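/- Let $\mathcal I$ be the category whose objects are the finite sets $\mathbf n=\{1,\dots,n\}$ for $n\ge 0$ (with $\mathbf 0=\emptyset$) and whose morphisms are all injective maps. An $\mathcal I$-space is a functor $X$ from $\mathcal I$ to (unbased) simplicial sets, and its Bousfield–Kan homotopy colimit is $$X_{h\mathcal I}=\operatorname{diag}\Big([s]\mapsto\coprod_{\mathbf n_0\leftarrow\cdots\leftarrow\mathbf n_s}X(\mathbf n_s)\Big),$$ the diagonal of a bisimplicial set. For an integer $\lambda$, a map $f\colon S\to T$ of simplicial sets is called $\lambda$-connected if its geometric realization induces a map $\pi_i(|S|,a)\to\pi_i(|T|,f(a))$ that is bijective for $0\le i<\lambda$ and surjective for $i=\lambda\ge 0$, for every base point $a\in|S|$ (for $i=0$ this is a condition on the sets of path components, imposed also if $S$ is empty; if $\lambda<0$ there is no condition). **Bökstedt's approximation lemma.** Let $X$ be an $\mathcal I$-space and suppose that there exists an unbounded, non-decreasing sequence of integers $\{\lambda_k \mid k\ge 0\}$ such that, for every $k \ge 0$, every morphism $\mathbf m\to\mathbf n$ in $\mathcal I$ with $m\ge k$ induces a $\lambda_k$-connected map $X(\mathbf m)\to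 X(\mathbf n)$. Then the canonical map $X(\mathbf n)\to X_{h\mathcal I}$ (induced by the inclusion $\{\mathbf n\}\to\mathcal I$) is $\lambda_n$-connected for all $n\ge 0$. -/

import Mathlib

open CategoryTheory Opposite Simplicial Topology

universe u

/-- The objects of the category `𝓘`: one object `⟨n⟩` for each finite set `{1, …, n}`, `n ≥ 0`
(with `{1, …, n}` modelled by `Fin n`). -/
structure InjCat : Type where
  /-- The number of elements. -/
  card : ℕ

/-- The category `𝓘` of the finite sets `{1, …, n}` and all injective maps between them. -/
instance InjCat.instCategory : SmallCategory InjCat where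
  Hom m n := Fin m.card ↪ Fin n.card
  id m := Function.Embedding.refl (Fin m.card)
  comp f g := Function.Embedding.trans f g

/-- An `𝓘`-space: a functor from `𝓘` to (unbased) simplicial sets. -/
abbrev ISpace : Type (u + 1) := InjCat ⥤ SSet.{u}

section HomotopyColimit

variable {J : Type} [SmallCategory J]

/-- For an `s`-simplex `n₀ ← n₁ ← ⋯ ← nₛ` of `J` (an `s`-simplex of the nerve of `Jᵒᵖ`),
the vertex `nₛ`. -/
def chainSource {s : ℕ} (σ : ComposableArrows Jᵒᵖ s) : J :=
  (σ.obj (Fin.last s)).unop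

/-- The simplicial operator `θ : [r] → [s]` acting on chains:
`n₀ ← ⋯ ← nₛ` is sent to `n_{θ(0)} ← ⋯ ← n_{θ(r)}`. -/
def chainPullback {r s : SimplexCategory} (θ : r ⟶ s) (σ : ComposableArrows Jᵒᵖ s.len) :
    ComposableArrows Jᵒᵖ r.len :=
  σ.whiskerLeft (SimplexCategory.toCat.map θ).toFunctor

/-- The composite morphism `nₛ → n_{θ(r)}` of `J` in a chain `n₀ ← ⋯ ← nₛ`. -/
def chainTransition {r s : SimplexCategory} (θ : r ⟶ s) (σ : ComposableArrows Jᵒᵖ s.len) :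
    chainSource σ ⟶ chainSource (chainPullback θ σ) :=
  (σ.map (homOfLE (Fin.le_last (θ.toOrderHom (Fin.last r.len))))).unop

/-- The simplicial set `∐_{n₀ ← ⋯ ← nₛ} X(nₛ)`, the coproduct being over all chains of `s`
composable morphisms of `J`. -/
def replacementLevel (X : J ⥤ SSet.{u}) (s : ℕ) : SSet.{u} where
  obj t := Σ σ : ComposableArrows Jᵒᵖ s, (X.obj (chainSource σ)).obj t
  map φ := ↾fun p ↦ ⟨p.1, (X.obj (chainSource p.1)).map φ p.2⟩

theorem map_app_of_eq_id (X : J ⥤ SSet.{u}) {j : J} (f : j ⟶ j) (h : f = 𝟙 j)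
    (t : SimplexCategoryᵒᵖ) (x : (X.obj j).obj t) : (X.map f).app t x = x := by
  subst h
  rw [X.map_id]
  rfl

theorem map_app_of_eq_comp (X : J ⥤ SSet.{u}) {i j k : J} (f : i ⟶ j) (g : j ⟶ k) (h : i ⟶ k)
    (e : h = f ≫ g) (t : SimplexCategoryᵒᵖ) (x : (X.obj i).obj t) :
    (X.map h).app t x = (X.map g).app t ((X.map f).app t x) := by
  subst e
  rw [X.map_comp]
  rfl

/-- The bisimplicial set `[s] ↦ ∐_{n₀ ← ⋯ ← nₛ} X(nₛ)` (the simplicial replacement of `X`).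
An operator `θ : [r] → [s]` sends the summand of `n₀ ← ⋯ ← nₛ` to that of
`n_{θ(0)} ← ⋯ ← n_{θ(r)}` by the map `X(nₛ) → X(n_{θ(r)})` induced by the chain. -/
def replacement (X : J ⥤ SSet.{u}) : SimplicialObject SSet.{u} where
  obj s := replacementLevel X s.unop.len
  map θ :=
    { app := fun t ↦ ↾fun p ↦
        ⟨chainPullback θ.unop p.1, (X.map (chainTransition θ.unop p.1)).app t p.2⟩
      naturality := fun _ _ φ ↦ by
        ext p
        exact congrArg (Sigma.mk (chainPullback θ.unop p.1))
          (ConcreteCategory.congr_hom ((X.map (chainTransition θ.unop p.1)).naturality φ) p.2) }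
  map_id s := by
    ext t p
    exact congrArg (Sigma.mk p.1) (map_app_of_eq_id X _
      (congrArg Quiver.Hom.unop (p.1.map_id (Fin.last s.unop.len))) t p.2)
  map_comp θ η := by
    ext t p
    exact congrArg (Sigma.mk (chainPullback (η.unop ≫ θ.unop) p.1)) (map_app_of_eq_comp X _ _ _
      (congrArg Quiver.Hom.unop (p.1.map_comp
        (homOfLE (θ.unop.toOrderHom.monotone (Fin.le_last (η.unop.toOrderHom (Fin.last _)))))
        (homOfLE (Fin.le_last _)))) t p.2)

/-- The diagonal `[s] ↦ Y_{s,s}` of a bisimplicial set `Y`. -/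
def bisimplicialDiag (Y : SimplicialObject SSet.{u}) : SSet.{u} :=
  Functor.diag SimplexCategoryᵒᵖ ⋙ Functor.uncurry.obj Y

/-- The Bousfield–Kan homotopy colimit `X_{hJ}` of a diagram `X : J ⥤ SSet`. -/
def hocolim (X : J ⥤ SSet.{u}) : SSet.{u} :=
  bisimplicialDiag (replacement X)

/-- The canonical map `X(j) → X_{hJ}`, induced by the inclusion `{j} → J`: a `t`-simplex `x` of
`X(j)` is sent to `x` in the summand of the constant chain `j = j = ⋯ = j`. -/
def toHocolim (X : J ⥤ SSet.{u}) (j : J) : X.obj j ⟶ hocolim X where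
  app t := ↾fun x ↦ ⟨(Functor.const (Fin (t.unop.len + 1))).obj (op j), x⟩
  naturality t t' φ := by
    ext x
    exact congrArg (Sigma.mk ((Functor.const (Fin (t'.unop.len + 1))).obj (op j)))
      (congrArg ((X.obj j).map φ) (map_app_of_eq_id X (𝟙 j) rfl t x).symm)

end HomotopyColimit

section ConnectedMaps

variable {A B : Type u} [TopologicalSpace A] [TopologicalSpace B]

/-- The map on sets of path components induced by a continuous map. -/
def pathComponentsMap (f : C(A, B)) : ZerothHomotopy A → ZerothHomotopy B :=
  ZerothHomotopy.lift (fun a ↦ ZerothHomotopy.mk (f a))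
    (fun _ _ p ↦ ZerothHomotopy.sound (p.map f.continuous))

/-- Composition of a map `(Iⁱ, ∂Iⁱ) → (A, a)` with `f`. -/
def genLoopMap (f : C(A, B)) (i : ℕ) (a : A) (p : GenLoop (Fin i) A a) :
    GenLoop (Fin i) B (f a) :=
  ⟨f.comp p.1, fun y hy ↦ congrArg f (p.2 y hy)⟩

/-- The map `πᵢ(A, a) → πᵢ(B, f(a))` induced by a continuous map `f`. -/
def homotopyGroupMap (f : C(A, B)) (i : ℕ) (a : A) : π_ i A a → π_ i B (f a) :=
  Quotient.map (genLoopMap f i a) (fun _ _ h ↦ h.comp_continuousMap f)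

/-- A continuous map `f : A → B` is `l`-connected, for an integer `l`, if for all base points
`a ∈ A` the map `πᵢ(A, a) → πᵢ(B, f(a))` is bijective for `i < l` and surjective for `i = l`
(equivalently: all homotopy fibres of `f` are `(l - 1)`-connected). For `i = 0` this is a condition
on the sets of path components, and makes sense also if `A` is empty. There is no condition
for `l < 0`. -/
structure IsConnectedMap (l : ℤ) (f : C(A, B)) : Prop where
  pi_zero_injective : 0 < l → Function.Injective (pathComponentsMap f)
  pi_zero_surjective : 0 ≤ l → Function.Surjective (pathComponentsMap f)
  pi_injective : ∀ i : ℕ, 1 ≤ i → (i : ℤ) < l → ∀ a : A, Function.Injective (homotopyGroupMap f i a)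
  pi_surjective : ∀ i : ℕ, 1 ≤ i → (i : ℤ) ≤ l → ∀ a : A,
    Function.Surjective (homotopyGroupMap f i a)

/-- A map of simplicial sets is `l`-connected if its geometric realization is. -/
def SSetIsConnectedMap (l : ℤ) {S T : SSet.{u}} (f : S ⟶ T) : Prop :=
  IsConnectedMap l (SSet.toTop.map f).hom

end ConnectedMaps

/-! Fix `n` and suppose that every map out of `X(n)` is `N`-connected. Let `T` be the endofunctor `m
↦ m ⊔ n` of `𝓘`. The inclusions of `n` into `m ⊔ n` form an objectwise `N`-connected transformation
from the constant diagram `X(n)` to `X ∘ T`, and homotopy colimits preserve such maps. Since `𝓘` has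
an initial object, the homotopy colimit of a constant diagram is its value up to homotopy. So `X(n)
→ X(n ⊔ n) → (X ∘ T)_{h𝓘}` is `N`-connected, and its second map is too because the first is. Replace
the first map by the one coming from the other inclusion of `n`: the composite, still `N`-connected,
is now `X(n) → X_{h𝓘} → (X ∘ T)_{h𝓘}`, whose second map is induced by the inclusions `m → m ⊔ n`.
Reindexing along `T` is a left homotopy inverse of that second map, because a transformation of
functors gives a homotopy of reindexing maps. Hence `X(n) → X_{h𝓘}` is `N`-connected
(`compressesUpTo_toHocolim`).

The main input is that homotopy colimits preserve connectivity (`CompressesUpTo.hocolimMap`). After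
realization, the map induced by `X → Y` is a retract of the one induced by `Sing|X| → Sing|Y|`,
which reduces the claim to diagrams of spaces; enlarging the targets by indiscrete factors reduces
it further to injective maps `F → E`. There the singular simplices of `E` whose faces of dimension
at most `N` lift to `F` form a subcomplex with anodyne inclusion. Filtering by skeleta of the nerve
shows that the homotopy colimit of these subcomplexes includes anodynely into that of `Sing E`. The
homotopy colimit of `Sing F` contains all its simplices of dimension at most `N`, so cellular
approximation finishes the argument.

Connectivity is treated as compression of pairs `(Iⁱ, ∂Iⁱ)` for `i ≤ N` (`CompressesUpTo`), which
behaves well under composition, retracts and homotopy. Realization is used through its adjunction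
with `Sing`, and concretely only for small complexes embedded in a simplex. -/

section HomotopyExtension

/-! ### Homotopy extension for cubes. -/

open scoped unitInterval

universe v

/-- The pair `(D, S)` has the homotopy extension property: `I × D` retracts onto
`{0} × D ∪ I × S`. -/
structure HasHEP (D : Type) [TopologicalSpace D] (S : Set D) : Prop where
  isClosed : IsClosed S
  exists_retraction : ∃ r : C(I × D, I × D), (∀ p, (r p).1 = 0 ∨ (r p).2 ∈ S) ∧
    ∀ p, (p.1 = 0 ∨ p.2 ∈ S) → r p = p

theorem continuous_of_isClosed_cover {X Y : Type*} [TopologicalSpace X] [TopologicalSpace Y]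
    {s t : Set X} (hs : IsClosed s) (ht : IsClosed t) (h : ∀ x, x ∈ s ∨ x ∈ t) {f : X → Y}
    (hfs : ContinuousOn f s) (hft : ContinuousOn f t) : Continuous f := by
  rw [← continuousOn_univ, ← Set.eq_univ_of_forall (s := s ∪ t) h]
  exact hfs.union_of_isClosed hft hs ht

variable {D : Type} [TopologicalSpace D] {S : Set D} {B : Type v} [TopologicalSpace B]

-- The map is `F ∘ r`. Although `F` need not be continuous on all of `I × D`, its composite with the
-- retraction is continuous on two closed sets that cover.
open Classical in
theorem HasHEP.extend (h : HasHEP D S) (b : C(D, B)) (k : C(I × S, B))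
    (hk : ∀ x : S, k (0, x) = b x) :
    ∃ H : C(I × D, B), (∀ x, H (0, x) = b x) ∧ ∀ t (x : S), H (t, x) = k (t, x) := by
  obtain ⟨r, hr, hr'⟩ := h.exists_retraction
  let F : I × D → B := fun p ↦ if hp : p.2 ∈ S then k (p.1, ⟨p.2, hp⟩) else b p.2
  have hF0 : ∀ p : I × D, p.1 = 0 → F p = b p.2 := by
    rintro ⟨t, x⟩ rfl
    by_cases hx : x ∈ S
    · simp only [F, hx, dif_pos]
      exact hk ⟨x, hx⟩
    · simp [F, hx]
  have hFS : ∀ (p : I × D) (hp : p.2 ∈ S), F p = k (p.1, ⟨p.2, hp⟩) := by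
    intro p hp
    simp [F, hp]
  have hs : IsClosed {p | (r p).1 = 0} :=
    isClosed_eq (continuous_fst.comp r.continuous) continuous_const
  have ht : IsClosed {p | (r p).2 ∈ S} := h.isClosed.preimage (continuous_snd.comp r.continuous)
  refine ⟨⟨fun p ↦ F (r p), continuous_of_isClosed_cover hs ht hr ?_ ?_⟩, fun x ↦ ?_, fun t x ↦ ?_⟩
  · refine ContinuousOn.congr (f := fun p ↦ b (r p).2) (by fun_prop) fun p hp ↦ hF0 _ hp
  · rw [continuousOn_iff_continuous_domRestrict]
    have : (Set.domRestrict {p | (r p).2 ∈ S} fun p ↦ F (r p)) =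
        fun p : {p | (r p).2 ∈ S} ↦ k ((r p.1).1, ⟨(r p.1).2, p.2⟩) := by
      funext p
      exact hFS _ p.2
    rw [this]
    fun_prop
  · simp only [ContinuousMap.coe_mk]
    rw [hr' _ (Or.inl rfl), hF0 _ rfl]
  · simp only [ContinuousMap.coe_mk]
    rw [hr' _ (Or.inr x.2), hFS _ x.2]

/-- The boundary `∂I × D ∪ I × S` of `I × D`. -/
def cylinderBoundary (S : Set D) : Set (I × D) :=
  {p | (p.1 = 0 ∨ p.1 = 1) ∨ p.2 ∈ S}

theorem HasHEP.congr {D' : Type} [TopologicalSpace D'] {S' : Set D'} (h : HasHEP D S)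
    (e : D ≃ₜ D') (he : ∀ x, e x ∈ S' ↔ x ∈ S) : HasHEP D' S' := by
  have he' : ∀ x, e.symm x ∈ S ↔ x ∈ S' := fun x ↦ by rw [← he]; simp
  obtain ⟨r, hr, hr'⟩ := h.exists_retraction
  refine ⟨?_, ⟨fun p ↦ ((r (p.1, e.symm p.2)).1, e (r (p.1, e.symm p.2)).2), by fun_prop⟩,
    fun p ↦ ?_, fun p hp ↦ ?_⟩
  · convert h.isClosed.preimage e.symm.continuous using 1
    ext x
    simp [he']
  · simpa [he] using hr (p.1, e.symm p.2)
  · have := hr' (p.1, e.symm p.2) (by simpa [he'] using hp)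
    simp [this]

theorem mem_cubeBoundary_iff {n : ℕ} (q : Fin n → I) :
    q ∈ Cube.boundary (Fin n) ↔ ∃ i, abs (2 * (q i : ℝ) - 1) = 1 := by
  refine exists_congr fun i ↦ ?_
  rw [abs_eq zero_le_one]
  constructor
  · rintro (h | h) <;> rw [h] <;> norm_num
  · rintro (h | h)
    · right; ext; push_cast; linarith
    · left; ext; push_cast; linarith

/-- In the coordinates `y = 2q - 1` this is the radial projection of `I × [-1, 1]ⁿ` from the point
`(2, 0)`: the vector from that point is divided by `m`, chosen so that the result meets the bottom
or a side face. -/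
theorem HasHEP.cube (n : ℕ) : HasHEP (Fin n → I) (Cube.boundary (Fin n)) := by
  let y : (Fin n → I) → Fin n → ℝ := fun q i ↦ 2 * (q i : ℝ) - 1
  have hyc : Continuous y := by fun_prop
  have hy1 : ∀ q i, abs (y q i) ≤ 1 := fun q i ↦ by
    have h0 := (q i).2.1
    have h1 := (q i).2.2
    rw [abs_le]
    constructor <;> simp only [y] <;> linarith
  have hy1' : ∀ q, ‖y q‖ ≤ 1 := fun q ↦ (pi_norm_le_iff_of_nonneg zero_le_one).2 fun i ↦ hy1 q i
  let m : I × (Fin n → I) → ℝ := fun p ↦ max ‖y p.2‖ ((2 - (p.1 : ℝ)) / 2)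
  have hmc : Continuous m := by fun_prop
  have hm0 : ∀ p, 0 < m p := fun p ↦ lt_max_of_lt_right (by linarith [p.1.2.2])
  have hm1 : ∀ p, m p ≤ 1 := fun p ↦ max_le (hy1' _) (by linarith [p.1.2.1])
  have hmt : ∀ p : I × (Fin n → I), (2 - (p.1 : ℝ)) / 2 ≤ m p := fun p ↦ le_max_right _ _
  have hym : ∀ p i, abs (y p.2 i) ≤ m p := fun p i ↦
    (norm_le_pi_norm (y p.2) i).trans (le_max_left _ _)
  have hdiv : ∀ p i, abs (y p.2 i / m p) ≤ 1 := fun p i ↦ by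
    rw [abs_div, abs_of_pos (hm0 p)]
    exact div_le_one_of_le₀ (hym p i) (hm0 p).le
  have hA : ∀ p : I × (Fin n → I), 2 - (2 - (p.1 : ℝ)) / m p ∈ I := fun p ↦ by
    have h1 : (2 - (p.1 : ℝ)) / m p ≤ 2 := by
      rw [div_le_iff₀ (hm0 p)]; linarith [hmt p]
    have h2 : 2 - (p.1 : ℝ) ≤ (2 - (p.1 : ℝ)) / m p := by
      rw [le_div_iff₀ (hm0 p)]
      nlinarith [hm1 p, p.1.2.2]
    exact ⟨by linarith, by linarith [p.1.2.2]⟩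
  have hB : ∀ (p : I × (Fin n → I)) (i), (y p.2 i / m p + 1) / 2 ∈ I := fun p i ↦ by
    have := abs_le.1 (hdiv p i)
    exact ⟨by linarith, by linarith⟩
  refine ⟨?_, ⟨fun p ↦ (⟨_, hA p⟩, fun i ↦ ⟨_, hB p i⟩), ?_⟩, fun p ↦ ?_, fun p hp ↦ ?_⟩
  · have : Cube.boundary (Fin n) = ⋃ i, Set.ofPred (fun q : Fin n → I ↦ q i = 0 ∨ q i = 1) := by
      ext q; simp [Cube.boundary]
    rw [this]
    exact isClosed_iUnion_of_finite fun i ↦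
      (isClosed_eq (continuous_apply i) continuous_const).union
        (isClosed_eq (continuous_apply i) continuous_const)
  · refine Continuous.prodMk (Continuous.subtype_mk ?_ _)
      (continuous_pi fun i ↦ Continuous.subtype_mk ?_ _)
    · exact continuous_const.sub ((by fun_prop : Continuous fun p : I × (Fin n → I) ↦
        2 - (p.1 : ℝ)).div hmc fun p ↦ (hm0 p).ne')
    · exact (((by fun_prop : Continuous fun p : I × (Fin n → I) ↦ y p.2 i).div hmc
        fun p ↦ (hm0 p).ne').add continuous_const).div_const _
  · by_cases h : ∃ i, abs (y p.2 i) = m p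
    · right
      obtain ⟨i, hi⟩ := h
      rw [mem_cubeBoundary_iff]
      refine ⟨i, ?_⟩
      simp only [ContinuousMap.coe_mk]
      rw [show 2 * ((y p.2 i / m p + 1) / 2) - 1 = y p.2 i / m p by ring, abs_div, hi,
        abs_of_pos (hm0 p), div_self (hm0 p).ne']
    · left
      push Not at h
      have h1 : ‖y p.2‖ < m p := (pi_norm_lt_iff (hm0 p)).2 fun i ↦ lt_of_le_of_ne (hym p i) (h i)
      have h2 : m p = (2 - (p.1 : ℝ)) / 2 := by
        rcases max_choice ‖y p.2‖ ((2 - (p.1 : ℝ)) / 2) with h3 | h3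
        · exact absurd h3.symm h1.ne
        · exact h3
      ext
      simp only [ContinuousMap.coe_mk, h2, Set.Icc.coe_zero]
      have : (2 - (p.1 : ℝ)) ≠ 0 := by linarith [p.1.2.2]
      field_simp
      ring
  · have h1 : m p = 1 := by
      refine le_antisymm (hm1 p) ?_
      rcases hp with hp | hp
      · refine le_trans ?_ (hmt p)
        rw [hp]; norm_num
      · obtain ⟨i, hi⟩ := (mem_cubeBoundary_iff _).1 hp
        exact hi.symm.le.trans (hym p i)
    ext
    · simp [h1]
    · simp [h1, y]

/-- The identification of `I × Iⁿ` with `Iⁿ⁺¹`. -/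
def cubeConsHomeomorph (n : ℕ) : I × (Fin n → I) ≃ₜ (Fin (n + 1) → I) where
  toFun p := Fin.cons p.1 p.2
  invFun q := (q 0, fun i ↦ q i.succ)
  left_inv p := by simp
  right_inv q := Fin.cons_self_tail q
  continuous_toFun := continuous_pi fun i ↦ by
    refine Fin.cases ?_ (fun j ↦ ?_) i
    · simpa using continuous_fst
    · simp only [Fin.cons_succ]; fun_prop
  continuous_invFun := by fun_prop

theorem cubeConsHomeomorph_mem_boundary (n : ℕ) (p : I × (Fin n → I)) :
    cubeConsHomeomorph n p ∈ Cube.boundary (Fin (n + 1)) ↔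
      p ∈ cylinderBoundary (Cube.boundary (Fin n)) := by
  change (∃ i, (Fin.cons p.1 p.2 : Fin (n + 1) → I) i = 0 ∨
    (Fin.cons p.1 p.2 : Fin (n + 1) → I) i = 1) ↔ _
  rw [Fin.exists_fin_succ]
  simp [Cube.boundary, cylinderBoundary]

theorem HasHEP.cylinder_cube (n : ℕ) :
    HasHEP (I × (Fin n → I)) (cylinderBoundary (Cube.boundary (Fin n))) :=
  (HasHEP.cube (n + 1)).congr (cubeConsHomeomorph n).symm fun x ↦ by
    rw [← cubeConsHomeomorph_mem_boundary]; simp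

/-- The time `t` map of a homotopy. -/
def homotopyAt (u : C(I × D, B)) (t : I) : C(D, B) := ⟨fun x ↦ u (t, x), by fun_prop⟩

@[simp] theorem homotopyAt_apply (u : C(I × D, B)) (t : I) (x : D) :
    homotopyAt u t x = u (t, x) := rfl

open Classical in
/-- If two homotopies agree on `S` and their ends at time `1` are homotopic relative to `S`, then so
are their ends at time `0`. -/
theorem HasHEP.homotopicRel_zero (hS : IsClosed S) (h : HasHEP (I × D) (cylinderBoundary S))
    (u v : C(I × D, B)) (huv : ∀ t, ∀ x ∈ S, u (t, x) = v (t, x))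
    (h1 : (homotopyAt u 1).HomotopicRel (homotopyAt v 1) S) :
    (homotopyAt u 0).HomotopicRel (homotopyAt v 0) S := by
  obtain ⟨K⟩ := h1
  -- Fill a box with base `K` whose walls are `u` and `v` run backwards from time `1`; the opposite
  -- face is the desired homotopy. Over `S` the two walls agree by `huv`.
  let k : I × cylinderBoundary S → B := fun p ↦
    if p.2.1.1 = 0 then u (σ p.1, p.2.1.2) else v (σ p.1, p.2.1.2)
  have hk0 : ∀ p : I × cylinderBoundary S, p.2.1.1 = 0 → k p = u (σ p.1, p.2.1.2) :=
    fun p hp ↦ if_pos hp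
  have hk1 : ∀ p : I × cylinderBoundary S, p.2.1.1 = 1 ∨ p.2.1.2 ∈ S →
      k p = v (σ p.1, p.2.1.2) := fun p hp ↦ by
    by_cases h0 : p.2.1.1 = 0
    · rcases hp with hp | hp
      · simp [h0] at hp
      · rw [hk0 _ h0, huv _ _ hp]
    · exact if_neg h0
  have hkc : Continuous k := by
    refine continuous_of_isClosed_cover
      (s := {p | p.2.1.1 = 0}) (t := {p | p.2.1.1 = 1 ∨ p.2.1.2 ∈ S})
      (isClosed_eq (f := fun p : I × cylinderBoundary S ↦ p.2.1.1) (by fun_prop) continuous_const)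
      ?_ (fun p ↦ ?_) ?_ ?_
    · exact IsClosed.union (isClosed_eq (f := fun p : I × cylinderBoundary S ↦ p.2.1.1)
        (by fun_prop) continuous_const)
        (hS.preimage (f := fun p : I × cylinderBoundary S ↦ p.2.1.2) (by fun_prop))
    · have := p.2.2
      simp only [cylinderBoundary, Set.mem_ofPred_eq] at this ⊢
      tauto
    · exact ContinuousOn.congr (f := fun p ↦ u (σ p.1, p.2.1.2)) (by fun_prop) fun p hp ↦ hk0 p hp
    · exact ContinuousOn.congr (f := fun p ↦ v (σ p.1, p.2.1.2)) (by fun_prop) fun p hp ↦ hk1 p hp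
  obtain ⟨H, -, hH⟩ := h.extend K.toContinuousMap ⟨k, hkc⟩ (fun x ↦ by
    obtain ⟨⟨s, x⟩, hx⟩ := x
    rcases id hx with (hs | hs) | hx
    · rw [ContinuousMap.coe_mk, hk0 _ hs]
      dsimp only at hs
      subst hs
      simp
    · rw [ContinuousMap.coe_mk, hk1 _ (Or.inl hs)]
      dsimp only at hs
      subst hs
      simp
    · rw [ContinuousMap.coe_mk, hk1 _ (Or.inr hx)]
      exact (by simp : v (σ 0, x) = homotopyAt v 1 x).trans (K.eq_snd s hx).symm)
  refine ⟨⟨⟨⟨fun p ↦ H (1, p), by fun_prop⟩, fun x ↦ ?_, fun x ↦ ?_⟩, fun t x hx ↦ ?_⟩⟩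
  · have := hH 1 ⟨(0, x), Or.inl (Or.inl rfl)⟩
    simp only [ContinuousMap.coe_mk] at this ⊢
    rw [this, hk0 _ rfl]
    simp
  · have := hH 1 ⟨(1, x), Or.inl (Or.inr rfl)⟩
    simp only [ContinuousMap.coe_mk] at this ⊢
    rw [this, hk1 _ (Or.inl rfl)]
    simp
  · have := hH 1 ⟨(t, x), Or.inr hx⟩
    simp only [ContinuousMap.coe_mk] at this ⊢
    rw [this, hk1 _ (Or.inr hx)]
    simp [huv 0 x hx]

theorem HasHEP.homotopicRel_one (hS : IsClosed S) (h : HasHEP (I × D) (cylinderBoundary S))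
    (u v : C(I × D, B)) (huv : ∀ t, ∀ x ∈ S, u (t, x) = v (t, x))
    (h1 : (homotopyAt u 0).HomotopicRel (homotopyAt v 0) S) :
    (homotopyAt u 1).HomotopicRel (homotopyAt v 1) S := by
  let rev : C(I × D, I × D) := ⟨fun p ↦ (σ p.1, p.2), by fun_prop⟩
  have := h.homotopicRel_zero hS (u.comp rev) (v.comp rev) (fun t x hx ↦ huv _ x hx)
    (by convert! h1 using 1 <;> ext <;> simp [rev])
  convert! this using 1 <;> ext <;> simp [rev]

end HomotopyExtension

/-! ### Compression of maps of pairs and its stability properties. -/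

section LiftsRel

open scoped unitInterval

universe v w

variable {A B C : Type u} [TopologicalSpace A] [TopologicalSpace B] [TopologicalSpace C]

/-- Maps of pairs `(D, S) → (B, A)` can be compressed into `A` relative to `S`, up to homotopy,
along `f : A → B`. -/
def LiftsRel (D : Type) [TopologicalSpace D] (S : Set D) (f : C(A, B)) : Prop :=
  ∀ (a : C(S, A)) (b : C(D, B)), (∀ x : S, f (a x) = b x) →
    ∃ a' : C(D, A), (∀ x : S, a' x = a x) ∧ (f.comp a').HomotopicRel b S

variable {D : Type} [TopologicalSpace D] {S : Set D}

theorem HomotopicRel.precomp {X Y Z : Type*} [TopologicalSpace X] [TopologicalSpace Y]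
    [TopologicalSpace Z] {f g : C(Y, Z)} {T : Set Y} (h : f.HomotopicRel g T) (e : C(X, Y)) :
    (f.comp e).HomotopicRel (g.comp e) (e ⁻¹' T) := by
  obtain ⟨K⟩ := h
  refine ⟨⟨⟨⟨fun p ↦ K (p.1, e p.2), by fun_prop⟩, fun x ↦ ?_, fun x ↦ ?_⟩, fun t x hx ↦ ?_⟩⟩
  · simp
  · simp
  · simpa using K.eq_fst t hx

theorem LiftsRel.congr {f : C(A, B)} (h : LiftsRel D S f) {D' : Type} [TopologicalSpace D']
    {S' : Set D'} (e : D ≃ₜ D') (he : ∀ x, e x ∈ S' ↔ x ∈ S) : LiftsRel D' S' f := by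
  intro a b hab
  obtain ⟨a', ha', h'⟩ := h (a.comp ⟨fun x ↦ ⟨e x, (he x).2 x.2⟩, by fun_prop⟩)
    (b.comp e) (fun x ↦ hab ⟨e x, (he x).2 x.2⟩)
  refine ⟨a'.comp e.symm, fun x ↦ ?_, ?_⟩
  · have := ha' ⟨e.symm x, by rw [← he]; simp⟩
    simpa using this
  · convert! HomotopicRel.precomp h' (e.symm : C(D', D)) using 1
    · ext; simp
    · ext x; simp [← he]

theorem LiftsRel.refl : LiftsRel D S (ContinuousMap.id A) := fun _ b hab ↦
  ⟨b, fun x ↦ (hab x).symm, ContinuousMap.HomotopicRel.refl _⟩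

theorem LiftsRel.comp {f : C(A, B)} {g : C(B, C)} (hf : LiftsRel D S f) (hg : LiftsRel D S g) :
    LiftsRel D S (g.comp f) := by
  intro a b hab
  obtain ⟨b', hb', h⟩ := hg (f.comp a) b hab
  obtain ⟨a', ha', h'⟩ := hf a b' fun x ↦ (hb' x).symm
  exact ⟨a', ha', (h'.comp_continuousMap g).trans h⟩

theorem LiftsRel.retract {A' B' : Type u} [TopologicalSpace A'] [TopologicalSpace B']
    {f : C(A, B)} (hf : LiftsRel D S f) (g : C(A', B')) (i : C(A', A)) (j : C(B', B))
    (r : C(A, A')) (q : C(B, B')) (hri : ∀ x, r (i x) = x) (hqj : ∀ x, q (j x) = x)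
    (hi : ∀ x, f (i x) = j (g x)) (hr : ∀ x, g (r x) = q (f x)) : LiftsRel D S g := by
  intro a b hab
  obtain ⟨a', ha', h'⟩ := hf (i.comp a) (j.comp b) fun x ↦ by simp [hi, hab]
  refine ⟨r.comp a', fun x ↦ by simp [ha', hri], ?_⟩
  convert! h'.comp_continuousMap q using 1
  · ext; simp [hr]
  · ext; simp [hqj]

/-- The homotopy obtained by applying a homotopy `F` pointwise to a map. -/
def homotopyComp {f g : C(A, B)} (F : f.Homotopy g) (a : C(D, A)) : C(I × D, B) :=
  ⟨fun p ↦ F (p.1, a p.2), by fun_prop⟩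

/-- Compress after applying `s`, apply `r`, and transport the result along the homotopy from `r ∘ s`
to the identity; the two transported maps agree on `S` at all times. -/
theorem LiftsRel.cancel (hS : IsClosed S) (h : HasHEP (I × D) (cylinderBoundary S))
    {ι : C(A, B)} {s : C(B, C)} {r : C(C, B)}
    (hs : LiftsRel D S (s.comp ι)) (hr : (r.comp s).Homotopic (ContinuousMap.id B)) :
    LiftsRel D S ι := by
  intro a b hab
  obtain ⟨a', ha', h'⟩ := hs a (s.comp b) fun x ↦ by simp [hab]
  refine ⟨a', ha', ?_⟩
  obtain ⟨F⟩ := hr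
  have := h.homotopicRel_one hS (homotopyComp F (ι.comp a')) (homotopyComp F b)
    (fun t x hx ↦ by
      have := hab ⟨x, hx⟩
      simp [homotopyComp, ha' ⟨x, hx⟩, this])
    (by
      convert! h'.comp_continuousMap r using 1
      · ext; simp [homotopyComp]
      · ext; simp [homotopyComp])
  convert! this using 1
  · ext; simp [homotopyComp]
  · ext; simp [homotopyComp]

/-- Drag the lower edge along the homotopy by homotopy extension, solve the problem for `f`, and
drag back. -/
theorem LiftsRel.of_homotopic (hS : HasHEP D S) (h : HasHEP (I × D) (cylinderBoundary S))
    {f g : C(A, B)} (hf : LiftsRel D S f) (hfg : g.Homotopic f) : LiftsRel D S g := by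
  intro a b hab
  obtain ⟨F⟩ := hfg
  obtain ⟨H, hH0, hH⟩ := hS.extend b (homotopyComp F a) (fun x ↦ by simp [homotopyComp, hab])
  obtain ⟨a', ha', h'⟩ := hf a (homotopyAt H 1) (fun x ↦ by simp [hH, homotopyComp])
  refine ⟨a', ha', ?_⟩
  have := h.homotopicRel_zero hS.isClosed (homotopyComp F a') H
    (fun t x hx ↦ by
      rw [hH t ⟨x, hx⟩]
      simp [homotopyComp, ha' ⟨x, hx⟩])
    (by
      convert! h' using 1
      ext; simp [homotopyComp])
  convert! this using 1
  · ext; simp [homotopyComp]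
  · ext; simp [hH0]

/-- A map `f : A → B` such that maps of pairs `(Iⁱ, ∂Iⁱ) → (B, A)` can be compressed for `i ≤ N`. -/
def CompressesUpTo (N : ℕ) (f : C(A, B)) : Prop :=
  ∀ i ≤ N, LiftsRel (Fin i → I) (Cube.boundary (Fin i)) f

theorem CompressesUpTo.comp {N : ℕ} {f : C(A, B)} {g : C(B, C)} (hf : CompressesUpTo N f)
    (hg : CompressesUpTo N g) : CompressesUpTo N (g.comp f) :=
  fun i hi ↦ (hf i hi).comp (hg i hi)

theorem CompressesUpTo.cancel {N : ℕ} {ι : C(A, B)} {s : C(B, C)} {r : C(C, B)}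
    (hs : CompressesUpTo N (s.comp ι)) (hr : (r.comp s).Homotopic (ContinuousMap.id B)) :
    CompressesUpTo N ι :=
  fun i hi ↦ (hs i hi).cancel (HasHEP.cube i).isClosed (HasHEP.cylinder_cube i) hr

theorem CompressesUpTo.of_homotopic {N : ℕ} {f g : C(A, B)} (hf : CompressesUpTo N f)
    (hfg : g.Homotopic f) : CompressesUpTo N g :=
  fun i hi ↦ (hf i hi).of_homotopic (HasHEP.cube i) (HasHEP.cylinder_cube i) hfg

theorem CompressesUpTo.refl {N : ℕ} : CompressesUpTo N (ContinuousMap.id A) :=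
  fun _ _ ↦ LiftsRel.refl

theorem CompressesUpTo.of_homotopyInverse {N : ℕ} {f : C(A, B)} {g : C(B, A)}
    (h : (g.comp f).Homotopic (ContinuousMap.id A))
    (h' : (f.comp g).Homotopic (ContinuousMap.id B)) : CompressesUpTo N f :=
  CompressesUpTo.cancel (s := g) (r := f) (CompressesUpTo.refl.of_homotopic h) h'

end LiftsRel

/-! ### Homotopy invariance of lifting problems and two-out-of-three. -/

section Liftable

open scoped unitInterval

variable {A B C : Type u} [TopologicalSpace A] [TopologicalSpace B] [TopologicalSpace C]
variable {D : Type} [TopologicalSpace D] {S : Set D}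

/-- All lifting problems up to homotopy relative to `S` with the given upper edge `a : S → A` have
a solution. -/
def Liftable (f : C(A, B)) (a : C(S, A)) : Prop :=
  ∀ b : C(D, B), (∀ x : S, f (a x) = b x) →
    ∃ a' : C(D, A), (∀ x : S, a' x = a x) ∧ (f.comp a').HomotopicRel b S

theorem HasHEP.extend_one (h : HasHEP D S) (b : C(D, B)) (k : C(I × S, B))
    (hk : ∀ x : S, k (1, x) = b x) :
    ∃ H : C(I × D, B), (∀ x, H (1, x) = b x) ∧ ∀ t (x : S), H (t, x) = k (t, x) := by
  obtain ⟨H, h0, h1⟩ := h.extend b (k.comp ⟨fun p ↦ (σ p.1, p.2), by fun_prop⟩)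
    (fun x ↦ by simp [hk])
  exact ⟨H.comp ⟨fun p ↦ (σ p.1, p.2), by fun_prop⟩, fun x ↦ by simp [h0], fun t x ↦ by simp [h1]⟩

/-- Homotopy extension moves the lower edge along `f ∘ k` and the solution back along `k`. Thus
solvability for all lower edges depends only on the homotopy class of the upper edge. -/
theorem Liftable.of_homotopy (hS : HasHEP D S) (h : HasHEP (I × D) (cylinderBoundary S))
    {f : C(A, B)} (k : C(I × S, A)) {a₀ a₁ : C(S, A)} (h0 : ∀ x, k (0, x) = a₀ x)
    (h1 : ∀ x, k (1, x) = a₁ x) (ha : Liftable f a₁) : Liftable f a₀ := by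
  intro b hb
  obtain ⟨H, H0, H1⟩ := hS.extend b (f.comp k) (fun x ↦ by simp [h0, hb])
  obtain ⟨a', ha', h'⟩ := ha (homotopyAt H 1) (fun x ↦ by simp [H1, h1])
  obtain ⟨G, G0, G1⟩ := hS.extend_one a' k (fun x ↦ by simp [ha', h1])
  refine ⟨homotopyAt G 0, fun x ↦ by simp [G1, h0], ?_⟩
  have := h.homotopicRel_zero hS.isClosed (f.comp G) H
    (fun t x hx ↦ by simp [H1 t ⟨x, hx⟩, G1 t ⟨x, hx⟩])
    (by convert! h' using 1; ext; simp [G0])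
  convert! this using 1
  ext; simp [H0]

open Classical in
/-- Glue a homotopy on the face `{0} × D` and a homotopy on the remaining part of the boundary of
`I × D`. -/
theorem exists_glue_face (hS : IsClosed S) (P : C(I × D, A)) (R : C(I × (I × D), A))
    (h : ∀ s, ∀ x ∈ S, P (s, x) = R (s, (0, x))) :
    ∃ k : C(I × cylinderBoundary S, A),
      (∀ s (p : cylinderBoundary S), p.1.1 = 0 → k (s, p) = P (s, p.1.2)) ∧
      ∀ s (p : cylinderBoundary S), p.1.1 = 1 ∨ p.1.2 ∈ S → k (s, p) = R (s, p) := by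
  let k : I × cylinderBoundary S → A := fun p ↦
    if p.2.1.1 = 0 then P (p.1, p.2.1.2) else R (p.1, p.2)
  have hk0 : ∀ p : I × cylinderBoundary S, p.2.1.1 = 0 → k p = P (p.1, p.2.1.2) :=
    fun p hp ↦ if_pos hp
  have hk1 : ∀ p : I × cylinderBoundary S, p.2.1.1 = 1 ∨ p.2.1.2 ∈ S →
      k p = R (p.1, p.2) := fun p hp ↦ by
    by_cases h0 : p.2.1.1 = 0
    · rcases hp with hp | hp
      · simp [h0] at hp
      · rw [hk0 _ h0, h _ _ hp, ← h0]
    · exact if_neg h0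
  refine ⟨⟨k, continuous_of_isClosed_cover
      (s := {p | p.2.1.1 = 0}) (t := {p | p.2.1.1 = 1 ∨ p.2.1.2 ∈ S})
      (isClosed_eq (f := fun p : I × cylinderBoundary S ↦ p.2.1.1) (by fun_prop) continuous_const)
      ?_ (fun p ↦ ?_) ?_ ?_⟩, fun s p hp ↦ hk0 _ hp, fun s p hp ↦ hk1 _ hp⟩
  · exact IsClosed.union (isClosed_eq (f := fun p : I × cylinderBoundary S ↦ p.2.1.1)
      (by fun_prop) continuous_const)
      (hS.preimage (f := fun p : I × cylinderBoundary S ↦ p.2.1.2) (by fun_prop))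
  · have := p.2.2
    simp only [cylinderBoundary, Set.mem_ofPred_eq] at this ⊢
    tauto
  · exact ContinuousOn.congr (f := fun p ↦ P (p.1, p.2.1.2)) (by fun_prop) fun p hp ↦ hk0 p hp
  · exact ContinuousOn.congr (f := fun p ↦ R (p.1, p.2)) (by fun_prop) fun p hp ↦ hk1 p hp

/-- The restriction to the boundary. -/
def restrictTo (S : Set D) (a : C(D, A)) : C(S, A) := ⟨fun x ↦ a x, by fun_prop⟩

@[simp] theorem restrictTo_apply (a : C(D, A)) (x : S) : restrictTo S a x = a x := rfl

/-- A retraction of `I × D` onto `{1} × D ∪ I × S`. -/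
theorem HasHEP.exists_retraction_one (h : HasHEP D S) :
    ∃ r : C(I × D, I × D), (∀ p, (r p).1 = 1 ∨ (r p).2 ∈ S) ∧
    ∀ p, (p.1 = 1 ∨ p.2 ∈ S) → r p = p := by
  obtain ⟨r, h0, h1⟩ := h.exists_retraction
  refine ⟨⟨fun p ↦ (σ (r (σ p.1, p.2)).1, (r (σ p.1, p.2)).2), by fun_prop⟩, fun p ↦ ?_,
    fun p hp ↦ ?_⟩
  · simpa using h0 (σ p.1, p.2)
  · have := h1 (σ p.1, p.2) (by simpa using hp)
    simp [this]

/-- Two maps which agree on `S` are homotopic relative to `S` if their images under `f` are. -/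
def RelInjective (D : Type) [TopologicalSpace D] (S : Set D) (f : C(A, B)) : Prop :=
  ∀ u v : C(D, A), (∀ x ∈ S, u x = v x) → (f.comp u).HomotopicRel (f.comp v) S →
    u.HomotopicRel v S

/-- The homotopy downstairs is a lifting problem on `I × D` whose boundary is lifted by `u` on the
face `0` and by `v` elsewhere; its solution is a homotopy upstairs. -/
theorem LiftsRel.relInjective (hS : IsClosed S) {f : C(A, B)}
    (hf : LiftsRel (I × D) (cylinderBoundary S) f) : RelInjective D S f := by
  rintro u v huv ⟨K⟩
  obtain ⟨k, k0, k1⟩ := exists_glue_face hS (⟨fun p ↦ u p.2, by fun_prop⟩ : C(I × D, A))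
    (⟨fun p ↦ v p.2.2, by fun_prop⟩ : C(I × (I × D), A)) (fun s x hx ↦ huv x hx)
  obtain ⟨a', ha', -⟩ := hf ⟨fun p ↦ k (0, p), by fun_prop⟩ K.toContinuousMap (fun p ↦ by
    obtain ⟨⟨t, x⟩, hp⟩ := p
    rcases id hp with (ht | ht) | hx
    · dsimp only at ht
      subst ht
      simp [k0 0 ⟨(0, x), hp⟩ rfl]
    · dsimp only at ht
      subst ht
      simp [k1 0 ⟨(1, x), hp⟩ (Or.inl rfl)]
    · have h2 := k1 0 ⟨(t, x), hp⟩ (Or.inr hx)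
      simp only [ContinuousMap.coe_mk, h2]
      exact (K.eq_snd t hx).symm)
  refine ⟨⟨⟨a', fun x ↦ ?_, fun x ↦ ?_⟩, fun t x hx ↦ ?_⟩⟩
  · rw [ContinuousMap.toFun_eq_coe, ha' ⟨(0, x), Or.inl (Or.inl rfl)⟩]
    simp [k0 0 ⟨(0, x), Or.inl (Or.inl rfl)⟩ rfl]
  · rw [ContinuousMap.toFun_eq_coe, ha' ⟨(1, x), Or.inl (Or.inr rfl)⟩]
    simp [k1 0 ⟨(1, x), Or.inl (Or.inr rfl)⟩ (Or.inl rfl)]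
  · refine (ha' ⟨(t, x), Or.inr hx⟩).trans ?_
    simp [k1 0 ⟨(t, x), Or.inr hx⟩ (Or.inr hx), huv x hx]

/-- The part of `a` on `{1} × D ∪ I × S` extends over `I × D` to `a₁`. On the face `0` the maps `a₀`
and `a₁` become homotopic relative to `S` after `f`, hence are so already. This deforms `a` to the
restriction of `a₁`, where `hs` applies. In this way injectivity in one dimension and surjectivity
in the next combine to compression. -/
theorem LiftsRel.of_relInjective (hS : HasHEP D S) (hQ : HasHEP (I × D) (cylinderBoundary S))
    (hQQ : HasHEP (I × (I × D)) (cylinderBoundary (cylinderBoundary S)))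
    {f : C(A, B)} (hi : RelInjective D S f)
    (hs : ∀ a : C(I × D, A), Liftable f (restrictTo (cylinderBoundary S) a)) :
    LiftsRel (I × D) (cylinderBoundary S) f := by
  intro a b hab
  obtain ⟨r, hr, hr'⟩ := hS.exists_retraction_one
  let a₁ : C(I × D, A) := ⟨fun p ↦ a ⟨r p, (hr p).imp Or.inr id⟩, by fun_prop⟩
  have ha₁ : ∀ p (hp : p.1 = 1 ∨ p.2 ∈ S), a₁ p = a ⟨p, hp.imp Or.inr id⟩ := fun p hp ↦ by
    simp only [a₁, ContinuousMap.coe_mk]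
    congr
    exact hr' p hp
  let a₀ : C(D, A) := ⟨fun x ↦ a ⟨(0, x), Or.inl (Or.inl rfl)⟩, by fun_prop⟩
  obtain ⟨G⟩ := hi a₀ (homotopyAt a₁ 0) (fun x hx ↦ by
    simp [ha₁ (0, x) (Or.inr hx), a₀]) (by
    have := hQ.homotopicRel_zero hS.isClosed b (f.comp a₁) (fun t x hx ↦ by
      simp [ha₁ (t, x) (Or.inr hx), hab]) (by
      convert! ContinuousMap.HomotopicRel.refl (homotopyAt b 1) using 1
      ext x
      simp [ha₁ (1, x) (Or.inl rfl), hab])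
    convert! this using 1
    ext x
    simp [a₀, hab])
  obtain ⟨k, k0, k1⟩ := exists_glue_face hS.isClosed G.toContinuousMap
    (⟨fun p ↦ a₁ p.2, by fun_prop⟩ : C(I × (I × D), A)) (fun s x hx ↦ by
      exact G.eq_snd s hx)
  refine Liftable.of_homotopy hQ hQQ k (fun p ↦ ?_) (fun p ↦ ?_) (hs a₁) b hab
  · obtain ⟨⟨t, x⟩, hp⟩ := p
    have key : ∀ ht : t = 1 ∨ x ∈ S, k (0, ⟨(t, x), hp⟩) = a ⟨(t, x), hp⟩ := fun ht ↦ by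
      rw [k1 _ _ ht]
      simp [ha₁ (t, x) ht]
    rcases id hp with (ht | ht) | hx
    · rw [k0 _ _ ht]
      dsimp only at ht
      subst ht
      simp [a₀]
    · exact key (Or.inl ht)
    · exact key (Or.inr hx)
  · obtain ⟨⟨t, x⟩, hp⟩ := p
    rcases id hp with (ht | ht) | hx
    · rw [k0 _ _ ht]
      dsimp only at ht
      subst ht
      simp
    · rw [k1 _ _ (Or.inl ht)]
      simp
    · rw [k1 _ _ (Or.inr hx)]
      simp

/-- If lifts exist for a point, then any map from a contractible space lifts up to homotopy. -/
theorem exists_lift_of_contractible {f : C(A, B)} {E : Type} [TopologicalSpace E]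
    (c : C(I × E, E)) (e₀ : E) (h0 : ∀ x, c (0, x) = x) (h1 : ∀ x, c (1, x) = e₀)
    (hf : LiftsRel (Fin 0 → I) (Cube.boundary (Fin 0)) f) (β : C(E, B)) :
    ∃ (a : A) (M : C(I × E, B)), (∀ x, M (0, x) = β x) ∧ ∀ x, M (1, x) = f a := by
  obtain ⟨a', -, ⟨K⟩⟩ := hf ⟨fun x ↦ (x.2.choose).elim0, continuous_of_const fun x ↦
    (x.2.choose).elim0⟩ (ContinuousMap.const _ (β e₀)) (fun x ↦ (x.2.choose).elim0)
  let z : Fin 0 → I := fun i ↦ i.elim0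
  let L : (f.comp (ContinuousMap.const E (a' z))).Homotopy (ContinuousMap.const E (β e₀)) :=
    ⟨⟨fun p ↦ K (p.1, z), by fun_prop⟩, fun x ↦ by simp, fun x ↦ by simp⟩
  let L' : β.Homotopy (ContinuousMap.const E (β e₀)) :=
    ⟨⟨fun p ↦ β (c p), by fun_prop⟩, fun x ↦ by simp [h0], fun x ↦ by simp [h1]⟩
  exact ⟨a' z, (L'.trans L.symm).toContinuousMap, fun x ↦ (L'.trans L.symm).apply_zero x,
    fun x ↦ (L'.trans L.symm).apply_one x⟩

/-- Up to homotopy, the upper edge `β` comes from `A`: all of the boundary but one face contracts to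
a point in the image of `f`, and the remaining face, then constant on `S`, is compressed along `f`.
The hypothesis on `g ∘ f` solves the problem with the new upper edge. -/
theorem LiftsRel.of_comp (hS : HasHEP D S) (hQ : HasHEP (I × D) (cylinderBoundary S))
    (hQQ : HasHEP (I × (I × D)) (cylinderBoundary (cylinderBoundary S)))
    (c : C(I × (I × D), (I × D))) (e₀ : I × D) (h0 : ∀ x, c (0, x) = x) (h1 : ∀ x, c (1, x) = e₀)
    {f : C(A, B)} {g : C(B, C)}
    (hf₀ : LiftsRel (Fin 0 → I) (Cube.boundary (Fin 0)) f)
    (hf : LiftsRel D S f) (hgf : LiftsRel (I × D) (cylinderBoundary S) (g.comp f)) :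
    LiftsRel (I × D) (cylinderBoundary S) g := by
  intro β
  change Liftable g β
  obtain ⟨r, hr, hr'⟩ := hS.exists_retraction_one
  let β₁ : C(I × D, B) := ⟨fun p ↦ β ⟨r p, (hr p).imp Or.inr id⟩, by fun_prop⟩
  have hβ₁ : ∀ p (hp : p.1 = 1 ∨ p.2 ∈ S), β₁ p = β ⟨p, hp.imp Or.inr id⟩ := fun p hp ↦ by
    simp only [β₁, ContinuousMap.coe_mk]
    congr
    exact hr' p hp
  let β₀ : C(D, B) := ⟨fun x ↦ β ⟨(0, x), Or.inl (Or.inl rfl)⟩, by fun_prop⟩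
  obtain ⟨z, M, M0, M1⟩ := exists_lift_of_contractible c e₀ h0 h1 hf₀ β₁
  obtain ⟨H, H0, H1⟩ := hS.extend β₀ ⟨fun p ↦ M (p.1, (0, p.2)), by fun_prop⟩ (fun x ↦ by
    simp [M0, hβ₁ (0, x) (Or.inr x.2), β₀])
  obtain ⟨α, hα, ⟨K⟩⟩ := hf (ContinuousMap.const _ z) (homotopyAt H 1) (fun x ↦ by
    simp [H1, M1])
  -- `k₁` contracts the part away from the face `0` to `f z`, `k₂` moves that face from the end of
  -- `H` to `f ∘ α`, and `k₃`, constant in time, is the resulting upper edge in `A`.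
  obtain ⟨k₁, k10, k11⟩ := exists_glue_face hS.isClosed H M (fun s x hx ↦ H1 s ⟨x, hx⟩)
  obtain ⟨k₂, k20, k21⟩ := exists_glue_face hS.isClosed K.symm.toContinuousMap
    (ContinuousMap.const _ (f z)) (fun s x hx ↦ by
      refine (K.symm.eq_snd s hx).trans ?_
      simp [hα ⟨x, hx⟩])
  obtain ⟨k₃, k30, k31⟩ := exists_glue_face hS.isClosed (⟨fun p ↦ α p.2, by fun_prop⟩ : C(I × D, A))
    (ContinuousMap.const _ z) (fun s x hx ↦ by simp [hα ⟨x, hx⟩])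
  refine Liftable.of_homotopy hQ hQQ k₁ (a₁ := k₁.comp ⟨fun p ↦ (1, p), by fun_prop⟩)
    (fun p ↦ ?_) (fun p ↦ rfl) (Liftable.of_homotopy hQ hQQ k₂
    (a₁ := f.comp (k₃.comp ⟨fun p ↦ (0, p), by fun_prop⟩)) (fun p ↦ ?_) (fun p ↦ ?_) ?_)
  · obtain ⟨⟨t, x⟩, hp⟩ := p
    have key : ∀ ht : t = 1 ∨ x ∈ S, k₁ (0, ⟨(t, x), hp⟩) = β ⟨(t, x), hp⟩ := fun ht ↦ by
      rw [k11 _ _ ht]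
      simp [M0, hβ₁ (t, x) ht]
    rcases id hp with (ht | ht) | hx
    · rw [k10 _ _ ht]
      dsimp only at ht
      subst ht
      simp [H0, β₀]
    · exact key (Or.inl ht)
    · exact key (Or.inr hx)
  · obtain ⟨⟨t, x⟩, hp⟩ := p
    have key : ∀ ht : t = 1 ∨ x ∈ S, k₂ (0, ⟨(t, x), hp⟩) = k₁ (1, ⟨(t, x), hp⟩) := fun ht ↦ by
      rw [k11 _ _ ht, k21 _ _ ht]
      simp [M1]
    rcases id hp with (ht | ht) | hx
    · rw [k20 _ _ ht]
      simp only [ContinuousMap.comp_apply, ContinuousMap.coe_mk]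
      rw [k10 _ _ ht]
      exact K.symm.apply_zero x
    · exact key (Or.inl ht)
    · exact key (Or.inr hx)
  · obtain ⟨⟨t, x⟩, hp⟩ := p
    have key : ∀ ht : t = 1 ∨ x ∈ S, k₂ (1, ⟨(t, x), hp⟩) = f (k₃ (0, ⟨(t, x), hp⟩)) := fun ht ↦ by
      rw [k21 _ _ ht, k31 _ _ ht]
      simp
    rcases id hp with (ht | ht) | hx
    · simp only [ContinuousMap.comp_apply, ContinuousMap.coe_mk]
      rw [k20 _ _ ht, k30 _ _ ht]
      exact K.symm.apply_one x
    · exact key (Or.inl ht)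
    · exact key (Or.inr hx)
  · intro b hb
    obtain ⟨a', ha', h'⟩ := hgf (k₃.comp ⟨fun p ↦ (0, p), by fun_prop⟩) b hb
    exact ⟨f.comp a', fun x ↦ congrArg f (ha' x), h'⟩

/-- The linear contraction of the cube to the origin. -/
def cubeContraction (n : ℕ) : C(I × (Fin n → I), Fin n → I) :=
  ⟨fun p i ↦ σ p.1 * p.2 i, by fun_prop⟩

@[simp] theorem cubeContraction_zero {n : ℕ} (x : Fin n → I) : cubeContraction n (0, x) = x := by
  ext; simp [cubeContraction]

@[simp] theorem cubeContraction_one {n : ℕ} (x : Fin n → I) :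
    cubeContraction n (1, x) = fun _ ↦ 0 := by
  ext; simp [cubeContraction]

theorem HasHEP.cylinder_cylinder_cube (n : ℕ) :
    HasHEP (I × (I × (Fin n → I))) (cylinderBoundary (cylinderBoundary (Cube.boundary (Fin n)))) :=
  (HasHEP.cylinder_cube (n + 1)).congr
    ((Homeomorph.refl I).prodCongr (cubeConsHomeomorph n).symm) fun x ↦ by
      have := cubeConsHomeomorph_mem_boundary n ((cubeConsHomeomorph n).symm x.2)
      rw [Homeomorph.apply_symm_apply] at this
      simp only [cylinderBoundary, Set.mem_ofPred_eq, Homeomorph.coe_prodCongr, Prod.map_fst,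
        Prod.map_snd, Homeomorph.refl_apply, id] at this ⊢
      rw [this]

theorem liftsRel_cylinder_iff {n : ℕ} {f : C(A, B)} :
    LiftsRel (I × (Fin n → I)) (cylinderBoundary (Cube.boundary (Fin n))) f ↔
      LiftsRel (Fin (n + 1) → I) (Cube.boundary (Fin (n + 1))) f := by
  refine ⟨fun h ↦ h.congr (cubeConsHomeomorph n) fun x ↦ cubeConsHomeomorph_mem_boundary n x,
    fun h ↦ h.congr (cubeConsHomeomorph n).symm fun x ↦ ?_⟩
  rw [← cubeConsHomeomorph_mem_boundary]; simp

theorem CompressesUpTo.of_comp {N : ℕ} {f : C(A, B)} {g : C(B, C)} (hf : CompressesUpTo N f)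
    (hgf : CompressesUpTo N (g.comp f)) : CompressesUpTo N g := by
  rintro (_ | n) hi
  · intro β b hb
    obtain ⟨a', -, h'⟩ := hgf 0 hi ⟨fun x ↦ (x.2.choose).elim0, continuous_of_const fun x ↦
      (x.2.choose).elim0⟩ b (fun x ↦ (x.2.choose).elim0)
    exact ⟨f.comp a', fun x ↦ (x.2.choose).elim0, h'⟩
  · rw [← liftsRel_cylinder_iff]
    refine LiftsRel.of_comp (HasHEP.cube n) (HasHEP.cylinder_cube n)
      (HasHEP.cylinder_cylinder_cube n)
      ⟨fun p ↦ (σ p.1 * p.2.1, cubeContraction n (p.1, p.2.2)), by fun_prop⟩ (0, fun _ ↦ 0)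
      (fun x ↦ by ext <;> simp) (fun x ↦ by ext <;> simp) (hf 0 (Nat.zero_le _))
      (hf n (by omega)) (liftsRel_cylinder_iff.2 (hgf _ hi))

end Liftable

/-! ### Compression and homotopy groups. -/

section Connectivity

open scoped unitInterval

variable {A B : Type u} [TopologicalSpace A] [TopologicalSpace B]

theorem homotopyGroupMap_mk (f : C(A, B)) (i : ℕ) (a : A) (p : GenLoop (Fin i) A a) :
    homotopyGroupMap f i a (Quotient.mk _ p) = Quotient.mk _ (genLoopMap f i a p) := rfl

/-- Contracting the cube to the origin moves `u`, and by homotopy extension also `v`, to maps that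
are constant on the boundary. These are loops at `u 0`, where injectivity applies, and the
homotopies are then undone. -/
theorem relInjective_of_homotopyGroupMap {n : ℕ} {f : C(A, B)}
    (hf : ∀ a, Function.Injective (homotopyGroupMap f n a)) :
    RelInjective (Fin n → I) (Cube.boundary (Fin n)) f := by
  intro u v huv h
  let U : C(I × (Fin n → I), A) := u.comp (cubeContraction n)
  obtain ⟨V, V0, V1⟩ := (HasHEP.cube n).extend v
    ⟨fun p ↦ U (p.1, p.2), by fun_prop⟩ (fun x ↦ by simp [U, huv x x.2])
  have hU : ∀ x, U (1, x) = u fun _ ↦ 0 := fun x ↦ by simp [U]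
  have h1 := (HasHEP.cylinder_cube n).homotopicRel_one (HasHEP.cube n).isClosed (f.comp U)
    (f.comp V) (fun t x hx ↦ by simp [V1 t ⟨x, hx⟩]) (by
      convert! h using 1
      · ext; simp [U]
      · ext; simp [V0])
  let p : GenLoop (Fin n) A (u fun _ ↦ 0) := ⟨homotopyAt U 1, fun x _ ↦ hU x⟩
  let q : GenLoop (Fin n) A (u fun _ ↦ 0) := ⟨homotopyAt V 1, fun x hx ↦
    (V1 1 ⟨x, hx⟩).trans (hU x)⟩
  have h2 : (Quotient.mk _ p : π_ n A _) = Quotient.mk _ q := by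
    apply hf
    rw [homotopyGroupMap_mk, homotopyGroupMap_mk]
    exact Quotient.sound h1
  have h3 : (homotopyAt U 1).HomotopicRel (homotopyAt V 1) (Cube.boundary (Fin n)) :=
    Quotient.exact h2
  have := (HasHEP.cylinder_cube n).homotopicRel_zero (HasHEP.cube n).isClosed U V
    (fun t x hx ↦ by simp [V1 t ⟨x, hx⟩]) h3
  convert! this using 1
  · ext; simp [U]
  · ext; simp [V0]

/-- An upper edge that extends over the cube contracts to a constant one, and lifting problems with
constant upper edge express surjectivity on `π_n`. -/
theorem liftable_of_homotopyGroupMap {n : ℕ} {f : C(A, B)}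
    (hf : ∀ a, Function.Surjective (homotopyGroupMap f n a)) (u : C(Fin n → I, A)) :
    Liftable f (restrictTo (Cube.boundary (Fin n)) u) := by
  refine Liftable.of_homotopy (HasHEP.cube n) (HasHEP.cylinder_cube n)
    ⟨fun p ↦ u (cubeContraction n (p.1, p.2)), by fun_prop⟩ (fun x ↦ by simp)
    (a₁ := ⟨fun x ↦ u (cubeContraction n (1, x)), by fun_prop⟩) (fun x ↦ rfl) ?_
  intro b hb
  obtain ⟨w, hw⟩ := hf (u fun _ ↦ 0) (Quotient.mk _ ⟨b, fun x hx ↦ by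
    rw [← hb ⟨x, hx⟩]; simp⟩)
  induction w using Quotient.inductionOn with | _ w => ?_
  have := Quotient.exact hw
  exact ⟨w.1, fun x ↦ by simpa using w.2 x x.2, this⟩

theorem joined_of_pathComponentsMap {f : C(A, B)}
    (hf : Function.Injective (pathComponentsMap f)) {x y : A} (h : Joined (f x) (f y)) :
    Joined x y := by
  have : pathComponentsMap f (ZerothHomotopy.mk x) = pathComponentsMap f (ZerothHomotopy.mk y) :=
    ZerothHomotopy.sound h.somePath
  exact Quotient.exact (hf this)

theorem liftsRel_zero_iff {f : C(A, B)} : LiftsRel (Fin 0 → I) (Cube.boundary (Fin 0)) f ↔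
    ∀ y : B, ∃ x : A, Joined (f x) y := by
  have e : ∀ x, x ∉ Cube.boundary (Fin 0) := fun x hx ↦ hx.choose.elim0
  constructor
  · intro h y
    obtain ⟨a', -, ⟨K⟩⟩ := h ⟨fun x ↦ (e _ x.2).elim, continuous_of_const fun x ↦ (e _ x.2).elim⟩
      (ContinuousMap.const _ y) (fun x ↦ (e _ x.2).elim)
    let z : Fin 0 → I := fun i ↦ i.elim0
    exact ⟨a' z, ⟨⟨⟨fun t ↦ K (t, z), by fun_prop⟩, by simp, by simp⟩⟩⟩
  · intro h a b _
    let z : Fin 0 → I := fun i ↦ i.elim0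
    obtain ⟨x, ⟨γ⟩⟩ := h (b z)
    exact ⟨ContinuousMap.const _ x, fun x ↦ (e _ x.2).elim, ⟨⟨⟨⟨fun p ↦ γ p.1, by fun_prop⟩,
      fun x ↦ by simp, fun x ↦ by simp [Subsingleton.elim x z]⟩, fun t x hx ↦ (e _ hx).elim⟩⟩⟩

theorem relInjective_zero_iff {f : C(A, B)} : RelInjective (Fin 0 → I) (Cube.boundary (Fin 0)) f ↔
    ∀ x y : A, Joined (f x) (f y) → Joined x y := by
  have e : ∀ x, x ∉ Cube.boundary (Fin 0) := fun x hx ↦ hx.choose.elim0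
  let z : Fin 0 → I := fun i ↦ i.elim0
  constructor
  · rintro h x y ⟨γ⟩
    obtain ⟨K⟩ := h (ContinuousMap.const _ x) (ContinuousMap.const _ y)
      (fun x hx ↦ (e _ hx).elim) ⟨⟨⟨⟨fun p ↦ γ p.1, by fun_prop⟩,
      fun x ↦ by simp, fun x ↦ by simp⟩, fun t x hx ↦ (e _ hx).elim⟩⟩
    exact ⟨⟨⟨fun t ↦ K (t, z), by fun_prop⟩, by simp, by simp⟩⟩
  · rintro h u v _ ⟨K⟩
    obtain ⟨γ⟩ := h (u z) (v z) ⟨⟨⟨fun t ↦ K (t, z), by fun_prop⟩, by simp, by simp⟩⟩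
    exact ⟨⟨⟨⟨fun p ↦ γ p.1, by fun_prop⟩,
      fun x ↦ by simp [Subsingleton.elim x z], fun x ↦ by simp [Subsingleton.elim x z]⟩,
      fun t x hx ↦ (e _ hx).elim⟩⟩

/-- In dimension `n + 1`, `LiftsRel.of_relInjective` takes injectivity on `π_n` and surjectivity on
`π_{n+1}`. Path components replace `π_0`, both for dimension `0` and for the injectivity needed in
dimension `1`. -/
theorem IsConnectedMap.compressesUpTo {N : ℕ} {l : ℤ} (hN : (N : ℤ) ≤ l) {f : C(A, B)}
    (h : IsConnectedMap l f) : CompressesUpTo N f := by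
  rintro (_ | n) hn
  · rw [liftsRel_zero_iff]
    intro y
    obtain ⟨x, hx⟩ := h.pi_zero_surjective (by omega) (ZerothHomotopy.mk y)
    induction x using ZerothHomotopy.rec with | _ x => ?_
    exact ⟨x, Quotient.exact hx⟩
  · rw [← liftsRel_cylinder_iff]
    refine LiftsRel.of_relInjective (HasHEP.cube n) (HasHEP.cylinder_cube n)
      (HasHEP.cylinder_cylinder_cube n) ?_ fun a b hb ↦ ?_
    · rcases Nat.eq_zero_or_pos n with rfl | h0
      · rw [relInjective_zero_iff]
        intro x y hxy
        exact joined_of_pathComponentsMap (h.pi_zero_injective (by omega)) hxy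
      · exact relInjective_of_homotopyGroupMap (h.pi_injective n h0 (by omega))
    · have := liftable_of_homotopyGroupMap (h.pi_surjective (n + 1) (by omega) (by omega))
        (a.comp (cubeConsHomeomorph n).symm) (b.comp (cubeConsHomeomorph n).symm) (fun x ↦ by
          refine hb ⟨(cubeConsHomeomorph n).symm x, ?_⟩
          rw [← cubeConsHomeomorph_mem_boundary]; simp)
      obtain ⟨a', ha', h'⟩ := this
      refine ⟨a'.comp (cubeConsHomeomorph n), fun x ↦ ?_, ?_⟩
      · have := ha' ⟨cubeConsHomeomorph n x, (cubeConsHomeomorph_mem_boundary n x).2 x.2⟩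
        simpa using this
      · convert! HomotopicRel.precomp h' (cubeConsHomeomorph n : C(I × (Fin n → I), _)) using 1
        ext x
        exact (cubeConsHomeomorph_mem_boundary n x).symm

theorem CompressesUpTo.relInjective {N n : ℕ} {f : C(A, B)} (h : CompressesUpTo N f) (hn : n < N) :
    RelInjective (Fin n → I) (Cube.boundary (Fin n)) f :=
  (liftsRel_cylinder_iff.2 (h (n + 1) hn)).relInjective (HasHEP.cube n).isClosed

theorem CompressesUpTo.isConnectedMap {N : ℕ} {l : ℤ} (hN : l ≤ (N : ℤ)) {f : C(A, B)}
    (h : CompressesUpTo N f) : IsConnectedMap l f where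
  pi_zero_injective h0 x y hxy := by
    induction x using ZerothHomotopy.rec with | _ x => ?_
    induction y using ZerothHomotopy.rec with | _ y => ?_
    obtain ⟨γ⟩ := relInjective_zero_iff.1 (h.relInjective (n := 0) (by omega)) x y
      (Quotient.exact hxy)
    exact ZerothHomotopy.sound γ
  pi_zero_surjective h0 y := by
    induction y using ZerothHomotopy.rec with | _ y => ?_
    obtain ⟨x, ⟨γ⟩⟩ := liftsRel_zero_iff.1 (h 0 (Nat.zero_le _)) y
    exact ⟨ZerothHomotopy.mk x, ZerothHomotopy.sound γ⟩
  pi_injective i hi hil a p q hpq := by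
    induction p using Quotient.inductionOn with | _ p => ?_
    induction q using Quotient.inductionOn with | _ q => ?_
    exact Quotient.sound (h.relInjective (n := i) (by omega) p.1 q.1
      (fun x hx ↦ (p.2 x hx).trans (q.2 x hx).symm) (Quotient.exact hpq))
  pi_surjective i hi hil a w := by
    induction w using Quotient.inductionOn with | _ w => ?_
    obtain ⟨a', ha', h'⟩ := h i (by omega) (ContinuousMap.const _ a) w.1
      (fun x ↦ (w.2 x x.2).symm)
    exact ⟨Quotient.mk _ ⟨a', fun x hx ↦ ha' ⟨x, hx⟩⟩, Quotient.sound h'⟩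

end Connectivity

/-! ### Points of geometric realizations; complexes embedded in a simplex. -/

section Realization

/-- The characteristic map `Δⁿ → |S|` of a simplex `x` of a simplicial set `S`. -/
noncomputable def cellMap {S : SSet.{u}} {n : ℕ} (x : S _⦋n⦌) :
    C(stdSimplex ℝ (Fin (n + 1)), |S|) :=
  TopCat.toSSetObjEquiv _ _ ((sSetTopAdj.unit.app S).app (op ⦋n⦌) x)

/-- The continuous map `|S| → E` adjoint to a simplicial map `S → Sing E`. -/
noncomputable def realizationDesc {S : SSet.{u}} {E : TopCat.{u}} (g : S ⟶ TopCat.toSSet.obj E) :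
    C(|S|, E) := ((sSetTopAdj.homEquiv S E).symm g).hom

variable {S T : SSet.{u}} {E : TopCat.{u}}

@[simp]
theorem realizationDesc_cellMap (g : S ⟶ TopCat.toSSet.obj E) {n : ℕ} (x : S _⦋n⦌)
    (t : stdSimplex ℝ (Fin (n + 1))) :
    realizationDesc g (cellMap x t) = TopCat.toSSetObjEquiv _ _ (g.app (op ⦋n⦌) x) t := by
  have h : sSetTopAdj.unit.app S ≫ TopCat.toSSet.map ((sSetTopAdj.homEquiv S E).symm g) = g := by
    exact (sSetTopAdj.homEquiv_unit S E _).symm.trans (Equiv.apply_symm_apply _ _)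
  have h' := congrArg (fun φ ↦ TopCat.toSSetObjEquiv _ _ (φ.app (op ⦋n⦌) x) t) h
  exact h'

@[simp]
theorem toTop_map_cellMap (f : S ⟶ T) {n : ℕ} (x : S _⦋n⦌) (t : stdSimplex ℝ (Fin (n + 1))) :
    (SSet.toTop.map f).hom (cellMap x t) = cellMap (f.app (op ⦋n⦌) x) t := by
  have h := sSetTopAdj.unit.naturality f
  have h' := congrArg (fun φ ↦ TopCat.toSSetObjEquiv _ _ (φ.app (op ⦋n⦌) x) t) h
  exact h'.symm

theorem cellMap_map {m n : ℕ} (f : ⦋m⦌ ⟶ ⦋n⦌) (x : S _⦋n⦌) (t : stdSimplex ℝ (Fin (m + 1))) :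
    cellMap (S.map f.op x) t = cellMap x (stdSimplex.map f.toOrderHom t) := by
  have h := (sSetTopAdj.unit.app S).naturality f.op
  have h' := congrArg (fun φ ↦ TopCat.toSSetObjEquiv _ _ (φ x) t) h
  exact h'

theorem realization_hom_ext {f g : C(|S|, E)}
    (h : ∀ (n : ℕ) (x : S _⦋n⦌) t, f (cellMap x t) = g (cellMap x t)) : f = g := by
  have : TopCat.ofHom f = TopCat.ofHom g := by
    apply (sSetTopAdj.homEquiv S E).injective
    ext n x
    induction n using Opposite.rec with | _ n => ?_
    apply (TopCat.toSSetObjEquiv _ _).injective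
    ext t
    rw [Adjunction.homEquiv_unit, Adjunction.homEquiv_unit]
    exact h n.len x t
  exact congrArg TopCat.Hom.hom this

/-- The indiscrete topological space on a type. -/
def Indiscrete (X : Type u) : Type u := X

instance (X : Type u) : TopologicalSpace (Indiscrete X) := ⊤

/-- All functions to an indiscrete space are continuous, so the characteristic function of the union
of the cells and the constant function with value true are two maps that agree on every cell, hence
are equal. -/
theorem exists_cellMap_eq (p : |S|) : ∃ (n : ℕ) (x : S _⦋n⦌) (t : _), cellMap x t = p := by
  let E : TopCat.{u} := TopCat.of (Indiscrete (ULift Prop))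
  have hc : ∀ f : |S| → E, Continuous f := fun f ↦ continuous_top
  let f : C(|S|, E) := ⟨fun q ↦ ULift.up (∃ (n : ℕ) (x : S _⦋n⦌) (t : _), cellMap x t = q), hc _⟩
  let g : C(|S|, E) := ⟨fun _ ↦ ULift.up True, hc _⟩
  have : f = g := realization_hom_ext fun n x t ↦
    ULift.ext _ _ (propext ⟨fun _ ↦ trivial, fun _ ↦ ⟨n, x, t, rfl⟩⟩)
  have := congrArg ULift.down (DFunLike.congr_fun this p)
  exact Eq.mpr this trivial

/-- The simplicial map `S → Sing E` given by a compatible family of continuous maps on standard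
simplices. -/
noncomputable def toSingular (c : ∀ n : SimplexCategoryᵒᵖ, S.obj n →
      C(stdSimplex ℝ (Fin (n.unop.len + 1)), E))
    (hc : ∀ {n m : SimplexCategoryᵒᵖ} (f : n ⟶ m) (x : S.obj n) (t),
      c m (S.map f x) t = c n x (stdSimplex.map f.unop.toOrderHom t)) : S ⟶ TopCat.toSSet.obj E where
  app n := ↾fun x ↦ (TopCat.toSSetObjEquiv E n).symm (c n x)
  naturality n m f := by
    ext x
    apply (TopCat.toSSetObjEquiv _ _).injective
    ext t
    exact hc f x t

@[simp]
theorem toSingular_app (c : ∀ n : SimplexCategoryᵒᵖ, S.obj n →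
      C(stdSimplex ℝ (Fin (n.unop.len + 1)), E)) (hc) (n : SimplexCategoryᵒᵖ) (x : S.obj n) :
    TopCat.toSSetObjEquiv _ _ ((toSingular c hc).app n x) = c n x := rfl

theorem stdSimplex_map_apply {X Y : Type*} [Fintype X] [Fintype Y] [DecidableEq Y] (f : X → Y)
    (s : stdSimplex ℝ X) (y : Y) : stdSimplex.map f s y = ∑ x with f x = y, s x := by
  simp [FunOnFinite.linearMap_apply_apply]

theorem stdSimplex_map_apply_of_injective {X Y : Type*} [Fintype X] [Fintype Y]
    {f : X → Y} (hf : Function.Injective f)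
    (s : stdSimplex ℝ X) (x : X) : stdSimplex.map f s (f x) = s x := by
  classical
  rw [stdSimplex_map_apply, Finset.sum_eq_single x]
  · intro b hb hbx
    exact absurd (hf (by simpa using hb)) hbx
  · simp

theorem stdSimplex_map_ne_zero_iff {X Y : Type*} [Fintype X] [Fintype Y] (f : X → Y)
    (s : stdSimplex ℝ X) (y : Y) : stdSimplex.map f s y ≠ 0 ↔ ∃ x, f x = y ∧ s x ≠ 0 := by
  classical
  rw [stdSimplex_map_apply, Ne, Finset.sum_eq_zero_iff_of_nonneg fun x _ ↦ stdSimplex.zero_le s x]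
  simp

theorem exists_stdSimplex_map_succAbove {n : ℕ} (t : stdSimplex ℝ (Fin (n + 2))) (i : Fin (n + 2))
    (h : t i = 0) : ∃ t' : stdSimplex ℝ (Fin (n + 1)), t = stdSimplex.map i.succAbove t' ∧
      ∀ j, t' j = t (i.succAbove j) := by
  let t' : stdSimplex ℝ (Fin (n + 1)) := ⟨fun j ↦ t (i.succAbove j), fun j ↦ t.2.1 _, by
    have := stdSimplex.sum_eq_one t
    rw [Fin.sum_univ_succAbove _ i, h, zero_add] at this
    exact this⟩
  refine ⟨t', ?_, fun j ↦ rfl⟩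
  ext j
  rcases Fin.eq_self_or_eq_succAbove i j with rfl | ⟨k, rfl⟩
  · rw [h]
    by_contra h'
    obtain ⟨k, hk, -⟩ := (stdSimplex_map_ne_zero_iff _ _ _).1 (Ne.symm h')
    exact Fin.succAbove_ne _ _ hk
  · exact (stdSimplex_map_apply_of_injective Fin.succAbove_right_injective t' k).symm

/-- An assignment of chains of vertices in a poset to the simplices of `S`, by which the simplices
are determined. -/
structure VertexEmbedding (S : SSet.{u}) (P : Type) [PartialOrder P] where
  /-- The vertices of a simplex. -/
  vertex : ∀ {n : SimplexCategoryᵒᵖ}, S.obj n → (Fin (n.unop.len + 1) →o P)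
  vertex_map : ∀ {n m : SimplexCategoryᵒᵖ} (f : n ⟶ m) (x : S.obj n),
    vertex (S.map f x) = (vertex x).comp f.unop.toOrderHom
  injective : ∀ n, Function.Injective (vertex (n := n))

namespace VertexEmbedding

variable {P : Type} [PartialOrder P] [Fintype P] (v : VertexEmbedding S P)

/-- The simplicial map `S → Sing Δᴾ` sending a simplex to the affine map given by its vertices. -/
noncomputable def toSingularSimplex :
    S ⟶ TopCat.toSSet.obj (TopCat.of (ULift.{u} (stdSimplex ℝ P))) :=
  toSingular (fun n x ↦ ⟨fun t ↦ ULift.up (stdSimplex.map (v.vertex x) t),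
      continuous_uliftUp.comp (stdSimplex.continuous_map _)⟩) (fun f x t ↦ by
    simp only [ContinuousMap.coe_mk]
    rw [v.vertex_map, stdSimplex.map_comp_apply]
    rfl)

/-- The map `|S| → Δᴾ`, affine on simplices, which is the inclusion on vertices. -/
noncomputable def coordinates : C(|S|, stdSimplex ℝ P) :=
  ⟨fun p ↦ (realizationDesc v.toSingularSimplex p).down,
    continuous_uliftDown.comp (realizationDesc _).continuous⟩

theorem coordinates_cellMap {n : ℕ} (x : S _⦋n⦌) (t : stdSimplex ℝ (Fin (n + 1))) :
    v.coordinates (cellMap x t) = stdSimplex.map (v.vertex x) t :=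
  congrArg ULift.down (realizationDesc_cellMap v.toSingularSimplex x t)

/-- A vanishing barycentric coordinate is removed by passing to a face. A repeated vertex makes the
simplex degenerate, because vertices determine simplices, and the point descends along the
degeneracy. Each move lowers the dimension. -/
theorem exists_normal_form {n : ℕ} (x : S _⦋n⦌) (t : stdSimplex ℝ (Fin (n + 1))) :
    ∃ (m : ℕ) (y : S _⦋m⦌) (s : stdSimplex ℝ (Fin (m + 1))), cellMap y s = cellMap x t ∧
      Function.Injective (v.vertex y) ∧ ∀ i, s i ≠ 0 := by
  induction n with
  | zero =>
    refine ⟨0, x, t, rfl, fun i j _ ↦ Subsingleton.elim (α := Fin 1) i j, fun i ↦ ?_⟩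
    have := stdSimplex.sum_eq_one t
    rw [Fin.sum_univ_one] at this
    rw [Subsingleton.elim (α := Fin 1) i 0, this]
    exact one_ne_zero
  | succ n ih =>
    by_cases h : ∃ i, t i = 0
    · obtain ⟨i, hi⟩ := h
      obtain ⟨t', rfl, -⟩ := exists_stdSimplex_map_succAbove t i hi
      obtain ⟨m, y, s, h1, h2⟩ := ih (S.map (SimplexCategory.δ i).op x) t'
      refine ⟨m, y, s, h1.trans ?_, h2⟩
      exact cellMap_map (SimplexCategory.δ i) x t'
    · push Not at h
      by_cases h' : Function.Injective (v.vertex x)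
      · exact ⟨n + 1, x, t, rfl, h', h⟩
      · obtain ⟨i, hi⟩ : ∃ i : Fin (n + 1), v.vertex x i.castSucc = v.vertex x i.succ := by
          by_contra! hne
          refine h' (Fin.strictMono_iff_lt_succ.2 fun i ↦ ?_).injective
          exact lt_of_le_of_ne ((v.vertex x).monotone i.castSucc_lt_succ.le) (hne i)
        have hx : S.map (SimplexCategory.σ i ≫ SimplexCategory.δ i.castSucc).op x = x := by
          apply v.injective
          rw [v.vertex_map]
          ext j
          change v.vertex x (i.castSucc.succAbove (i.predAbove j)) = _
          by_cases hj : j = i.castSucc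
          · subst hj
            simp [hi]
          · rw [Fin.succAbove_predAbove]
            exact hj
        obtain ⟨m, y, s, h1, h2⟩ := ih (S.map (SimplexCategory.δ i.castSucc).op x)
          (stdSimplex.map (SimplexCategory.σ i).toOrderHom t)
        refine ⟨m, y, s, h1.trans ?_, h2⟩
        rw [← cellMap_map]
        conv_rhs => rw [← hx]
        rw [op_comp, S.map_comp]
        rfl

/-- In normal form the support of the coordinates is the vertex set. Being a chain, it has only one
increasing enumeration, which determines the simplex; injectivity on vertices then recovers the
barycentric coordinates. -/
theorem coordinates_injective : Function.Injective v.coordinates := by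
  intro p q hpq
  obtain ⟨n, x, t, rfl⟩ := exists_cellMap_eq p
  obtain ⟨m, y, s, rfl⟩ := exists_cellMap_eq q
  obtain ⟨n', x, t, h, h1, h2⟩ := v.exists_normal_form x t
  rw [← h] at hpq ⊢
  obtain ⟨m', y, s, h', h1', h2'⟩ := v.exists_normal_form y s
  rw [← h'] at hpq ⊢
  rw [coordinates_cellMap, coordinates_cellMap] at hpq
  have hr : Set.range (v.vertex x) = Set.range (v.vertex y) := by
    ext a
    have e1 := stdSimplex_map_ne_zero_iff (v.vertex x) t a
    have e2 := stdSimplex_map_ne_zero_iff (v.vertex y) s a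
    rw [hpq] at e1
    have e3 := e1.symm.trans e2
    constructor
    · rintro ⟨i, hi⟩
      obtain ⟨j, hj, -⟩ := e3.1 ⟨i, hi, h2 i⟩
      exact ⟨j, hj⟩
    · rintro ⟨i, hi⟩
      obtain ⟨j, hj, -⟩ := e3.2 ⟨i, hi, h2' i⟩
      exact ⟨j, hj⟩
  obtain rfl : n' = m' := by
    have := congrArg Set.ncard hr
    rw [← Set.image_univ, ← Set.image_univ, Set.ncard_image_of_injective _ h1,
      Set.ncard_image_of_injective _ h1'] at this
    simpa using this
  have hv : v.vertex x = v.vertex y := by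
    have := (StrictMono.range_inj ((v.vertex x).monotone.strictMono_of_injective h1)
      ((v.vertex y).monotone.strictMono_of_injective h1')).1 hr
    exact OrderHom.ext _ _ this
  obtain rfl : x = y := v.injective _ hv
  congr 1
  ext i
  rw [← stdSimplex_map_apply_of_injective h1 t i, hpq, stdSimplex_map_apply_of_injective h1]

/-- Normal forms have fewer than `card P + 1` vertices too many to exceed `P`, so finitely many
compact cells cover. -/
theorem compactSpace (v : VertexEmbedding S P) : CompactSpace |S| := by
  have : ∀ n, Finite (S _⦋n⦌) := fun n ↦ by
    have : Finite (Fin (n + 1) →o P) := DFunLike.finite _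
    exact Finite.of_injective _ (v.injective (op ⦋n⦌))
  refine ⟨?_⟩
  have : (Set.univ : Set |S|) = ⋃ n : Fin (Fintype.card P + 1), ⋃ x : S _⦋(n : ℕ)⦌,
      Set.range (cellMap x) := by
    symm
    rw [Set.eq_univ_iff_forall]
    intro p
    obtain ⟨n, x, t, rfl⟩ := exists_cellMap_eq p
    obtain ⟨n', x, t, h, h1, h2⟩ := v.exists_normal_form x t
    have : n' + 1 ≤ Fintype.card P := by
      simpa using Fintype.card_le_of_injective _ h1
    simp only [Set.mem_iUnion]
    exact ⟨⟨n', by omega⟩, x, t, h⟩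
  rw [this]
  exact isCompact_iUnion fun n ↦ isCompact_iUnion fun x ↦ isCompact_range (cellMap x).continuous

theorem isClosedEmbedding_coordinates : IsClosedEmbedding v.coordinates :=
  have := v.compactSpace
  Continuous.isClosedEmbedding v.coordinates.continuous v.coordinates_injective

theorem range_coordinates : Set.range v.coordinates =
    {t | ∃ (m : ℕ) (x : S _⦋m⦌), ∀ i, t i ≠ 0 → i ∈ Set.range (v.vertex x)} := by
  ext t
  simp only [Set.mem_range, Set.mem_ofPred_eq]
  constructor
  · rintro ⟨p, rfl⟩
    obtain ⟨n, x, t, rfl⟩ := exists_cellMap_eq p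
    refine ⟨n, x, fun i hi ↦ ?_⟩
    rw [coordinates_cellMap] at hi
    obtain ⟨j, hj, -⟩ := (stdSimplex_map_ne_zero_iff _ _ _).1 hi
    exact ⟨j, hj⟩
  · rintro ⟨m, x, hx⟩
    classical
    -- A section of the vertex map over the support of `t`; the value `0` elsewhere is harmless, as
    -- `t` vanishes outside the vertex set.
    let e : P → Fin (m + 1) := fun p ↦ if h : ∃ j, v.vertex x j = p then h.choose else 0
    refine ⟨cellMap x (stdSimplex.map e t), ?_⟩
    rw [coordinates_cellMap, stdSimplex.map_comp_apply]
    ext i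
    rw [stdSimplex_map_apply]
    have he : ∀ p, t p ≠ 0 → v.vertex x (e p) = p := fun p hp ↦ by
      have h : ∃ j, v.vertex x j = p := hx p hp
      simp only [e, dif_pos h]
      exact h.choose_spec
    by_cases hi : t i = 0
    · rw [hi]
      refine Finset.sum_eq_zero fun p hp ↦ ?_
      by_contra hp'
      have h3 := he p hp'
      simp only [Function.comp_apply, Finset.mem_filter, Finset.mem_univ, true_and] at hp
      rw [h3] at hp
      exact hp' (hp ▸ hi)
    · rw [Finset.sum_eq_single i]
      · intro b hb hbi
        by_contra hb'
        have h3 := he b hb'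
        simp only [Function.comp_apply, Finset.mem_filter, Finset.mem_univ, true_and] at hb
        exact hbi (h3.symm.trans hb)
      · intro h
        simp [he i hi] at h

end VertexEmbedding

end Realization

section

open CategoryTheory Opposite Simplicial Topology MonoidalCategory


/-! ### Horns, and the Kan property of singular simplicial sets. -/

section SimplexSubcomplexes

namespace VertexEmbedding

variable {S T : SSet.{u}} {P : Type} [PartialOrder P]

/-- The vertex embedding of a simplicial subset. -/
def comap (v : VertexEmbedding T P) (f : S ⟶ T) [Mono f] : VertexEmbedding S P where
  vertex x := v.vertex (f.app _ x)
  vertex_map φ x := by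
    rw [← v.vertex_map]
    exact congrArg _ (ConcreteCategory.congr_hom (f.naturality φ) x)
  injective n x y h := by
    have : Mono (f.app n) := inferInstance
    exact (mono_iff_injective (f.app n)).1 this (v.injective n h)

/-- The vertices of the simplices of `Δ[n]`. -/
def ofStdSimplex (n : ℕ) : VertexEmbedding (Δ[n] : SSet.{u}) (Fin (n + 1)) where
  vertex x := SSet.stdSimplex.asOrderHom x
  vertex_map _ _ := rfl
  injective m x y h := by
    apply SSet.stdSimplex.objEquiv.injective
    exact SimplexCategory.Hom.ext _ _ h

/-- The vertices of the simplices of `Δ[n] × Δ[k]`. -/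
def ofProd (n k : ℕ) :
    VertexEmbedding (Δ[n] ⊗ Δ[k] : SSet.{u}) (Fin (n + 1) × Fin (k + 1)) where
  vertex x := ((ofStdSimplex n).vertex x.1).prod ((ofStdSimplex k).vertex x.2)
  vertex_map _ _ := rfl
  injective m x y h := by
    have h' := fun i ↦ Prod.ext_iff.1 (DFunLike.congr_fun h i)
    exact Prod.ext ((ofStdSimplex n).injective m (OrderHom.ext _ _ (funext fun i ↦ (h' i).1)))
      ((ofStdSimplex k).injective m (OrderHom.ext _ _ (funext fun i ↦ (h' i).2)))

variable [Fintype P]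

/-- Lift a map to `Δᴾ` with image in that of `|S|`. -/
noncomputable def lift (v : VertexEmbedding S P) {Y : Type*} [TopologicalSpace Y]
    (f : C(Y, stdSimplex ℝ P)) (h : ∀ y, f y ∈ Set.range v.coordinates) : C(Y, |S|) where
  toFun y := (h y).choose
  continuous_toFun := by
    rw [v.isClosedEmbedding_coordinates.isInducing.continuous_iff]
    convert f.continuous using 1
    exact funext fun y ↦ (h y).choose_spec

theorem coordinates_lift (v : VertexEmbedding S P) {Y : Type*} [TopologicalSpace Y]
    (f : C(Y, stdSimplex ℝ P)) (h : ∀ y, f y ∈ Set.range v.coordinates) (y : Y) :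
    v.coordinates (v.lift f h y) = f y := (h y).choose_spec

end VertexEmbedding

/-- Given a vertex `i` of `Δⁿ⁺¹`, the retraction onto the union of the faces containing `i`. -/
theorem exists_horn_retraction (n : ℕ) (i : Fin (n + 2)) :
    ∃ r : C(stdSimplex ℝ (Fin (n + 2)), stdSimplex ℝ (Fin (n + 2))),
      (∀ t, ∃ j, j ≠ i ∧ r t j = 0) ∧ ∀ t, (∃ j, j ≠ i ∧ t j = 0) → r t = t := by
  classical
  let F : Finset (Fin (n + 2)) := Finset.univ.erase i
  have hF : F.Nonempty := by
    rw [← Finset.card_pos, Finset.card_erase_of_mem (Finset.mem_univ i)]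
    simp
  have hFc : (F.card : ℝ) = n + 1 := by
    rw [Finset.card_erase_of_mem (Finset.mem_univ i)]
    simp
  have hFm : ∀ j, j ∈ F ↔ j ≠ i := fun j ↦ by simp [F]
  let m : stdSimplex ℝ (Fin (n + 2)) → ℝ := fun t ↦ F.inf' hF fun j ↦ t j
  have hev : ∀ j, Continuous fun t : stdSimplex ℝ (Fin (n + 2)) ↦ t j :=
    fun j ↦ (continuous_apply j).comp continuous_subtype_val
  have hm : Continuous m := Continuous.finset_inf'_apply hF fun j _ ↦ hev j
  have hm0 : ∀ t, 0 ≤ m t := fun t ↦ Finset.le_inf' _ _ fun j _ ↦ stdSimplex.zero_le t j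
  have hmj : ∀ t, ∀ j ∈ F, m t ≤ t j := fun t j hj ↦ Finset.inf'_le _ hj
  -- Projection parallel to the line from the barycentre of the face opposite `i` to the vertex `i`:
  -- the least coordinate `m` away from `i` is taken from each of the `n + 1` coordinates other than
  -- `i`, and the total goes to `i`.
  let f : stdSimplex ℝ (Fin (n + 2)) → Fin (n + 2) → ℝ := fun t j ↦
    if j = i then t i + (n + 1) * m t else t j - m t
  have hf : ∀ t, f t ∈ stdSimplex ℝ (Fin (n + 2)) := fun t ↦ by
    refine ⟨fun j ↦ ?_, ?_⟩
    · by_cases hj : j = i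
      · simp only [f, if_pos hj]
        have := stdSimplex.zero_le t i
        have := hm0 t
        positivity
      · simp only [f, if_neg hj]
        linarith [hmj t j ((hFm j).2 hj)]
    · have h1 := stdSimplex.sum_eq_one t
      rw [← Finset.add_sum_erase _ _ (Finset.mem_univ i)] at h1 ⊢
      rw [Finset.sum_congr rfl (g := fun j ↦ t j - m t) fun j hj ↦ by
        simp [f, (hFm j).1 hj]]
      rw [Finset.sum_sub_distrib, Finset.sum_const, nsmul_eq_mul]
      change (t i + _) = 1 at h1
      have : f t i = t i + (n + 1) * m t := by simp [f]
      rw [this, hFc]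
      linarith
  refine ⟨⟨fun t ↦ ⟨f t, hf t⟩, Continuous.subtype_mk (continuous_pi fun j ↦ ?_) _⟩,
    fun t ↦ ?_, fun t ht ↦ ?_⟩
  · by_cases hj : j = i
    · simp only [f, if_pos hj]
      exact (hev i).add (continuous_const.mul hm)
    · simp only [f, if_neg hj]
      exact (hev j).sub hm
  · obtain ⟨j, hj, hjm⟩ := Finset.exists_mem_eq_inf' hF fun j ↦ t j
    refine ⟨j, (hFm j).1 hj, ?_⟩
    change f t j = 0
    simp only [f, if_neg ((hFm j).1 hj)]
    exact sub_eq_zero.2 hjm.symm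
  · obtain ⟨j, hj, hjt⟩ := ht
    have h0 : m t = 0 := le_antisymm (hjt ▸ hmj t j ((hFm j).2 hj)) (hm0 t)
    ext k
    change f t k = t k
    by_cases hk : k = i
    · simp [f, hk, h0]
    · simp [f, hk, h0]

theorem mem_range_horn_coordinates {n : ℕ} {i j : Fin (n + 2)} (hj : j ≠ i)
    {t : stdSimplex ℝ (Fin (n + 2))} (ht : t j = 0) :
    t ∈ Set.range ((VertexEmbedding.ofStdSimplex.{u} (n + 1)).comap
      (SSet.horn (n + 1) i).ι).coordinates := by
  rw [VertexEmbedding.range_coordinates]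
  refine ⟨n, SSet.horn.face i j hj, fun k hk ↦ ?_⟩
  have hkj : k ≠ j := fun h ↦ hk (h ▸ ht)
  obtain ⟨l, rfl⟩ := Fin.exists_succAbove_eq hkj
  exact ⟨l, rfl⟩

theorem exists_extension_horn {E : TopCat.{u}} {n : ℕ} {i : Fin (n + 2)}
    (φ : (SSet.horn (n + 1) i : SSet.{u}) ⟶ TopCat.toSSet.obj E) :
    ∃ Φ : Δ[n + 1] ⟶ TopCat.toSSet.obj E,
      ∀ (j : Fin (n + 2)) (hj : j ≠ i), SSet.stdSimplex.δ j ≫ Φ = SSet.horn.ι i j hj ≫ φ := by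
  let v := (VertexEmbedding.ofStdSimplex.{u} (n + 1)).comap (SSet.horn (n + 1) i).ι
  obtain ⟨r, hr, hr'⟩ := exists_horn_retraction n i
  let ρ := v.lift r fun t ↦ by
    obtain ⟨j, hj, hj'⟩ := hr t
    exact mem_range_horn_coordinates hj hj'
  refine ⟨SSet.yonedaEquiv.symm ((TopCat.toSSetObjEquiv E (op ⦋n + 1⦌)).symm
    ((realizationDesc φ).comp ρ)), fun j hj ↦ ?_⟩
  apply SSet.yonedaEquiv.injective
  apply (TopCat.toSSetObjEquiv E (op ⦋n⦌)).injective
  ext z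
  change realizationDesc φ (ρ (stdSimplex.map j.succAbove z)) =
    TopCat.toSSetObjEquiv _ _ (φ.app _ (SSet.horn.face i j hj)) z
  rw [← realizationDesc_cellMap]
  congr 1
  apply v.coordinates_injective
  rw [VertexEmbedding.coordinates_lift, VertexEmbedding.coordinates_cellMap]
  refine hr' _ ⟨j, hj, ?_⟩
  by_contra h
  obtain ⟨x, hx, -⟩ := (stdSimplex_map_ne_zero_iff _ _ _).1 h
  exact Fin.succAbove_ne _ _ hx

instance kanComplex_singular (E : TopCat.{u}) : SSet.KanComplex (TopCat.toSSet.obj E) := by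
  rw [SSet.KanComplex.iff]
  intro n i f hf
  obtain ⟨Φ, hΦ⟩ := exists_extension_horn hf.desc
  exact ⟨Φ, fun j hj ↦ by rw [hΦ j hj, SSet.horn.IsCompatible.ι_desc]⟩

end SimplexSubcomplexes

/-! ### The realization of `Δ[n] × Δ[k]` by couplings of probability measures. -/

section Products

variable {n k : ℕ}

theorem sum_filter_lt_succ {n : ℕ} (f : Fin (n + 1) → ℝ) (i : Fin (n + 1)) :
    ∑ a ∈ Finset.univ.filter (fun a : Fin (n + 1) ↦ (a : ℕ) < (i : ℕ) + 1), f a = (∑ a ∈ Finset.univ.filter (fun a : Fin (n + 1) ↦ (a : ℕ) < (i : ℕ)), f a) + f i := by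
  have : Finset.univ.filter (fun a : Fin (n + 1) ↦ (a : ℕ) < (i : ℕ) + 1) =
      insert i (Finset.univ.filter fun a : Fin (n + 1) ↦ (a : ℕ) < (i : ℕ)) := by
    ext a
    simp only [Finset.mem_filter, Finset.mem_univ, true_and, Finset.mem_insert, Fin.ext_iff]
    omega
  rw [this, Finset.sum_insert (by simp), add_comm]

/-- The cumulative distribution function of a measure on `{0, …, n}`. -/
def cumulative (x : Fin (n + 1) → ℝ) (i : ℕ) : ℝ := ∑ a ∈ Finset.univ.filter (fun a : Fin (n + 1) ↦ (a : ℕ) < i), x a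

theorem cumulative_succ (x : Fin (n + 1) → ℝ) (i : Fin (n + 1)) :
    cumulative x ((i : ℕ) + 1) = cumulative x i + x i := sum_filter_lt_succ x i

@[simp] theorem cumulative_zero (x : Fin (n + 1) → ℝ) : cumulative x 0 = 0 := by
  simp [cumulative]

theorem cumulative_top (x : stdSimplex ℝ (Fin (n + 1))) : cumulative x (n + 1) = 1 := by
  rw [← stdSimplex.sum_eq_one x, cumulative, Finset.filter_true_of_mem]
  intro a _
  exact a.2

theorem cumulative_mono (x : stdSimplex ℝ (Fin (n + 1))) : Monotone (cumulative x) := by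
  intro i j h
  refine Finset.sum_le_sum_of_subset_of_nonneg (fun a ha ↦ ?_) fun a _ _ ↦ stdSimplex.zero_le x a
  simp only [Finset.mem_filter, Finset.mem_univ, true_and] at ha ⊢
  omega

theorem cumulative_nonneg (x : stdSimplex ℝ (Fin (n + 1))) (i : ℕ) : 0 ≤ cumulative x i :=
  Finset.sum_nonneg fun a _ ↦ stdSimplex.zero_le x a

/-- The joint distribution function of a measure on `{0, …, n} × {0, …, k}`. -/
def jointCumulative (μ : Fin (n + 1) × Fin (k + 1) → ℝ) (i j : ℕ) : ℝ :=
  cumulative (fun a ↦ cumulative (fun b ↦ μ (a, b)) j) i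

/-- The mass of a point is a mixed second difference of the joint distribution function. -/
theorem eq_of_jointCumulative {μ ν : Fin (n + 1) × Fin (k + 1) → ℝ}
    (h : ∀ i j, jointCumulative μ i j = jointCumulative ν i j) : μ = ν := by
  ext ⟨i, j⟩
  have key : ∀ μ : Fin (n + 1) × Fin (k + 1) → ℝ, μ (i, j) =
      jointCumulative μ (i + 1) (j + 1) - jointCumulative μ i (j + 1) -
      (jointCumulative μ (i + 1) j - jointCumulative μ i j) := fun μ ↦ by
    simp only [jointCumulative]
    rw [cumulative_succ, cumulative_succ, cumulative_succ]
    ring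
  rw [key μ, key ν]
  simp only [h]

/-- A measure supported on a chain is determined by its marginals. -/
theorem jointCumulative_eq_min (μ : stdSimplex ℝ (Fin (n + 1) × Fin (k + 1)))
    (hμ : ∀ p q, μ p ≠ 0 → μ q ≠ 0 → p ≤ q ∨ q ≤ p) (i j : ℕ) :
    jointCumulative μ i j = min (cumulative (fun a ↦ ∑ b, μ (a, b)) i)
      (cumulative (fun b ↦ ∑ a, μ (a, b)) j) := by
  have h0 : ∀ p, 0 ≤ μ p := fun p ↦ stdSimplex.zero_le μ p
  have e1 : jointCumulative μ i j = ∑ a : Fin (n + 1), ∑ b : Fin (k + 1), if (a : ℕ) < i ∧ (b : ℕ) < j then μ (a, b) else 0 := by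
    simp only [jointCumulative, cumulative, Finset.sum_filter]
    refine Finset.sum_congr rfl fun a _ ↦ ?_
    split_ifs with h <;> simp [h]
  have e2 : cumulative (fun a ↦ ∑ b, μ (a, b)) i =
      ∑ a : Fin (n + 1), ∑ b : Fin (k + 1), if (a : ℕ) < i then μ (a, b) else 0 := by
    simp only [cumulative, Finset.sum_filter]
    refine Finset.sum_congr rfl fun a _ ↦ ?_
    split_ifs with h <;> simp
  have e3 : cumulative (fun b ↦ ∑ a, μ (a, b)) j =
      ∑ a : Fin (n + 1), ∑ b : Fin (k + 1), if (b : ℕ) < j then μ (a, b) else 0 := by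
    rw [Finset.sum_comm]
    simp only [cumulative, Finset.sum_filter]
    refine Finset.sum_congr rfl fun b _ ↦ ?_
    split_ifs with h <;> simp
  have l1 : jointCumulative μ i j ≤ cumulative (fun a ↦ ∑ b, μ (a, b)) i := by
    rw [e1, e2]
    refine Finset.sum_le_sum fun a _ ↦ Finset.sum_le_sum fun b _ ↦ ?_
    have := h0 (a, b)
    split_ifs <;> grind
  have l2 : jointCumulative μ i j ≤ cumulative (fun b ↦ ∑ a, μ (a, b)) j := by
    rw [e1, e3]
    refine Finset.sum_le_sum fun a _ ↦ Finset.sum_le_sum fun b _ ↦ ?_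
    have := h0 (a, b)
    split_ifs <;> grind
  -- Either all support points with `a < i` have `b < j`, and the first bound is attained; or some
  -- support point has `a' < i` and `j ≤ b'`, and comparability with it forces `a < i` for every
  -- support point with `b < j`, so the second bound is attained.
  by_cases hc : ∀ a b, μ (a, b) ≠ 0 → (a : ℕ) < i → (b : ℕ) < j
  · refine le_antisymm (le_min l1 l2) ((min_le_left _ _).trans ?_)
    rw [e1, e2]
    refine Finset.sum_le_sum fun a _ ↦ Finset.sum_le_sum fun b _ ↦ ?_
    have := hc a b
    split_ifs <;> grind
  · refine le_antisymm (le_min l1 l2) ((min_le_right _ _).trans ?_)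
    push Not at hc
    obtain ⟨a', b', h1, h2, h3⟩ := hc
    rw [e1, e3]
    refine Finset.sum_le_sum fun a _ ↦ Finset.sum_le_sum fun b _ ↦ ?_
    by_cases hab : μ (a, b) = 0
    · simp [hab]
    have h4 : (b : ℕ) < j → (a : ℕ) < i := fun hb ↦ by
      rcases hμ _ _ h1 hab with h | h
      · have : (b' : ℕ) ≤ b := h.2
        omega
      · have : (a : ℕ) ≤ a' := h.1
        omega
    split_ifs <;> grind

theorem stdSimplex_map_fst (μ : stdSimplex ℝ (Fin (n + 1) × Fin (k + 1))) (a : Fin (n + 1)) :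
    stdSimplex.map Prod.fst μ a = ∑ b, μ (a, b) := by
  rw [stdSimplex_map_apply, Finset.sum_filter, Fintype.sum_prod_type]
  rw [Finset.sum_eq_single a (fun b _ h ↦ by simp [h]) (by simp)]
  simp

theorem stdSimplex_map_snd (μ : stdSimplex ℝ (Fin (n + 1) × Fin (k + 1))) (b : Fin (k + 1)) :
    stdSimplex.map Prod.snd μ b = ∑ a, μ (a, b) := by
  rw [stdSimplex_map_apply, Finset.sum_filter, Fintype.sum_prod_type_right]
  rw [Finset.sum_eq_single b (fun b _ h ↦ by simp [h]) (by simp)]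
  simp

/-- This is the comonotone coupling, whose joint distribution function is the minimum of the
marginal ones. The points of each marginal occupy consecutive intervals of `[0, 1]`, and the mass at
`(a, b)` is the overlap of the intervals of `a` and `b`. Two incomparable pairs cannot both have
overlapping intervals. -/
theorem exists_coupling (x : stdSimplex ℝ (Fin (n + 1))) (y : stdSimplex ℝ (Fin (k + 1))) :
    ∃ μ : stdSimplex ℝ (Fin (n + 1) × Fin (k + 1)), stdSimplex.map Prod.fst μ = x ∧
      stdSimplex.map Prod.snd μ = y ∧ ∀ p q, μ p ≠ 0 → μ q ≠ 0 → p ≤ q ∨ q ≤ p := by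
  let M : ℕ → ℕ → ℝ := fun i j ↦ min (cumulative x i) (cumulative y j)
  let z : Fin (n + 1) × Fin (k + 1) → ℝ := fun p ↦
    (M (p.1 + 1) (p.2 + 1) - M p.1 (p.2 + 1)) - (M (p.1 + 1) p.2 - M p.1 p.2)
  have hx := cumulative_mono x
  have hy := cumulative_mono y
  have htel : ∀ (m : ℕ) (f : ℕ → ℝ), ∑ b : Fin (m + 1), (f (b + 1) - f b) = f (m + 1) - f 0 :=
    fun m f ↦ by
      rw [Fin.sum_univ_eq_sum_range (fun b ↦ f (b + 1) - f b), Finset.sum_range_sub]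
  have hx1 : ∀ i : Fin (n + 1), cumulative x (i + 1) ≤ 1 := fun i ↦
    cumulative_top x ▸ hx (by omega)
  have hy1 : ∀ i : Fin (k + 1), cumulative y (i + 1) ≤ 1 := fun i ↦
    cumulative_top y ▸ hy (by omega)
  have h1 : ∀ a, ∑ b, z (a, b) = x a := fun a ↦ by
    have := htel k fun j ↦ M (a + 1) j - M a j
    have e : ∀ b : Fin (k + 1), z (a, b) =
      (M (a + 1) (b + 1) - M a (b + 1)) - (M (a + 1) b - M a b) := fun b ↦ rfl
    rw [Finset.sum_congr rfl fun b _ ↦ e b, this]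
    have hxa := hx (Nat.le_succ a)
    simp only [M, cumulative_top, cumulative_zero]
    rw [min_eq_left (hx1 a), min_eq_left (hxa.trans (hx1 a)),
      min_eq_right (cumulative_nonneg x _), min_eq_right (cumulative_nonneg x _), cumulative_succ]
    ring
  have h2 : ∀ b, ∑ a, z (a, b) = y b := fun b ↦ by
    have := htel n fun i ↦ M i (b + 1) - M i b
    have e : ∀ a : Fin (n + 1), z (a, b) =
      (M (a + 1) (b + 1) - M (a + 1) b) - (M a (b + 1) - M a b) := fun a ↦ by
        simp only [z]; ring
    rw [Finset.sum_congr rfl fun b _ ↦ e b, this]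
    have hxa := hy (Nat.le_succ b)
    simp only [M, cumulative_top, cumulative_zero]
    rw [min_eq_right (hy1 b), min_eq_right (hxa.trans (hy1 b)),
      min_eq_left (cumulative_nonneg y _), min_eq_left (cumulative_nonneg y _), cumulative_succ]
    ring
  have hz : ∀ p, 0 ≤ z p := fun p ↦ by
    have h1 := hx (Nat.le_succ p.1)
    have h2 := hy (Nat.le_succ p.2)
    simp only [z, M, Nat.succ_eq_add_one] at h1 h2 ⊢
    simp only [min_def]
    split_ifs <;> linarith
  have hz0 : ∀ p, z p ≠ 0 → cumulative y p.2 < cumulative x (p.1 + 1) ∧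
      cumulative x p.1 < cumulative y (p.2 + 1) := fun p hp ↦ by
    have h1 := hx (Nat.le_succ p.1)
    have h2 := hy (Nat.le_succ p.2)
    simp only [Nat.succ_eq_add_one] at h1 h2
    constructor
    · by_contra! h
      refine hp ?_
      simp only [z, M]
      rw [min_eq_left h, min_eq_left (h.trans h2), min_eq_left (h1.trans h),
        min_eq_left (h1.trans (h.trans h2))]
      ring
    · by_contra! h
      refine hp ?_
      simp only [z, M]
      rw [min_eq_right h, min_eq_right (h.trans h1), min_eq_right (h2.trans h),
        min_eq_right (h2.trans (h.trans h1))]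
      ring
  refine ⟨⟨z, hz, ?_⟩, ?_, ?_, fun p q hp hq ↦ ?_⟩
  · rw [Fintype.sum_prod_type, Finset.sum_congr rfl fun a _ ↦ h1 a]
    exact stdSimplex.sum_eq_one x
  · ext a
    rw [stdSimplex_map_fst]
    exact h1 a
  · ext a
    rw [stdSimplex_map_snd]
    exact h2 a
  · obtain ⟨p1, p2⟩ := hz0 p hp
    obtain ⟨q1, q2⟩ := hz0 q hq
    by_contra! h
    obtain ⟨h3, h4⟩ := h
    rw [Prod.le_def] at h3 h4
    have h5 : (p.1 < q.1 ∧ q.2 < p.2) ∨ (q.1 < p.1 ∧ p.2 < q.2) := by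
      rcases le_total p.1 q.1 with h | h <;> rcases le_total p.2 q.2 with h' | h' <;> grind
    rcases h5 with ⟨h5, h6⟩ | ⟨h5, h6⟩
    · have := hx (show (p.1 : ℕ) + 1 ≤ q.1 from h5)
      have := hy (show (q.2 : ℕ) + 1 ≤ p.2 from h6)
      linarith
    · have := hx (show (q.1 : ℕ) + 1 ≤ p.1 from h5)
      have := hy (show (p.2 : ℕ) + 1 ≤ q.2 from h6)
      linarith

/-- Every chain in `{0, …, n} × {0, …, k}` is contained in the image of a monotone map. -/
theorem exists_orderHom_of_chain (C : Set (Fin (n + 1) × Fin (k + 1)))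
    (hC : ∀ p ∈ C, ∀ q ∈ C, p ≤ q ∨ q ≤ p) :
    ∃ c : Fin (n + k + 1) →o Fin (n + 1) × Fin (k + 1), C ⊆ Set.range c := by
  classical
  let rk : Fin (n + 1) × Fin (k + 1) → ℕ := fun p ↦ p.1 + p.2
  -- In a chain this supremum is the largest element of rank at most `l`, or the bottom element if
  -- there is none.
  let c : ℕ → Fin (n + 1) × Fin (k + 1) := fun l ↦
    (Finset.univ.filter fun p ↦ p ∈ C ∧ rk p ≤ l).sup id
  have hc : Monotone c := fun l m h ↦ Finset.sup_mono fun p hp ↦ by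
    simp only [Finset.mem_filter, Finset.mem_univ, true_and] at hp ⊢
    exact ⟨hp.1, hp.2.trans h⟩
  refine ⟨⟨fun l ↦ c l, fun l m h ↦ hc h⟩, fun p hp ↦ ?_⟩
  refine ⟨⟨rk p, by have := p.1.2; have := p.2.2; simp only [rk]; omega⟩, ?_⟩
  change c (rk p) = p
  refine le_antisymm (Finset.sup_le fun q hq ↦ ?_) (Finset.le_sup (f := id) (by simpa using hp))
  simp only [Finset.mem_filter, Finset.mem_univ, true_and] at hq
  rcases hC q hq.1 p hp with h | h
  · exact h
  · have h1 : (p.1 : ℕ) ≤ q.1 := h.1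
    have h2 : (p.2 : ℕ) ≤ q.2 := h.2
    have h3 := hq.2
    simp only [rk] at h3
    refine le_of_eq (Prod.ext (Fin.ext ?_) (Fin.ext ?_))
    · simp only [id]; omega
    · simp only [id]; omega

/-- The map `|Δ[n] × Δ[k]| → Δⁿ × Δᵏ`. -/
noncomputable def prodCoordinates (n k : ℕ) : C(|(Δ[n] ⊗ Δ[k] : SSet.{u})|,
    stdSimplex ℝ (Fin (n + 1)) × stdSimplex ℝ (Fin (k + 1))) :=
  ⟨fun p ↦ (stdSimplex.map Prod.fst ((VertexEmbedding.ofProd n k).coordinates p),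
    stdSimplex.map Prod.snd ((VertexEmbedding.ofProd n k).coordinates p)),
    ((stdSimplex.continuous_map _).comp (VertexEmbedding.ofProd n k).coordinates.continuous).prodMk
    ((stdSimplex.continuous_map _).comp (VertexEmbedding.ofProd n k).coordinates.continuous)⟩

theorem prodCoordinates_cellMap {m : ℕ} (x : (Δ[n] ⊗ Δ[k] : SSet.{u}) _⦋m⦌)
    (t : stdSimplex ℝ (Fin (m + 1))) :
    prodCoordinates n k (cellMap x t) = (stdSimplex.map (SSet.stdSimplex.asOrderHom x.1) t,
      stdSimplex.map (SSet.stdSimplex.asOrderHom x.2) t) := by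
  simp only [prodCoordinates, ContinuousMap.coe_mk]
  rw [VertexEmbedding.coordinates_cellMap, stdSimplex.map_comp_apply, stdSimplex.map_comp_apply]
  rfl

/-- Points of `|Δ[n] × Δ[k]|` are the measures on the grid that are supported on a chain, and the
map takes marginals. A chain-supported measure is determined by its marginals, and the comonotone
coupling realizes every pair of them. -/
theorem prodCoordinates_bijective (n k : ℕ) :
    Function.Bijective (prodCoordinates.{u} n k) := by
  have hch : ∀ p : |(Δ[n] ⊗ Δ[k] : SSet.{u})|, ∀ a b,
      (VertexEmbedding.ofProd n k).coordinates p a ≠ 0 →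
      (VertexEmbedding.ofProd n k).coordinates p b ≠ 0 → a ≤ b ∨ b ≤ a := fun p a b ha hb ↦ by
    have := Set.mem_range_self (f := (VertexEmbedding.ofProd n k).coordinates) p
    rw [VertexEmbedding.range_coordinates] at this
    obtain ⟨m, x, hx⟩ := this
    obtain ⟨i, rfl⟩ := hx a ha
    obtain ⟨j, rfl⟩ := hx b hb
    exact (le_total i j).imp (fun h ↦ OrderHom.monotone _ h) fun h ↦ OrderHom.monotone _ h
  constructor
  · intro p q hpq
    apply (VertexEmbedding.ofProd n k).coordinates_injective
    refine stdSimplex.ext (eq_of_jointCumulative fun i j ↦ ?_)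
    rw [jointCumulative_eq_min _ (hch p), jointCumulative_eq_min _ (hch q)]
    have h1 := fun a ↦ DFunLike.congr_fun (congrArg Prod.fst hpq) a
    have h2 := fun a ↦ DFunLike.congr_fun (congrArg Prod.snd hpq) a
    simp only [prodCoordinates, ContinuousMap.coe_mk, stdSimplex_map_fst,
      stdSimplex_map_snd] at h1 h2
    simp only [h1, h2]
  · rintro ⟨x, y⟩
    obtain ⟨μ, h1, h2, h3⟩ := exists_coupling x y
    obtain ⟨c, hc⟩ := exists_orderHom_of_chain {p | μ p ≠ 0} fun p hp q hq ↦ h3 p q hp hq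
    have : μ ∈ Set.range (VertexEmbedding.ofProd.{u} n k).coordinates := by
      rw [VertexEmbedding.range_coordinates]
      refine ⟨n + k, (SSet.stdSimplex.objMk (OrderHom.fst.comp c),
        SSet.stdSimplex.objMk (OrderHom.snd.comp c)), fun i hi ↦ ?_⟩
      obtain ⟨j, rfl⟩ := hc hi
      exact ⟨j, rfl⟩
    obtain ⟨p, hp⟩ := this
    exact ⟨p, by simp only [prodCoordinates, ContinuousMap.coe_mk, hp, h1, h2]⟩

/-- The homeomorphism between `|Δ[n] × Δ[k]|` and `Δⁿ × Δᵏ`. -/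
noncomputable def prodHomeomorph (n k : ℕ) : |(Δ[n] ⊗ Δ[k] : SSet.{u})| ≃ₜ
    stdSimplex ℝ (Fin (n + 1)) × stdSimplex ℝ (Fin (k + 1)) :=
  have := (VertexEmbedding.ofProd.{u} n k).compactSpace
  Continuous.homeoOfEquivCompactToT2 (f := Equiv.ofBijective _ (prodCoordinates_bijective n k))
    (prodCoordinates n k).continuous

end Products

end

section

open CategoryTheory Opposite Simplicial Topology MonoidalCategory
open SSet.modelCategoryQuillen


/-! ### Cylinders, simplicial homotopies and anodyne extensions after realization. -/

section Cylinders

variable {S T : SSet.{u}}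

/-- The simplex of `S × T` with given components. -/
def prodSimplex {n : ℕ} (x : S _⦋n⦌) (y : T _⦋n⦌) : (S ⊗ T : SSet.{u}) _⦋n⦌ := (x, y)

/-- The simplex of `Δ[k]` given by a simplicial operator. -/
def stdSimplexMk {m k : ℕ} (a : ⦋m⦌ ⟶ ⦋k⦌) : (Δ[k] : SSet.{u}) _⦋m⦌ :=
  SSet.stdSimplex.objEquiv.symm a

/-- The inverse `Δⁿ × Δᵏ → |Δ[n] × Δ[k]|` of the canonical map. -/
noncomputable def shuffleMap (n k : ℕ) :
    C(stdSimplex ℝ (Fin (n + 1)) × stdSimplex ℝ (Fin (k + 1)), |(Δ[n] ⊗ Δ[k] : SSet.{u})|) :=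
  ((prodHomeomorph n k).symm : C(_, _))

theorem shuffleMap_eq_iff {n k : ℕ}
    {q : stdSimplex ℝ (Fin (n + 1)) × stdSimplex ℝ (Fin (k + 1))}
    {p : |(Δ[n] ⊗ Δ[k] : SSet.{u})|} : shuffleMap n k q = p ↔ prodCoordinates n k p = q := by
  change (prodHomeomorph n k).symm q = p ↔ prodHomeomorph n k p = q
  rw [Homeomorph.symm_apply_eq, eq_comm]

theorem shuffleMap_map {n k m : ℕ} (b : ⦋m⦌ ⟶ ⦋n⦌) (a : ⦋m⦌ ⟶ ⦋k⦌)
    (s : stdSimplex ℝ (Fin (m + 1))) :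
    shuffleMap.{u} n k (stdSimplex.map b.toOrderHom s, stdSimplex.map a.toOrderHom s) =
      cellMap (prodSimplex (stdSimplexMk b) (stdSimplexMk a)) s := by
  rw [shuffleMap_eq_iff, prodCoordinates_cellMap]
  rfl

/-- A preimage of `(t, y)` in `|Δ[n] × Δ[k]|` lies in a cell, that is, in a pair of operators with a
common source. Identities between maps on products can therefore be checked on cells. -/
theorem exists_common_refinement {n k : ℕ} (t : stdSimplex ℝ (Fin (n + 1)))
    (y : stdSimplex ℝ (Fin (k + 1))) :
    ∃ (m : ℕ) (b : ⦋m⦌ ⟶ ⦋n⦌) (a : ⦋m⦌ ⟶ ⦋k⦌) (s : stdSimplex ℝ (Fin (m + 1))),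
      t = stdSimplex.map b.toOrderHom s ∧ y = stdSimplex.map a.toOrderHom s := by
  obtain ⟨m, x, s, h⟩ := exists_cellMap_eq (shuffleMap.{0} n k (t, y))
  have h' := shuffleMap_eq_iff.1 h.symm
  rw [prodCoordinates_cellMap] at h'
  exact ⟨m, SSet.stdSimplex.objEquiv x.1, SSet.stdSimplex.objEquiv x.2, s,
    (congrArg Prod.fst h').symm, (congrArg Prod.snd h').symm⟩

/-- The simplicial map `S → Sing C(Δᵏ, |S × Δ[k]|)`. -/
noncomputable def cylinderAdjoint (S : SSet.{u}) (k : ℕ) :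
    S ⟶ TopCat.toSSet.obj (TopCat.of C(stdSimplex ℝ (Fin (k + 1)), |(S ⊗ Δ[k] : SSet.{u})|)) :=
  toSingular (fun n x ↦ ContinuousMap.curry
    ((SSet.toTop.map (SSet.yonedaEquiv.symm x ▷ Δ[k])).hom.comp (shuffleMap n.unop.len k))) (by
    intro n m f x t
    ext y
    obtain ⟨l, b, a, s, rfl, rfl⟩ := exists_common_refinement t y
    rw [ContinuousMap.curry_apply, ContinuousMap.curry_apply, ContinuousMap.comp_apply,
      ContinuousMap.comp_apply, shuffleMap_map b a s, stdSimplex.map_comp_apply]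
    have e := shuffleMap_map.{u} (b ≫ f.unop) a s
    refine Eq.trans ?_ (congrArg _ e.symm)
    rw [toTop_map_cellMap, toTop_map_cellMap]
    refine congrArg (fun z ↦ cellMap (prodSimplex z (stdSimplexMk a)) s) ?_
    change S.map b.op (S.map f x) = S.map (b ≫ f.unop).op x
    rw [op_comp, S.map_comp]
    rfl)

/-- The canonical map `|S| × Δᵏ → |S × Δ[k]|`. -/
noncomputable def cylinderMap (S : SSet.{u}) (k : ℕ) :
    C(|S| × stdSimplex ℝ (Fin (k + 1)), |(S ⊗ Δ[k] : SSet.{u})|) :=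
  -- The exponential law for the locally compact space `Δᵏ` gives continuity on the product without
  -- a cell structure on it.
  ContinuousMap.uncurry (realizationDesc (cylinderAdjoint S k))

theorem cylinderMap_cellMap {n k m : ℕ} (x : S _⦋n⦌) (b : ⦋m⦌ ⟶ ⦋n⦌) (a : ⦋m⦌ ⟶ ⦋k⦌)
    (s : stdSimplex ℝ (Fin (m + 1))) :
    cylinderMap S k (cellMap x (stdSimplex.map b.toOrderHom s), stdSimplex.map a.toOrderHom s) =
      cellMap (prodSimplex (S.map b.op x) (stdSimplexMk a)) s := by
  have h : cylinderMap S k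
      (cellMap x (stdSimplex.map b.toOrderHom s), stdSimplex.map a.toOrderHom s) =
      (realizationDesc (cylinderAdjoint S k) (cellMap x (stdSimplex.map b.toOrderHom s)))
        (stdSimplex.map a.toOrderHom s) := rfl
  rw [h, realizationDesc_cellMap]
  refine (congrArg (SSet.toTop.map (SSet.yonedaEquiv.symm x ▷ Δ[k])).hom
    (shuffleMap_map b a s)).trans ?_
  rw [toTop_map_cellMap]
  rfl

theorem cylinder_induction {k : ℕ} {motive : |S| → stdSimplex ℝ (Fin (k + 1)) → Prop}
    (h : ∀ (n m : ℕ) (x : S _⦋n⦌) (b : ⦋m⦌ ⟶ ⦋n⦌) (a : ⦋m⦌ ⟶ ⦋k⦌) (s),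
      motive (cellMap x (stdSimplex.map b.toOrderHom s)) (stdSimplex.map a.toOrderHom s))
    (p y) : motive p y := by
  obtain ⟨n, x, t, rfl⟩ := exists_cellMap_eq p
  obtain ⟨l, b, a, s, rfl, rfl⟩ := exists_common_refinement t y
  exact h n l x b a s

theorem cylinderMap_naturality (f : S ⟶ T) (k : ℕ) (p : |S|) (y) :
    (SSet.toTop.map (f ▷ Δ[k])).hom (cylinderMap S k (p, y)) =
      cylinderMap T k ((SSet.toTop.map f).hom p, y) := by
  induction p, y using cylinder_induction with | h n m x b a s => ?_
  rw [cylinderMap_cellMap, toTop_map_cellMap, toTop_map_cellMap, cylinderMap_cellMap]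
  exact congrArg (fun z ↦ cellMap (prodSimplex z (stdSimplexMk a)) s)
    (ConcreteCategory.congr_hom (f.naturality b.op) x)

theorem cylinderMap_map {k l : ℕ} (g : ⦋k⦌ ⟶ ⦋l⦌) (p : |S|) (y : stdSimplex ℝ (Fin (k + 1))) :
    (SSet.toTop.map (S ◁ SSet.stdSimplex.map g)).hom (cylinderMap S k (p, y)) =
      cylinderMap S l (p, stdSimplex.map g.toOrderHom y) := by
  induction p, y using cylinder_induction with | h n m x b a s => ?_
  rw [cylinderMap_cellMap, toTop_map_cellMap, stdSimplex.map_comp_apply]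
  exact (cylinderMap_cellMap x b (a ≫ g) s).symm

theorem cylinderMap_vertex {n k : ℕ} (i : Fin (k + 1)) (x : S _⦋n⦌) (t) :
    cylinderMap S k (cellMap x t, stdSimplex.vertex i) =
      cellMap (prodSimplex x
        (stdSimplexMk (SimplexCategory.Hom.mk ⟨fun _ ↦ i, fun _ _ _ ↦ le_rfl⟩))) t := by
  have h1 : t = stdSimplex.map (𝟙 ⦋n⦌ : ⦋n⦌ ⟶ ⦋n⦌).toOrderHom t :=
    (stdSimplex.map_id_apply t).symm
  let a : ⦋n⦌ ⟶ ⦋k⦌ := SimplexCategory.Hom.mk ⟨fun _ ↦ i, fun _ _ _ ↦ le_rfl⟩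
  have h2 : stdSimplex.vertex (S := ℝ) i = stdSimplex.map a.toOrderHom t := by
    ext j
    rw [stdSimplex_map_apply, stdSimplex.vertex_coe]
    change _ = ∑ x with i = j, t x
    by_cases hj : i = j
    · subst hj
      simp
    · simp [hj, Ne.symm hj]
  conv_lhs => rw [h1, h2]
  rw [cylinderMap_cellMap]
  refine congrArg (fun z ↦ cellMap (prodSimplex z (stdSimplexMk a)) t) ?_
  rw [op_id, S.map_id]
  rfl

theorem cylinderMap_vertex_zero (p : |S|) :
    cylinderMap S 1 (p, stdSimplex.vertex 0) = (SSet.toTop.map SSet.ι₀).hom p := by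
  obtain ⟨n, x, t, rfl⟩ := exists_cellMap_eq p
  rw [cylinderMap_vertex, toTop_map_cellMap]
  rfl

theorem cylinderMap_vertex_one (p : |S|) :
    cylinderMap S 1 (p, stdSimplex.vertex 1) = (SSet.toTop.map SSet.ι₁).hom p := by
  obtain ⟨n, x, t, rfl⟩ := exists_cellMap_eq p
  rw [cylinderMap_vertex, toTop_map_cellMap]
  rfl

/-- Simplicially homotopic maps have homotopic realizations. -/
theorem homotopic_realization {f g : S ⟶ T} (h : S ⊗ Δ[1] ⟶ T) (h0 : SSet.ι₀ ≫ h = f)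
    (h1 : SSet.ι₁ ≫ h = g) : (SSet.toTop.map f).hom.Homotopic (SSet.toTop.map g).hom := by
  refine ⟨⟨⟨fun p ↦ (SSet.toTop.map h).hom
    (cylinderMap S 1 (p.2, stdSimplexHomeomorphUnitInterval.symm p.1)), by fun_prop⟩, fun p ↦ ?_,
    fun p ↦ ?_⟩⟩
  · have e : stdSimplexHomeomorphUnitInterval.symm 0 = stdSimplex.vertex (0 : Fin 2) := by
      rw [Homeomorph.symm_apply_eq, stdSimplexHomeomorphUnitInterval_zero]
    simp only
    rw [e, cylinderMap_vertex_zero, ← h0, SSet.toTop.map_comp]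
    rfl
  · have e : stdSimplexHomeomorphUnitInterval.symm 1 = stdSimplex.vertex (1 : Fin 2) := by
      rw [Homeomorph.symm_apply_eq, stdSimplexHomeomorphUnitInterval_one]
    simp only
    rw [e, cylinderMap_vertex_one, ← h1, SSet.toTop.map_comp]
    rfl

/-- Two maps into a Kan complex which agree on an anodyne subcomplex are homotopic. -/
theorem exists_homotopy_of_anodyne {A : T.Subcomplex} (hA : SSet.anodyneExtensions A.ι)
    {X : SSet.{u}} [SSet.KanComplex X] (f g : T ⟶ X) (hfg : A.ι ≫ f = A.ι ≫ g) :
    ∃ h : T ⊗ Δ[1] ⟶ X, SSet.ι₀ ≫ h = f ∧ SSet.ι₁ ≫ h = g := by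
  classical
  let U := A.unionProd (SSet.boundary.{u} 1)
  have hAfg : ∀ n (x : T.obj n), x ∈ A.obj n → f.app n x = g.app n x := fun n x hx ↦
    ConcreteCategory.congr_hom (congrArg (fun φ ↦ φ.app n) hfg) ⟨x, hx⟩
  -- `Z` singles out the simplices over the end `0`. The other simplices of `U` lie over the end `1`
  -- or in `A × Δ[1]`, and in the latter `f = g`, so the case distinction defining `k` is compatible
  -- with operators.
  let Z : ∀ {n : SimplexCategoryᵒᵖ}, (T ⊗ Δ[1]).obj n → Prop := fun x ↦
    ∀ i, SSet.stdSimplex.asOrderHom x.2 i = 0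
  have hZ : ∀ {n m : SimplexCategoryᵒᵖ} (φ : n ⟶ m) (x : (T ⊗ Δ[1]).obj n),
      x ∈ U.obj n → Z ((T ⊗ Δ[1]).map φ x) → ¬ Z x → x.1 ∈ A.obj n := by
    intro n m φ x hx h1 h2
    rcases (SSet.Subcomplex.mem_unionProd_iff _ _ _).1 hx with h | h
    · exfalso
      apply h
      intro j
      by_cases hj : j = 0
      · exact ⟨_, (h1 0).trans hj.symm⟩
      · obtain ⟨i, hi⟩ := not_forall.1 h2
        refine ⟨i, ?_⟩
        revert hi hj
        generalize SSet.stdSimplex.asOrderHom x.2 i = k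
        revert j k
        decide
    · exact h
  let k : (U : SSet.{u}) ⟶ X :=
    { app := fun n ↦ ↾fun x ↦ if Z x.1 then f.app n x.1.1 else g.app n x.1.1
      naturality := fun n m φ ↦ by
        ext x
        change (if Z ((T ⊗ Δ[1]).map φ x.1) then f.app m (T.map φ x.1.1) else
          g.app m (T.map φ x.1.1)) = X.map φ (if Z x.1 then f.app n x.1.1 else g.app n x.1.1)
        have nf := ConcreteCategory.congr_hom (f.naturality φ) x.1.1
        have ng := ConcreteCategory.congr_hom (g.naturality φ) x.1.1
        by_cases h1 : Z x.1
        · have h2 : Z ((T ⊗ Δ[1]).map φ x.1) := fun i ↦ h1 _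
          rw [if_pos h1, if_pos h2]
          exact nf
        · rw [if_neg h1]
          by_cases h2 : Z ((T ⊗ Δ[1]).map φ x.1)
          · rw [if_pos h2, ← hAfg _ _ (hZ φ x.1 x.2 h2 h1)]
            exact nf
          · rw [if_neg h2]
            exact ng }
  have hU : SSet.anodyneExtensions U.ι := SSet.anodyneExtensions_unionProd_ι' _ _ hA
  have := hU _ (HomotopicalAlgebra.mem_fibrations (Limits.terminal.from X))
  have sq : CommSq k U.ι (Limits.terminal.from X) (Limits.terminal.from _) := ⟨by simp⟩
  have hl : U.ι ≫ sq.lift = k := sq.fac_left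
  have key : ∀ n (x : (T ⊗ Δ[1]).obj n) (hx : x ∈ U.obj n), sq.lift.app n x = k.app n ⟨x, hx⟩ :=
    fun n x hx ↦ ConcreteCategory.congr_hom (congrArg (fun φ ↦ φ.app n) hl) ⟨x, hx⟩
  have hb : ∀ (i : Fin 2) (n : SimplexCategoryᵒᵖ) (x : (T ⊗ Δ[1]).obj n),
      (∀ j, SSet.stdSimplex.asOrderHom x.2 j = i) → x ∈ U.obj n := fun i n x hx ↦ by
    refine (SSet.Subcomplex.mem_unionProd_iff _ _ _).2 (Or.inl fun hs ↦ ?_)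
    obtain ⟨j0, h0⟩ := hs 0
    obtain ⟨j1, h1⟩ := hs 1
    rw [hx] at h0 h1
    exact absurd (h0.symm.trans h1) (by decide)
  refine ⟨sq.lift, ?_, ?_⟩
  · ext n x
    refine (key n _ (hb 0 n _ fun j ↦ rfl)).trans ?_
    exact if_pos fun i ↦ rfl
  · ext n x
    refine (key n _ (hb 1 n _ fun j ↦ rfl)).trans ?_
    refine if_neg fun h ↦ ?_
    exact absurd (h 0) (by change (1 : Fin 2) ≠ 0; decide)

theorem realization_unit {S : SSet.{u}} {E : TopCat.{u}} (f : |S| ⟶ E) :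
    realizationDesc (sSetTopAdj.unit.app S ≫ TopCat.toSSet.map f) = f.hom := by
  apply realization_hom_ext
  intro n x t
  rw [realizationDesc_cellMap]
  rfl

theorem homotopic_realizationDesc {E : TopCat.{u}} {f g : S ⟶ TopCat.toSSet.obj E}
    (h : S ⊗ Δ[1] ⟶ TopCat.toSSet.obj E) (h0 : SSet.ι₀ ≫ h = f) (h1 : SSet.ι₁ ≫ h = g) :
    (realizationDesc f).Homotopic (realizationDesc g) := by
  have key : ∀ f : S ⟶ TopCat.toSSet.obj E, realizationDesc f =
      (realizationDesc (𝟙 (TopCat.toSSet.obj E))).comp (SSet.toTop.map f).hom := fun f ↦ by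
    apply realization_hom_ext
    intro n x t
    rw [ContinuousMap.comp_apply, toTop_map_cellMap, realizationDesc_cellMap,
      realizationDesc_cellMap]
    rfl
  rw [key f, key g]
  exact (ContinuousMap.Homotopic.refl _).comp (homotopic_realization h h0 h1)

/-- The realized inclusion is a homotopy equivalence. As `Sing|A|` is Kan, the unit of `A` extends
over `T` and gives a retraction `r`. Its composite with the inclusion agrees with the identity on
`A`, and maps to the Kan complex `Sing|T|` that agree on `A` are homotopic. -/
theorem compressesUpTo_of_anodyne {A : T.Subcomplex} (hA : SSet.anodyneExtensions A.ι) (N : ℕ) :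
    CompressesUpTo N (SSet.toTop.map A.ι).hom := by
  have := hA _ (HomotopicalAlgebra.mem_fibrations
    (Limits.terminal.from (TopCat.toSSet.obj |(A : SSet.{u})|)))
  have sq : CommSq (sSetTopAdj.unit.app (A : SSet.{u})) A.ι
    (Limits.terminal.from (TopCat.toSSet.obj |(A : SSet.{u})|)) (Limits.terminal.from _) :=
    ⟨by simp⟩
  have hl : A.ι ≫ sq.lift = sSetTopAdj.unit.app (A : SSet.{u}) := sq.fac_left
  let r : |T| ⟶ |(A : SSet.{u})| := TopCat.ofHom (realizationDesc sq.lift)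
  have hri : r.hom.comp (SSet.toTop.map A.ι).hom = ContinuousMap.id _ := by
    apply realization_hom_ext
    intro n x t
    rw [ContinuousMap.comp_apply, toTop_map_cellMap]
    change realizationDesc sq.lift (cellMap _ t) = _
    rw [realizationDesc_cellMap]
    exact congrArg (fun φ ↦ TopCat.toSSetObjEquiv _ _ (φ.app (op ⦋n⦌) x) t) hl
  obtain ⟨h, h0, h1⟩ := exists_homotopy_of_anodyne hA
    (sSetTopAdj.unit.app T ≫ TopCat.toSSet.map (r ≫ SSet.toTop.map A.ι))
    (sSetTopAdj.unit.app T ≫ TopCat.toSSet.map (𝟙 _)) (by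
      ext n x
      apply (TopCat.toSSetObjEquiv _ _).injective
      ext t
      change (SSet.toTop.map A.ι).hom (r.hom (cellMap (n := n.unop.len) (x : T.obj n) t)) =
        cellMap (n := n.unop.len) (x : T.obj n) t
      have e : cellMap (n := n.unop.len) (x : T.obj n) t = (SSet.toTop.map A.ι).hom
        (cellMap (S := (A : SSet.{u})) (n := n.unop.len) x t) := (toTop_map_cellMap A.ι _ _).symm
      rw [e]
      exact congrArg _ (DFunLike.congr_fun hri _))
  have hh := homotopic_realizationDesc h h0 h1
  rw [realization_unit, realization_unit] at hh
  refine CompressesUpTo.of_homotopyInverse (g := r.hom) ?_ hh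
  rw [hri]

end Cylinders

end

section

open scoped unitInterval

/-! ### The simplex as a ball and as a cube. -/

section SimplexBall

/-- The standard simplex, projected to its last `n` coordinates. -/
def cornerSimplex (n : ℕ) : Set (Fin n → ℝ) := {y | (∀ i, 0 ≤ y i) ∧ ∑ i, y i ≤ 1}

theorem convex_cornerSimplex (n : ℕ) : Convex ℝ (cornerSimplex n) := by
  intro x hx y hy a b ha hb hab
  refine ⟨fun i ↦ ?_, ?_⟩
  · have := hx.1 i
    have := hy.1 i
    simp only [Pi.add_apply, Pi.smul_apply, smul_eq_mul]
    positivity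
  · simp only [Pi.add_apply, Pi.smul_apply, smul_eq_mul, Finset.sum_add_distrib, ← Finset.mul_sum]
    nlinarith [hx.2, hy.2]

theorem isClosed_cornerSimplex (n : ℕ) : IsClosed (cornerSimplex n) := by
  have h1 : IsClosed (⋂ i, Set.ofPred fun y : Fin n → ℝ ↦ 0 ≤ y i) :=
    isClosed_iInter fun i ↦ isClosed_le continuous_const (continuous_apply i)
  have h2 : IsClosed (Set.ofPred fun y : Fin n → ℝ ↦ ∑ i, y i ≤ 1) :=
    isClosed_le (by fun_prop) continuous_const
  convert! h1.inter h2 using 1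
  ext y
  simp [cornerSimplex]

theorem isBounded_cornerSimplex (n : ℕ) : Bornology.IsBounded (cornerSimplex n) := by
  refine (Metric.isBounded_Icc (0 : Fin n → ℝ) 1).subset fun y hy ↦ ⟨hy.1, fun i ↦ ?_⟩
  exact (Finset.single_le_sum (fun i _ ↦ hy.1 i) (Finset.mem_univ i)).trans hy.2

theorem interior_cornerSimplex (n : ℕ) :
    interior (cornerSimplex n) = {y | (∀ i, 0 < y i) ∧ ∑ i, y i < 1} := by
  apply subset_antisymm
  · intro y hy
    have key : ∀ w : Fin n → ℝ, ∃ ε > 0, y + (ε : ℝ) • w ∈ cornerSimplex n := fun w ↦ by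
      have hc : Filter.Tendsto (fun ε : ℝ ↦ y + ε • w) (𝓝[>] 0) (𝓝 (y + (0 : ℝ) • w)) :=
        Filter.Tendsto.mono_left (Continuous.tendsto (by fun_prop) 0) nhdsWithin_le_nhds
      rw [zero_smul, add_zero] at hc
      obtain ⟨ε, h1, h2⟩ := ((hc.eventually (mem_interior_iff_mem_nhds.1 hy)).and
        self_mem_nhdsWithin).exists
      exact ⟨ε, h2, h1⟩
    have hy' := interior_subset hy
    refine ⟨fun i ↦ (hy'.1 i).lt_of_ne fun h ↦ ?_, hy'.2.lt_of_ne fun h ↦ ?_⟩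
    · obtain ⟨ε, h0, h1⟩ := key (Pi.single i (-1))
      have := h1.1 i
      simp only [Pi.add_apply, Pi.smul_apply, Pi.single_eq_same, smul_eq_mul] at this
      linarith
    · obtain ⟨ε, h0, h1⟩ := key 1
      have := h1.2
      simp only [Pi.add_apply, Pi.smul_apply, Pi.one_apply, smul_eq_mul, Finset.sum_add_distrib,
        h, mul_one, Finset.sum_const, Finset.card_univ, Fintype.card_fin, nsmul_eq_mul] at this
      rcases n with _ | n
      · simp at h
      · push_cast at this
        nlinarith [mul_nonneg h0.le (Nat.cast_nonneg (α := ℝ) n)]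
  · refine interior_maximal (fun y hy ↦ ⟨fun i ↦ (hy.1 i).le, hy.2.le⟩) ?_
    have h1 : IsOpen (⋂ i, Set.ofPred fun y : Fin n → ℝ ↦ 0 < y i) :=
      isOpen_iInter_of_finite fun i ↦ isOpen_lt continuous_const (continuous_apply i)
    have h2 : IsOpen (Set.ofPred fun y : Fin n → ℝ ↦ ∑ i, y i < 1) :=
      isOpen_lt (by fun_prop) continuous_const
    convert! h1.inter h2 using 1
    ext y
    simp

/-- The standard simplex as a subset of Euclidean space of the right dimension. -/
def stdSimplexHomeomorphCorner (n : ℕ) : stdSimplex ℝ (Fin (n + 1)) ≃ₜ cornerSimplex n where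
  toFun t := ⟨fun i ↦ t i.succ, fun i ↦ t.2.1 _, by
    have := stdSimplex.sum_eq_one t
    rw [Fin.sum_univ_succ] at this
    linarith [stdSimplex.zero_le t 0]⟩
  invFun y := ⟨Fin.cons (1 - ∑ i, y.1 i) y.1, fun i ↦ by
    refine Fin.cases ?_ (fun i ↦ ?_) i
    · simpa using y.2.2
    · simpa using y.2.1 i, by
    simp [Fin.sum_univ_succ]⟩
  left_inv t := by
    ext i
    refine Fin.cases ?_ (fun i ↦ ?_) i
    · have := stdSimplex.sum_eq_one t
      rw [Fin.sum_univ_succ] at this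
      change 1 - ∑ i : Fin n, t i.succ = t 0
      linarith
    · rfl
  right_inv y := by
    ext i
    rfl
  continuous_toFun := by
    refine Continuous.subtype_mk (continuous_pi fun i ↦ ?_) _
    exact (continuous_apply (i.succ)).comp continuous_subtype_val
  continuous_invFun := by
    refine Continuous.subtype_mk (continuous_pi fun i ↦ ?_) _
    refine Fin.cases ?_ (fun i ↦ ?_) i
    · simp only [Fin.cons_zero]
      exact continuous_const.sub (continuous_finsetSum _ fun i _ ↦
        (continuous_apply i).comp continuous_subtype_val)
    · simp only [Fin.cons_succ]
      exact (continuous_apply i).comp continuous_subtype_val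

theorem stdSimplexHomeomorphCorner_mem_interior {n : ℕ} (t : stdSimplex ℝ (Fin (n + 1))) :
    (stdSimplexHomeomorphCorner n t : Fin n → ℝ) ∈ interior (cornerSimplex n) ↔ ∀ j, t j ≠ 0 := by
  have := stdSimplex.sum_eq_one t
  rw [Fin.sum_univ_succ] at this
  rw [interior_cornerSimplex, Fin.forall_fin_succ]
  change ((∀ i : Fin n, 0 < t i.succ) ∧ ∑ i : Fin n, t i.succ < (1 : ℝ)) ↔ _
  rw [and_comm]
  refine and_congr ⟨fun h h' ↦ by linarith, fun h ↦ ?_⟩ (forall_congr' fun i ↦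
    ⟨fun h ↦ h.ne', fun h ↦ (stdSimplex.zero_le t _).lt_of_ne' h⟩)
  linarith [(stdSimplex.zero_le t 0).lt_of_ne' h]

/-- The standard simplex is a ball. -/
theorem exists_stdSimplex_homeomorph_closedBall (n : ℕ) :
    ∃ e : stdSimplex ℝ (Fin (n + 1)) ≃ₜ Metric.closedBall (0 : Fin n → ℝ) 1,
      ∀ t, ‖(e t : Fin n → ℝ)‖ = 1 ↔ ∃ j, t j = 0 := by
  have hne : (interior (cornerSimplex n)).Nonempty := by
    let t : stdSimplex ℝ (Fin (n + 1)) := ⟨fun _ ↦ ((n : ℝ) + 1)⁻¹, fun _ ↦ by positivity, by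
      simp; field_simp⟩
    refine ⟨_, (stdSimplexHomeomorphCorner_mem_interior t).2 fun j ↦ ?_⟩
    change ((n : ℝ) + 1)⁻¹ ≠ 0
    positivity
  obtain ⟨h, h1, h2, -⟩ := exists_homeomorph_image_interior_closure_frontier_eq_unitBall
    (convex_cornerSimplex n) hne (isBounded_cornerSimplex n)
  rw [(isClosed_cornerSimplex n).closure_eq] at h2
  refine ⟨(stdSimplexHomeomorphCorner n).trans ((h.image _).trans (Homeomorph.setCongr h2)),
    fun t ↦ ?_⟩
  have h3 : ‖h (stdSimplexHomeomorphCorner n t)‖ ≤ 1 := by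
    have : h (stdSimplexHomeomorphCorner n t) ∈ h '' cornerSimplex n :=
      Set.mem_image_of_mem _ (stdSimplexHomeomorphCorner n t).2
    rw [h2] at this
    simpa using this
  change ‖h (stdSimplexHomeomorphCorner n t)‖ = 1 ↔ _
  rw [← not_iff_not, ← Ne, ← h3.lt_iff_ne, ← mem_ball_zero_iff, ← h1,
    h.injective.mem_set_image, stdSimplexHomeomorphCorner_mem_interior]
  push Not
  rfl

/-- The unit ball for the supremum norm is a cube. -/
noncomputable def closedBallHomeomorphCube (n : ℕ) : Metric.closedBall (0 : Fin n → ℝ) 1 ≃ₜ (Fin n → I) where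
  toFun y i := ⟨(1 + y.1 i) / 2, by
    have h : ‖y.1‖ ≤ 1 := mem_closedBall_zero_iff.1 y.2
    have := abs_le.1 ((norm_le_pi_norm y.1 i).trans h)
    constructor <;> linarith⟩
  invFun q := ⟨fun i ↦ 2 * (q i : ℝ) - 1, by
    rw [mem_closedBall_zero_iff, pi_norm_le_iff_of_nonneg zero_le_one]
    intro i
    rw [Real.norm_eq_abs, abs_le]
    constructor <;> linarith [(q i).2.1, (q i).2.2]⟩
  left_inv y := by
    ext i
    change 2 * ((1 + y.1 i) / 2) - 1 = y.1 i
    ring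
  right_inv q := by
    ext i
    change (1 + (2 * (q i : ℝ) - 1)) / 2 = q i
    ring
  continuous_toFun := continuous_pi fun i ↦ Continuous.subtype_mk ((continuous_const.add
    ((continuous_apply i).comp continuous_subtype_val)).div_const 2) _
  continuous_invFun := by fun_prop

theorem closedBallHomeomorphCube_mem_boundary {n : ℕ} (y : Metric.closedBall (0 : Fin n → ℝ) 1) :
    closedBallHomeomorphCube n y ∈ Cube.boundary (Fin n) ↔ ‖y.1‖ = 1 := by
  have h : ‖y.1‖ ≤ 1 := mem_closedBall_zero_iff.1 y.2
  have key : ∀ i, 2 * (closedBallHomeomorphCube n y i : ℝ) - 1 = y.1 i := fun i ↦ by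
    change 2 * ((1 + y.1 i) / 2) - 1 = y.1 i
    ring
  simp only [mem_cubeBoundary_iff, key]
  constructor
  · rintro ⟨i, hi⟩
    exact le_antisymm h (hi.symm.le.trans (norm_le_pi_norm y.1 i))
  · intro hy
    by_contra! hc
    refine hy.not_lt ((pi_norm_lt_iff one_pos).2 fun i ↦ ?_)
    exact lt_of_le_of_ne ((norm_le_pi_norm y.1 i).trans h) (hc i)

theorem exists_stdSimplex_homeomorph_cube (n : ℕ) :
    ∃ e : (Fin n → I) ≃ₜ stdSimplex ℝ (Fin (n + 1)),
      ∀ x, e x ∈ Set.ofPred (fun t : stdSimplex ℝ (Fin (n + 1)) ↦ ∃ j, t j = 0) ↔ x ∈ Cube.boundary (Fin n) := by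
  obtain ⟨e, he⟩ := exists_stdSimplex_homeomorph_closedBall n
  refine ⟨(e.trans (closedBallHomeomorphCube n)).symm, fun x ↦ ?_⟩
  obtain ⟨t, rfl⟩ := (e.trans (closedBallHomeomorphCube n)).surjective x
  rw [Homeomorph.symm_apply_apply]
  change (∃ j, t j = 0) ↔ closedBallHomeomorphCube n (e t) ∈ _
  rw [closedBallHomeomorphCube_mem_boundary, he]

end SimplexBall

/-- The inclusion `|∂Δ[n]| → Δⁿ`. -/
noncomputable def boundaryCoordinates (n : ℕ) :
    VertexEmbedding (∂Δ[n] : SSet.{u}) (Fin (n + 1)) :=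
  (VertexEmbedding.ofStdSimplex n).comap (SSet.boundary n).ι

theorem range_boundaryCoordinates (n : ℕ) :
    Set.range (boundaryCoordinates.{u} n).coordinates = {t | ∃ j, t j = 0} := by
  rw [VertexEmbedding.range_coordinates]
  ext t
  constructor
  · rintro ⟨m, x, hx⟩
    have h := x.2
    change ¬ Function.Surjective (SSet.stdSimplex.asOrderHom x.1) at h
    by_contra hc
    exact h fun j ↦ hx j fun hj ↦ hc ⟨j, hj⟩
  · rintro ⟨j, hj⟩
    rcases n with _ | n
    · have := stdSimplex.sum_eq_one t
      rw [Fin.sum_univ_one] at this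
      rw [Fin.fin_one_eq_zero j, this] at hj
      exact absurd hj one_ne_zero
    refine ⟨n, ⟨stdSimplexMk (SimplexCategory.δ j), fun h ↦ ?_⟩, fun i hi ↦ ?_⟩
    · obtain ⟨i, hi⟩ := h j
      exact Fin.succAbove_ne j i hi
    · obtain ⟨k, hk⟩ := Fin.exists_succAbove_eq (x := i) (y := j) (by rintro rfl; exact hi hj)
      exact ⟨k, hk⟩

end

/-! ### Attaching cells, and extension of maps over them. -/

section

open scoped unitInterval

/-- `L'` is obtained from `L` by attaching `d`-cells along their boundaries. -/
structure CellAttachment (d : ℕ) {L L' : SSet.{u}} (j : L ⟶ L') where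
  /-- The index type of the cells. -/
  Cell : Type u
  /-- The attaching maps. -/
  att : Cell → ((∂Δ[d] : SSet.{u}) ⟶ L)
  /-- The characteristic maps. -/
  char : Cell → (Δ[d] ⟶ L')
  comm : ∀ k, (SSet.boundary d).ι ≫ char k = att k ≫ j
  glue : ∀ {Z : SSet.{u}} (g : L ⟶ Z) (w : Cell → (Δ[d] ⟶ Z)),
    (∀ k, (SSet.boundary d).ι ≫ w k = att k ≫ g) → ∃ h : L' ⟶ Z, j ≫ h = g ∧ ∀ k, char k ≫ h = w k
  surjective : ∀ (n : ℕ) (x : L' _⦋n⦌), (∃ y, j.app _ y = x) ∨ ∃ k y, (char k).app _ y = x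

theorem stdSimplex_hom_app {L : SSet.{u}} {d n : ℕ} (f : Δ[d] ⟶ L) (x : (Δ[d] : SSet.{u}) _⦋n⦌) :
    f.app _ x = L.map (SSet.stdSimplex.objEquiv x).op (SSet.yonedaEquiv f) := by
  obtain ⟨y, rfl⟩ := SSet.yonedaEquiv.symm.surjective f
  rw [Equiv.apply_symm_apply]
  rfl

theorem realizationDesc_injective {S : SSet.{u}} {E : TopCat.{u}} :
    Function.Injective (realizationDesc : (S ⟶ TopCat.toSSet.obj E) → C(|S|, E)) := by
  intro f g h
  apply (sSetTopAdj.homEquiv S E).symm.injective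
  exact TopCat.hom_ext h

namespace CellAttachment

variable {d : ℕ} {L L' : SSet.{u}} {j : L ⟶ L'} (c : CellAttachment d j)

/-- The characteristic map of a cell. -/
noncomputable def cell (k : c.Cell) : C(stdSimplex ℝ (Fin (d + 1)), |L'|) :=
  cellMap (SSet.yonedaEquiv (c.char k))

theorem cell_map (k : c.Cell) {n : ℕ} (x : (Δ[d] : SSet.{u}) _⦋n⦌) (s) :
    c.cell k (stdSimplex.map (SSet.stdSimplex.asOrderHom x) s) =
      cellMap ((c.char k).app _ x) s := by
  rw [stdSimplex_hom_app, cellMap_map]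
  rfl

theorem cell_coordinates (k : c.Cell) (z : |(∂Δ[d] : SSet.{u})|) :
    c.cell k ((boundaryCoordinates d).coordinates z) =
      (SSet.toTop.map j).hom ((SSet.toTop.map (c.att k)).hom z) := by
  obtain ⟨n, x, s, rfl⟩ := exists_cellMap_eq z
  have h : (c.char k).app (op ⦋n⦌) x.1 = j.app _ ((c.att k).app _ x) :=
    ConcreteCategory.congr_hom (NatTrans.congr_app (c.comm k) (op ⦋n⦌)) x
  have h' : (boundaryCoordinates d).coordinates (cellMap x s) =
      stdSimplex.map (SSet.stdSimplex.asOrderHom x.1) s :=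
    VertexEmbedding.coordinates_cellMap _ x s
  rw [toTop_map_cellMap, toTop_map_cellMap, h', c.cell_map, h]

/-- Maps from `|L'|` to `E` are simplicial maps from `L'` to `Sing E`, to which `glue` applies; the
hypothesis is its compatibility condition in adjoint form. -/
theorem exists_extension {E : Type u} [TopologicalSpace E] (g : C(|L|, E))
    (w : c.Cell → C(stdSimplex ℝ (Fin (d + 1)), E))
    (h : ∀ k z, w k ((boundaryCoordinates d).coordinates z) =
      g ((SSet.toTop.map (c.att k)).hom z)) :
    ∃ f : C(|L'|, E), (∀ p, f ((SSet.toTop.map j).hom p) = g p) ∧ ∀ k t, f (c.cell k t) = w k t := by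
  let Z : TopCat.{u} := TopCat.of E
  let g' : L ⟶ TopCat.toSSet.obj Z := sSetTopAdj.unit.app L ≫ TopCat.toSSet.map (TopCat.ofHom g)
  have hg' : realizationDesc g' = g := realization_unit (TopCat.ofHom g : |L| ⟶ Z)
  let w' : c.Cell → (Δ[d] ⟶ TopCat.toSSet.obj Z) := fun k ↦
    SSet.yonedaEquiv.symm ((TopCat.toSSetObjEquiv Z (op ⦋d⦌)).symm (w k))
  obtain ⟨f', h1, h2⟩ := c.glue g' w' fun k ↦ by
    apply realizationDesc_injective
    apply realization_hom_ext
    intro n x t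
    have e1 : realizationDesc (c.att k ≫ g') (cellMap x t) =
        g ((SSet.toTop.map (c.att k)).hom (cellMap x t)) := by
      rw [← hg', toTop_map_cellMap, realizationDesc_cellMap, realizationDesc_cellMap]
      rfl
    rw [e1, ← h, realizationDesc_cellMap, VertexEmbedding.coordinates_cellMap]
    rfl
  refine ⟨realizationDesc f', fun p ↦ ?_, fun k t ↦ ?_⟩
  · obtain ⟨n, x, t, rfl⟩ := exists_cellMap_eq p
    rw [toTop_map_cellMap, ← hg', realizationDesc_cellMap, realizationDesc_cellMap, ← h1]
    rfl
  · refine (realizationDesc_cellMap f' (SSet.yonedaEquiv (c.char k)) t).trans ?_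
    have h3 : f'.app _ (SSet.yonedaEquiv (c.char k)) = SSet.yonedaEquiv (w' k) := by
      rw [← h2 k]
      rfl
    refine (congrArg (fun y ↦ TopCat.toSSetObjEquiv _ _ y t) h3).trans ?_
    rw [Equiv.apply_symm_apply]
    rfl

theorem exists_eq (p : |L'|) : (∃ q, (SSet.toTop.map j).hom q = p) ∨ ∃ k t, c.cell k t = p := by
  obtain ⟨n, x, s, rfl⟩ := exists_cellMap_eq p
  rcases c.surjective n x with ⟨y, rfl⟩ | ⟨k, y, rfl⟩
  · exact Or.inl ⟨cellMap y s, toTop_map_cellMap _ _ _⟩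
  · exact Or.inr ⟨k, _, c.cell_map k y s⟩

theorem exists_extension_of_extends (c : CellAttachment d j) {E : Type u} [TopologicalSpace E]
    (hE : ∀ g : C(|(∂Δ[d] : SSet.{u})|, E), ∃ w : C(stdSimplex ℝ (Fin (d + 1)), E),
      ∀ z, w ((boundaryCoordinates d).coordinates z) = g z) (g : C(|L|, E)) :
    ∃ f : C(|L'|, E), ∀ p, f ((SSet.toTop.map j).hom p) = g p := by
  choose w hw using hE
  obtain ⟨f, hf, -⟩ := c.exists_extension g
    (fun k ↦ w (g.comp (SSet.toTop.map (c.att k)).hom)) fun k z ↦ hw _ z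
  exact ⟨f, hf⟩

end CellAttachment

theorem exists_extension_indiscrete {X Y E : Type*} [TopologicalSpace X] [TopologicalSpace Y]
    {f : X → Y} (hf : Function.Injective f) [Nonempty E]
    (g : C(X, Indiscrete E)) :
    ∃ w : C(Y, Indiscrete E), ∀ x, w (f x) = g x := by
  have : Nonempty (Indiscrete E) := ‹_›
  exact ⟨⟨Function.extend f g fun _ ↦ Classical.arbitrary (Indiscrete E), continuous_top⟩,
    fun x ↦ Function.Injective.extend_apply hf g (fun _ ↦ Classical.arbitrary (Indiscrete E)) x⟩

/-- `Prop` is the Sierpiński space: a map to it is an open set, which for an induced topology is the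
trace of an open set. -/
theorem exists_extension_prop {X Y : Type*} [TopologicalSpace X] [TopologicalSpace Y]
    {f : X → Y} (hf : IsInducing f) (g : C(X, ULift.{u} Prop)) :
    ∃ w : C(Y, ULift.{u} Prop), ∀ x, w (f x) = g x := by
  have h : IsOpen (Set.ofPred fun x ↦ (g x).down) :=
    isOpen_iff_continuous_mem.2 (continuous_uliftDown.comp g.continuous)
  obtain ⟨V, hV, hVU⟩ := hf.isOpen_iff.1 h
  refine ⟨⟨fun y ↦ ULift.up (y ∈ V), continuous_uliftUp.comp (isOpen_iff_continuous_mem.1 hV)⟩,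
    fun x ↦ ?_⟩
  apply ULift.ext
  have : (x ∈ f ⁻¹' V) = (x ∈ Set.ofPred fun x ↦ (g x).down) := by rw [hVU]
  exact this

/-- This is Tietze's theorem, lifted to the universe in which realizations live. -/
theorem exists_extension_real {X Y : Type*} [TopologicalSpace X] [TopologicalSpace Y] [NormalSpace Y]
    {f : X → Y} (hf : IsClosedEmbedding f) (g : C(X, ULift.{u} ℝ)) :
    ∃ w : C(Y, ULift.{u} ℝ), ∀ x, w (f x) = g x := by
  obtain ⟨w, hw⟩ := ContinuousMap.exists_extension hf
    (⟨fun x ↦ (g x).down, continuous_uliftDown.comp g.continuous⟩ : C(X, ℝ))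
  refine ⟨⟨fun y ↦ ULift.up (w y), continuous_uliftUp.comp w.continuous⟩, fun x ↦ ?_⟩
  apply ULift.ext
  exact DFunLike.congr_fun hw x

/-- Extending functions to an indiscrete space separates points, and extending maps to the
Sierpiński space exhibits each open set of `X` as a preimage. Embeddings are thus detected by
extension problems, which can be solved cell by cell. -/
theorem isEmbedding_of_extensions {X Y : Type*} [TopologicalSpace X] [TopologicalSpace Y]
    {f : X → Y} (hf : Continuous f)
    (h1 : ∀ g : C(X, Indiscrete (ULift.{u} Prop)), ∃ w : C(Y, Indiscrete (ULift.{u} Prop)),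
      ∀ x, w (f x) = g x)
    (h2 : ∀ g : C(X, ULift.{u} Prop), ∃ w : C(Y, ULift.{u} Prop), ∀ x, w (f x) = g x) :
    IsEmbedding f := by
  refine ⟨⟨le_antisymm hf.le_induced fun U hU ↦ ?_⟩, fun x y hxy ↦ ?_⟩
  · obtain ⟨w, hw⟩ := h2 ⟨fun x ↦ ULift.up (x ∈ U),
      continuous_uliftUp.comp (isOpen_iff_continuous_mem.1 hU)⟩
    refine isOpen_induced_iff.2 ⟨Set.ofPred fun y ↦ (w y).down,
      isOpen_iff_continuous_mem.2 (continuous_uliftDown.comp w.continuous), ?_⟩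
    ext x
    change (w (f x)).down ↔ x ∈ U
    rw [hw]
    rfl
  · obtain ⟨w, hw⟩ := h1 ⟨fun z ↦ ULift.up (z = x), continuous_top⟩
    have h3 := (hw y).symm.trans ((congrArg w hxy).symm.trans (hw x))
    have h4 : (y = x) = (x = x) := congrArg ULift.down h3
    exact (h4.mpr rfl).symm

namespace CellAttachment

variable {d : ℕ} {L L' : SSet.{u}} {j : L ⟶ L'} (c : CellAttachment d j)

theorem isEmbedding (c : CellAttachment d j) : IsEmbedding (SSet.toTop.map j).hom :=
  isEmbedding_of_extensions (SSet.toTop.map j).hom.continuous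
    (c.exists_extension_of_extends (exists_extension_indiscrete (boundaryCoordinates d).coordinates_injective))
    (c.exists_extension_of_extends (exists_extension_prop
      (boundaryCoordinates d).isClosedEmbedding_coordinates.isInducing))

end CellAttachment

/-- The closed unit ball. -/
abbrev UnitBall (d : ℕ) : Type := Metric.closedBall (0 : Fin d → ℝ) 1

/-- The identification of the simplex with the ball. -/
noncomputable def simplexBall (d : ℕ) : stdSimplex ℝ (Fin (d + 1)) ≃ₜ UnitBall d :=
  (exists_stdSimplex_homeomorph_closedBall d).choose

theorem norm_simplexBall_eq_one_iff {d : ℕ} {t : stdSimplex ℝ (Fin (d + 1))} :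
    ‖(simplexBall d t : Fin d → ℝ)‖ = 1 ↔ ∃ z, (boundaryCoordinates.{u} d).coordinates z = t := by
  rw [simplexBall, (exists_stdSimplex_homeomorph_closedBall d).choose_spec]
  exact (Set.ext_iff.1 (range_boundaryCoordinates.{u} d) t).symm

namespace CellAttachment

variable {d : ℕ} {L L' : SSet.{u}} {j : L ⟶ L'} (c : CellAttachment d j)

/-- The characteristic map of a cell, with the ball as its domain. -/
noncomputable def disc (k : c.Cell) : C(UnitBall d, |L'|) :=
  (c.cell k).comp ((simplexBall d).symm : C(_, _))

theorem disc_simplexBall (k : c.Cell) (t) : c.disc k (simplexBall d t) = c.cell k t :=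
  congrArg (c.cell k) ((simplexBall d).symm_apply_apply t)

theorem disc_mem_range (k : c.Cell) (x : UnitBall d) (hx : ‖(x : Fin d → ℝ)‖ = 1) :
    ∃ q, (SSet.toTop.map j).hom q = c.disc k x := by
  obtain ⟨t, rfl⟩ := (simplexBall d).surjective x
  obtain ⟨z, rfl⟩ := norm_simplexBall_eq_one_iff.{u}.1 hx
  exact ⟨_, (c.cell_coordinates k z).symm.trans (c.disc_simplexBall k _).symm⟩

theorem exists_eq_disc (p : |L'|) :
    (∃ q, (SSet.toTop.map j).hom q = p) ∨ ∃ k x, c.disc k x = p := by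
  rcases c.exists_eq p with h | ⟨k, t, h⟩
  · exact Or.inl h
  · exact Or.inr ⟨k, _, (c.disc_simplexBall k t).trans h⟩

theorem exists_extension_disc {E : Type u} [TopologicalSpace E] (g : C(|L|, E))
    (w : c.Cell → C(UnitBall d, E))
    (h : ∀ k z, w k (simplexBall d ((boundaryCoordinates d).coordinates z)) =
      g ((SSet.toTop.map (c.att k)).hom z)) :
    ∃ f : C(|L'|, E), (∀ p, f ((SSet.toTop.map j).hom p) = g p) ∧ ∀ k x, f (c.disc k x) = w k x := by
  obtain ⟨f, h1, h2⟩ := c.exists_extension g (fun k ↦ (w k).comp ⟨simplexBall d, (simplexBall d).continuous⟩) h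
  refine ⟨f, h1, fun k x ↦ ?_⟩
  obtain ⟨t, rfl⟩ := (simplexBall d).surjective x
  rw [disc_simplexBall, h2]
  rfl

theorem norm_coordinates (z : |(∂Δ[d] : SSet.{u})|) :
    ‖(simplexBall d ((boundaryCoordinates d).coordinates z) : Fin d → ℝ)‖ = 1 :=
  norm_simplexBall_eq_one_iff.2 ⟨z, rfl⟩

/-- A function on the ball which is constant on the boundary gives a function. -/
theorem exists_function {F : Type} [TopologicalSpace F] (φ : C(UnitBall d, F)) (a : F)
    (h : ∀ x : UnitBall d, ‖(x : Fin d → ℝ)‖ = 1 → φ x = a) :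
    ∃ f : C(|L'|, F), (∀ p, f ((SSet.toTop.map j).hom p) = a) ∧ ∀ k x, f (c.disc k x) = φ x := by
  obtain ⟨f, h1, h2⟩ := c.exists_extension_disc (E := ULift.{u} F) (ContinuousMap.const _ ⟨a⟩)
    (fun _ ↦ ⟨fun x ↦ ULift.up (φ x), continuous_uliftUp.comp φ.continuous⟩)
    fun k z ↦ congrArg ULift.up (h _ (norm_coordinates z))
  exact ⟨⟨fun p ↦ (f p).down, continuous_uliftDown.comp f.continuous⟩,
    fun p ↦ congrArg ULift.down (h1 p), fun k x ↦ congrArg ULift.down (h2 k x)⟩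

/-- A deformation of the ball relative to the boundary extends to all cells. -/
theorem exists_deformation {K : Type} [TopologicalSpace K] [LocallyCompactSpace K]
    (Φ : C(K × UnitBall d, UnitBall d))
    (h : ∀ q (x : UnitBall d), ‖(x : Fin d → ℝ)‖ = 1 → Φ (q, x) = x) :
    ∃ M : C(K × |L'|, |L'|), (∀ q p, M (q, (SSet.toTop.map j).hom p) = (SSet.toTop.map j).hom p) ∧
      ∀ q k x, M (q, c.disc k x) = c.disc k (Φ (q, x)) := by
  obtain ⟨f, h1, h2⟩ := c.exists_extension_disc (E := C(K, |L'|))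
    (ContinuousMap.curry ⟨fun p ↦ (SSet.toTop.map j).hom p.1, by fun_prop⟩)
    (fun k ↦ ContinuousMap.curry ⟨fun p ↦ c.disc k (Φ (p.2, p.1)), by fun_prop⟩) fun k z ↦ by
      ext q
      change c.disc k (Φ (q, _)) = (SSet.toTop.map j).hom _
      rw [h q _ (norm_coordinates z), disc_simplexBall, cell_coordinates]
  refine ⟨(ContinuousMap.uncurry f).comp ⟨Prod.swap, continuous_swap⟩, fun q p ↦ ?_,
    fun q k x ↦ ?_⟩
  · exact DFunLike.congr_fun (h1 p) q
  · exact DFunLike.congr_fun (h2 k x) q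

end CellAttachment

end

section

open scoped unitInterval

/-! ### General position: cubes of dimension below that of the attached cells. -/

section BallMaps

variable {d : ℕ}

theorem UnitBall.norm_le (x : UnitBall d) : ‖(x : Fin d → ℝ)‖ ≤ 1 := mem_closedBall_zero_iff.1 x.2

/-- Translation of the points near the centre of the ball. -/
noncomputable def ballTranslation (d : ℕ) :
    C((I × Metric.closedBall (0 : Fin d → ℝ) (1 / 8)) × UnitBall d, UnitBall d) where
  -- The cutoff is `1` for `‖x‖ ≤ 1/4` and `0` for `‖x‖ ≥ 1/2`. Translation vectors have norm at
  -- most `1/8`, so the ball is preserved.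
  toFun p := ⟨p.2.1 + ((p.1.1 : ℝ) * max 0 (min 1 (2 - 4 * ‖p.2.1‖))) • p.1.2.1, by
    have hw := mem_closedBall_zero_iff.1 p.1.2.2
    have hx := p.2.norm_le
    have h0 := p.1.1.2.1
    have h1 := p.1.1.2.2
    rw [mem_closedBall_zero_iff]
    refine (norm_add_le _ _).trans ?_
    rw [norm_smul, Real.norm_eq_abs, abs_of_nonneg (by positivity)]
    rcases le_total ‖p.2.1‖ (1 / 2) with h | h
    · have : (p.1.1 : ℝ) * max 0 (min 1 (2 - 4 * ‖p.2.1‖)) ≤ 1 :=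
        mul_le_one₀ h1 (le_max_left _ _) (max_le zero_le_one (min_le_left _ _))
      nlinarith [norm_nonneg (p.1.2.1)]
    · rw [max_eq_left ((min_le_right _ _).trans (by linarith))]
      simpa using hx⟩
  continuous_toFun := by
    refine Continuous.subtype_mk ?_ _
    fun_prop

theorem ballTranslation_coe (p : (I × Metric.closedBall (0 : Fin d → ℝ) (1 / 8)) × UnitBall d) :
    (ballTranslation d p : Fin d → ℝ) =
      p.2.1 + ((p.1.1 : ℝ) * max 0 (min 1 (2 - 4 * ‖p.2.1‖))) • p.1.2.1 := rfl

/-- The radial deformation of the ball onto its boundary, outside a ball of radius `δ`. -/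
noncomputable def ballPush (d : ℕ) (δ : ℝ) (h0 : 0 < δ) (h1 : δ ≤ 1) :
    C(I × UnitBall d, UnitBall d) where
  -- At time `0` the maximum is `1` and the map is the identity; at time `1` it is `max ‖x‖ δ`, so
  -- points with `‖x‖ ≥ δ` reach the boundary.
  toFun p := ⟨(max ‖p.2.1‖ (1 - p.1 * (1 - δ)))⁻¹ • p.2.1, by
    rw [mem_closedBall_zero_iff, norm_smul, norm_inv, Real.norm_eq_abs,
      abs_of_nonneg (le_max_of_le_left (norm_nonneg _)), inv_mul_eq_div]
    exact div_le_one_of_le₀ (le_max_left _ _) (le_max_of_le_left (norm_nonneg _))⟩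
  continuous_toFun := by
    have hc : Continuous fun p : I × UnitBall d ↦ max ‖p.2.1‖ (1 - (p.1 : ℝ) * (1 - δ)) := by
      fun_prop
    refine Continuous.subtype_mk (Continuous.smul (hc.inv₀ fun p ↦ ?_)
      (continuous_subtype_val.comp continuous_snd)) _
    refine (lt_max_of_lt_right ?_).ne'
    nlinarith [p.1.2.1, p.1.2.2, mul_nonneg p.1.2.1 h0.le,
      mul_le_mul_of_nonneg_right p.1.2.2 (sub_nonneg.2 h1)]

theorem ballPush_coe (δ : ℝ) (h0 : 0 < δ) (h1 : δ ≤ 1) (p : I × UnitBall d) :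
    (ballPush d δ h0 h1 p : Fin d → ℝ) = (max ‖p.2.1‖ (1 - p.1 * (1 - δ)))⁻¹ • p.2.1 := rfl

/-- A `C¹` map from dimension `n` to dimension `d > n` misses values arbitrarily close to `0`.
Approximate `f` within `1/16` by such a map `g` and subtract a missed value `v` of norm below
`1/16`. -/
theorem exists_approximation {n : ℕ} (h : n < d) (f : C(Fin n → I, Fin d → ℝ)) :
    ∃ w : C(Fin n → I, Metric.closedBall (0 : Fin d → ℝ) (1 / 8)), ∀ t, f t + w t ≠ 0 := by
  let F : (Fin n → ℝ) → Fin d → ℝ := fun y ↦ f fun i ↦ Set.projIcc 0 1 zero_le_one (y i)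
  have hF : Continuous F := f.continuous.comp (continuous_pi fun i ↦
    continuous_projIcc.comp (continuous_apply i))
  obtain ⟨g, hg, hgF, -⟩ := hF.exists_contDiff_approx 1 (ε := fun _ ↦ 1 / 16) continuous_const
    fun _ ↦ by norm_num
  obtain ⟨v, hv, hv'⟩ := Metric.dense_iff.1
    (hg.dense_compl_range_of_finrank_lt_finrank (by simpa using h)) 0 (1 / 16) (by norm_num)
  rw [mem_ball_zero_iff] at hv
  have hft : ∀ t : Fin n → I, F (fun i ↦ t i) = f t := fun t ↦ by simp [F]
  refine ⟨⟨fun t ↦ ⟨g (fun i ↦ t i) - v - f t, ?_⟩, ?_⟩, fun t ht ↦ hv' ⟨fun i ↦ t i, ?_⟩⟩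
  · rw [mem_closedBall_zero_iff]
    have := hgF fun i ↦ t i
    rw [dist_eq_norm, hft] at this
    calc ‖g (fun i ↦ (t i : ℝ)) - v - f t‖ = ‖(g (fun i ↦ (t i : ℝ)) - f t) - v‖ := by
          congr 1; abel
      _ ≤ _ := norm_sub_le _ _
      _ ≤ 1 / 8 := by linarith
  · refine Continuous.subtype_mk ?_ _
    have := hg.continuous
    fun_prop
  · have h2 : f t + (g (fun i ↦ t i) - v - f t) = 0 := ht
    have h3 : f t + (g (fun i ↦ t i) - v - f t) = g (fun i ↦ t i) - v := by abel
    rw [h3, sub_eq_zero] at h2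
    exact h2

end BallMaps

namespace CellAttachment

variable {d : ℕ} {L L' : SSet.{u}} {j : L ⟶ L'}

/-- By compactness of the cube, `b` keeps a distance `δ` from the centres, uniformly in the cells.
The radial push then carries it into the image of `|L|`, and the embedding property makes the lift
continuous. -/
theorem exists_lift_of_norm_ne_zero (c : CellAttachment d j) {n : ℕ} (S : Set (Fin n → I))
    (b : C(Fin n → I, |L'|)) (hS : ∀ x ∈ S, ∃ q, (SSet.toTop.map j).hom q = b x)
    (hb : ∀ t k x, b t = c.disc k x → (x : Fin d → ℝ) ≠ 0) :
    ∃ a : C(Fin n → I, |L|), ((SSet.toTop.map j).hom.comp a).HomotopicRel b S := by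
  obtain ⟨ν, hν, hν'⟩ := c.exists_function (⟨fun x ↦ ‖x.1‖, by fun_prop⟩ : C(UnitBall d, ℝ)) 1
    fun x hx ↦ hx
  have hpos : ∀ t, 0 < ν (b t) ∧ ν (b t) ≤ 1 := fun t ↦ by
    rcases c.exists_eq_disc (b t) with ⟨q, hq⟩ | ⟨k, x, hx⟩
    · rw [← hq, hν]
      exact ⟨one_pos, le_rfl⟩
    · rw [← hx, hν']
      exact ⟨norm_pos_iff.2 (hb t k x hx.symm), x.norm_le⟩
  obtain ⟨δ₀, hδ₀, hδ₀'⟩ := (isCompact_univ (X := Fin n → I)).exists_forall_le'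
    (ν.comp b).continuous.continuousOn (a := 0) fun t _ ↦ (hpos t).1
  let δ := min 1 δ₀
  have hδ : 0 < δ := lt_min one_pos hδ₀
  have hδ1 : δ ≤ 1 := min_le_left _ _
  obtain ⟨M, hM, hM'⟩ := c.exists_deformation (ballPush d δ hδ hδ1) fun q x hx ↦ by
    ext1
    have h1 : 1 - (q : ℝ) * (1 - δ) ≤ 1 := by nlinarith [q.2.1, mul_nonneg q.2.1 (sub_nonneg.2 hδ1)]
    rw [ballPush_coe]
    simp [hx, max_eq_left h1]
  have hM0 : ∀ p, M (0, p) = p := fun p ↦ by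
    rcases c.exists_eq_disc p with ⟨q, rfl⟩ | ⟨k, x, rfl⟩
    · exact hM 0 q
    · rw [hM']
      congr 1
      ext1
      rw [ballPush_coe]
      simp [max_eq_right x.norm_le]
  have hM1 : ∀ t, ∃ q, (SSet.toTop.map j).hom q = M (1, b t) := fun t ↦ by
    rcases c.exists_eq_disc (b t) with ⟨q, hq⟩ | ⟨k, x, hx⟩
    · rw [← hq, hM]
      exact ⟨q, rfl⟩
    · have h1 : δ ≤ ‖x.1‖ := by
        have := (min_le_right 1 δ₀).trans (hδ₀' t (Set.mem_univ t))
        change δ ≤ ν (b t) at this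
        rwa [← hx, hν'] at this
      rw [← hx, hM']
      refine c.disc_mem_range k _ ?_
      rw [ballPush_coe]
      have h2 : max ‖x.1‖ (1 - ((1 : I) : ℝ) * (1 - δ)) = ‖x.1‖ := by simp [h1]
      change ‖(max ‖x.1‖ (1 - ((1 : I) : ℝ) * (1 - δ)))⁻¹ • x.1‖ = 1
      rw [h2, norm_smul, norm_inv, norm_norm, inv_mul_cancel₀ (hδ.trans_le h1).ne']
  choose a ha using hM1
  refine ⟨⟨a, c.isEmbedding.continuous_iff.2 ?_⟩, ?_⟩
  · have : ((SSet.toTop.map j).hom ∘ a) = fun t ↦ M (1, b t) := funext ha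
    rw [this]
    fun_prop
  · refine ContinuousMap.HomotopicRel.symm ⟨⟨⟨⟨fun p ↦ M (p.1, b p.2), by fun_prop⟩, fun x ↦ hM0 _,
      fun x ↦ (ha x).symm⟩, fun s x hx ↦ ?_⟩⟩
    obtain ⟨q, hq⟩ := hS x hx
    change M (s, b x) = b x
    rw [← hq, hM]

/-- One perturbation moves `b` off the centres of all cells simultaneously, because `κ` records the
position near the centre of every cell in a common `ℝᵈ`; then the radial push applies. -/
theorem liftsRel (c : CellAttachment d j) {n : ℕ} (h : n < d) (S : Set (Fin n → I)) :
    LiftsRel (Fin n → I) S (SSet.toTop.map j).hom := by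
  intro a b hab
  obtain ⟨κ, hκ, hκ'⟩ := c.exists_function
    -- The function is the identity for `‖x‖ ≤ 1/2` and vanishes on the boundary, so it extends by
    -- `0` over `|L|`.
    (⟨fun x ↦ min 1 (2 * (1 - ‖x.1‖)) • x.1, by fun_prop⟩ : C(UnitBall d, Fin d → ℝ)) 0
    fun x hx ↦ by simp [hx]
  obtain ⟨w, hw⟩ := exists_approximation h (κ.comp b)
  obtain ⟨M, hM, hM'⟩ := c.exists_deformation (ballTranslation d) fun q x hx ↦ by
    ext1
    rw [ballTranslation_coe]
    simp [hx]
    norm_num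
  have hM0 : ∀ v p, M ((0, v), p) = p := fun v p ↦ by
    rcases c.exists_eq_disc p with ⟨q, rfl⟩ | ⟨k, x, rfl⟩
    · exact hM _ q
    · rw [hM']
      congr 1
      ext1
      rw [ballTranslation_coe]
      simp
  let b' : C(Fin n → I, |L'|) := ⟨fun t ↦ M ((1, w t), b t), by fun_prop⟩
  have hbb' : ∀ x ∈ S, ∀ s, M ((s, w x), b x) = b x := fun x hx s ↦ by
    rw [← hab ⟨x, hx⟩, hM]
  obtain ⟨ν, hν, hν'⟩ := c.exists_function (⟨fun x ↦ ‖x.1‖, by fun_prop⟩ : C(UnitBall d, ℝ)) 1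
    fun x hx ↦ hx
  have hne : ∀ t k x, b' t = c.disc k x → (x : Fin d → ℝ) ≠ 0 := by
    intro t k x hx h0
    have h1 : ν (b' t) = 0 := by rw [hx, hν']; simp [h0]
    change ν (M ((1, w t), b t)) = 0 at h1
    rcases c.exists_eq_disc (b t) with ⟨q, hq⟩ | ⟨k, y, hy⟩
    · rw [← hq, hM, hν] at h1
      exact one_ne_zero h1
    · have h2 := hw t
      change κ (b t) + w t ≠ 0 at h2
      rw [← hy, hκ'] at h2
      rw [← hy, hM', hν'] at h1
      have h3 : (ballTranslation d ((1, w t), y) : Fin d → ℝ) = 0 := norm_eq_zero.1 h1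
      rw [ballTranslation_coe] at h3
      simp only [ContinuousMap.coe_mk, Set.Icc.coe_one, one_mul] at h2 h3
      have hwt := mem_closedBall_zero_iff.1 (w t).2
      -- For `‖y‖ ≤ 1/4` the translation is by all of `w` and `κ` is the identity, so the choice of
      -- `w` avoids the centre. For `‖y‖ ≥ 1/4` a translation by at most `1/8` cannot reach it.
      rcases le_total ‖y.1‖ (1 / 4) with h | h
      · rw [min_eq_left (by linarith), max_eq_right zero_le_one, one_smul] at h3
        rw [min_eq_left (by linarith), one_smul] at h2
        exact h2 h3
      · have h4 : ‖y.1‖ ≤ ‖(w t).1‖ := by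
          rw [eq_neg_of_add_eq_zero_left h3, norm_neg, norm_smul, Real.norm_eq_abs,
            abs_of_nonneg (le_max_left _ _)]
          exact mul_le_of_le_one_left (norm_nonneg _) (max_le zero_le_one (min_le_left _ _))
        linarith
  obtain ⟨a', ha'⟩ := c.exists_lift_of_norm_ne_zero S b'
    (fun x hx ↦ ⟨a ⟨x, hx⟩, (hab ⟨x, hx⟩).trans (hbb' x hx 1).symm⟩) hne
  · refine ⟨a', fun x ↦ c.isEmbedding.injective ?_, ha'.trans ?_⟩
    · obtain ⟨H⟩ := ha'
      have h1 := H.eq_fst 1 x.2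
      have h2 : H (1, x.1) = b' x := H.apply_one x.1
      exact (h1.symm.trans (h2.trans (hbb' x x.2 1))).trans (hab x).symm
    · exact ContinuousMap.HomotopicRel.symm ⟨⟨⟨⟨fun p ↦ M ((p.1, w p.2), b p.2), by fun_prop⟩,
        fun x ↦ hM0 _ _, fun x ↦ rfl⟩, fun s x hx ↦ hbb' x hx s⟩⟩


end CellAttachment

end

/-! ### Relative skeleta, compactness and cellular approximation. -/

section

open scoped unitInterval

open SSet.relativeCellComplexOfMono in
/-- The relative skeleta of a monomorphism are obtained by attaching cells. -/
noncomputable def skeletonAttachment {X Y : SSet.{u}} (i : X ⟶ Y) (d : ℕ) :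
    CellAttachment d (r i d) where
  Cell := Cell i d
  att k := k.ιSigmaBoundary ≫ t i d
  char k := k.ιSigmaStdSimplex ≫ b i d
  comm k := by
    rw [Category.assoc, w, ← Category.assoc, ← Category.assoc, Cell.ι_l]
  glue {Z} g v h := by
    obtain ⟨f, h1, h2⟩ := (isPushout i d).exists_desc g (Limits.Sigma.desc v) (by
      apply Limits.Sigma.hom_ext
      intro k
      rw [← Category.assoc, ← h k, ← Category.assoc, Cell.ι_l, Category.assoc]
      simp)
    refine ⟨f, h1, fun k ↦ ?_⟩
    rw [Category.assoc, h2]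
    simp
  surjective n x := by
    have h : x ∈ Set.range ((r i d).app _) ∪ Set.range ((b i d).app _) := by
      rw [range_r_app_union_range_b_app]
      exact Set.mem_univ x
    rcases h with ⟨y, hy⟩ | ⟨y, hy⟩
    · exact Or.inl ⟨y, hy⟩
    · obtain ⟨k, z, rfl⟩ := ιSigmaStdSimplex_jointly_surjective y
      exact Or.inr ⟨k, z, hy⟩

section

variable {X Y : SSet.{u}} (i : X ⟶ Y)

/-- The inclusions of the relative skeleta. -/
noncomputable def skeletonInclusion (d : ℕ) :
    C(|(SSet.skeletonOfMono i d : SSet.{u})|, |Y|) :=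
  (SSet.toTop.map (SSet.skeletonOfMono i d).ι).hom

/-- The inclusion of a relative skeleton into the next one. -/
noncomputable def skeletonStep (d : ℕ) :
    C(|(SSet.skeletonOfMono i d : SSet.{u})|, |(SSet.skeletonOfMono i (d + 1) : SSet.{u})|) :=
  (SSet.toTop.map (SSet.relativeCellComplexOfMono.r i d)).hom

theorem toTop_map_comp_apply {A B C : SSet.{u}} (f : A ⟶ B) (g : B ⟶ C) (p : |A|) :
    (SSet.toTop.map (f ≫ g)).hom p = (SSet.toTop.map g).hom ((SSet.toTop.map f).hom p) := by
  rw [SSet.toTop.map_comp]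
  rfl

theorem toTop_map_id_apply {A : SSet.{u}} (p : |A|) : (SSet.toTop.map (𝟙 A)).hom p = p := by
  rw [SSet.toTop.map_id]
  rfl

theorem skeletonInclusion_step (d : ℕ) (p) :
    skeletonInclusion i (d + 1) (skeletonStep i d p) = skeletonInclusion i d p :=
  (toTop_map_comp_apply (SSet.relativeCellComplexOfMono.r i d)
    (SSet.skeletonOfMono i (d + 1)).ι p).symm

/-- A compatible family of maps on the skeleta extends. -/
theorem exists_of_skeleta {E : Type u} [TopologicalSpace E]
    (h : ∀ d, C(|(SSet.skeletonOfMono i d : SSet.{u})|, E))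
    (hh : ∀ d p, h (d + 1) (skeletonStep i d p) = h d p) :
    ∃ f : C(|Y|, E), ∀ d p, f (skeletonInclusion i d p) = h d p := by
  have key : ∀ (n : ℕ) (x : Y _⦋n⦌) d e (hd : x ∈ (SSet.skeletonOfMono i d).obj _)
      (he : x ∈ (SSet.skeletonOfMono i e).obj _) t, d ≤ e →
      h d (cellMap (S := (SSet.skeletonOfMono i d : SSet.{u})) ⟨x, hd⟩ t) =
        h e (cellMap (S := (SSet.skeletonOfMono i e : SSet.{u})) ⟨x, he⟩ t) := by
    intro n x d e hd he t hde
    induction e, hde using Nat.le_induction with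
    | base => rfl
    | succ e hde ih =>
      have he' := (SSet.skeletonOfMono i).monotone hde _ hd
      refine ((ih he').trans (hh e _).symm).trans (congrArg (h (e + 1)) ?_)
      exact toTop_map_cellMap (SSet.relativeCellComplexOfMono.r i e) ⟨x, he'⟩ t
  have mem : ∀ (n : SimplexCategoryᵒᵖ) (x : Y.obj n),
      x ∈ (SSet.skeletonOfMono i (n.unop.len + 1)).obj n := fun n x ↦ by
    have := SSet.skeletonOfMono_obj_eq_top i (Nat.lt_succ_self n.unop.len)
    exact this.symm ▸ Set.mem_univ x
  let F : Y ⟶ TopCat.toSSet.obj (TopCat.of E) := toSingular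
    (fun n x ↦ (h (n.unop.len + 1)).comp
      (cellMap (S := (SSet.skeletonOfMono i (n.unop.len + 1) : SSet.{u})) (n := n.unop.len)
        ⟨x, mem n x⟩)) (by
    intro n m f x t
    let e := max (n.unop.len + 1) (m.unop.len + 1)
    have hn : x ∈ (SSet.skeletonOfMono i e).obj n :=
      (SSet.skeletonOfMono i).monotone (le_max_left _ _) _ (mem n x)
    have hm : Y.map f x ∈ (SSet.skeletonOfMono i e).obj m :=
      (SSet.skeletonOfMono i e).map f hn
    refine (key _ _ _ _ (mem m _) hm t (le_max_right _ _)).trans ?_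
    refine Eq.trans ?_ (key _ _ _ _ (mem n _) hn _ (le_max_left _ _)).symm
    refine congrArg (h e) ?_
    exact cellMap_map (S := (SSet.skeletonOfMono i e : SSet.{u})) f.unop
      (n := n.unop.len) (m := m.unop.len) ⟨x, hn⟩ t)
  refine ⟨realizationDesc F, fun d p ↦ ?_⟩
  obtain ⟨n, x, t, rfl⟩ := exists_cellMap_eq p
  rw [skeletonInclusion, toTop_map_cellMap, realizationDesc_cellMap]
  change h (n + 1) (cellMap (S := (SSet.skeletonOfMono i (n + 1) : SSet.{u})) ⟨x.1, mem _ x.1⟩ t) = _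
  rcases le_total d (n + 1) with hd | hd
  · exact (key _ _ _ _ x.2 (mem _ _) t hd).symm
  · exact key _ _ _ _ (mem _ _) x.2 t hd

/-- Extension of maps from the source of a monomorphism, skeleton by skeleton. -/
theorem exists_extension_of_skeleta [Mono i] {E : Type u} [TopologicalSpace E]
    (P : ∀ d, C(|(SSet.skeletonOfMono i (d + 1) : SSet.{u})|, E) → Prop)
    (hP : ∀ d (g : C(|(SSet.skeletonOfMono i d : SSet.{u})|, E)),
      ∃ h, (∀ p, h (skeletonStep i d p) = g p) ∧ P d h) (g : C(|X|, E)) :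
    ∃ f : C(|Y|, E), (∀ p, f ((SSet.toTop.map i).hom p) = g p) ∧
      ∀ d, P d (f.comp (skeletonInclusion i (d + 1))) := by
  let k : X ≅ (SSet.skeletonOfMono i 0 : SSet.{u}) := asIso (SSet.Subcomplex.toRange i) ≪≫
    SSet.Subcomplex.eqToIso (SSet.skeletonOfMono_zero i).symm
  have hk : k.hom ≫ (SSet.skeletonOfMono i 0).ι = i := rfl
  let h : ∀ d, C(|(SSet.skeletonOfMono i d : SSet.{u})|, E) := fun d ↦
    Nat.rec (g.comp (SSet.toTop.map k.inv).hom) (fun d g ↦ (hP d g).choose) d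
  obtain ⟨f, hf⟩ := exists_of_skeleta i h fun d p ↦ (hP d (h d)).choose_spec.1 p
  refine ⟨f, fun p ↦ ?_, fun d ↦ ?_⟩
  · have h1 : skeletonInclusion i 0 ((SSet.toTop.map k.hom).hom p) = (SSet.toTop.map i).hom p := by
      rw [skeletonInclusion, ← toTop_map_comp_apply, hk]
    rw [← h1, hf]
    change g ((SSet.toTop.map k.inv).hom ((SSet.toTop.map k.hom).hom p)) = g p
    rw [← toTop_map_comp_apply, k.hom_inv_id, toTop_map_id_apply]
  · have h1 : f.comp (skeletonInclusion i (d + 1)) = h (d + 1) := by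
      ext p
      exact hf _ p
    rw [h1]
    exact (hP d (h d)).choose_spec.2

/-- Maps to the two test spaces extend from the boundary of a simplex to the simplex, hence over
each relative skeleton in turn. -/
theorem isEmbedding_toTop_map_of_mono [Mono i] : IsEmbedding (SSet.toTop.map i).hom := by
  refine isEmbedding_of_extensions (SSet.toTop.map i).hom.continuous (fun g ↦ ?_) fun g ↦ ?_
  · obtain ⟨f, hf, -⟩ := exists_extension_of_skeleta i (fun _ _ ↦ True) (fun d g ↦ by
      obtain ⟨h, hh⟩ := (skeletonAttachment i d).exists_extension_of_extends
        (exists_extension_indiscrete (boundaryCoordinates d).coordinates_injective) g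
      exact ⟨h, hh, trivial⟩) g
    exact ⟨f, hf⟩
  · obtain ⟨f, hf, -⟩ := exists_extension_of_skeleta i (fun _ _ ↦ True) (fun d g ↦ by
      obtain ⟨h, hh⟩ := (skeletonAttachment i d).exists_extension_of_extends
        (exists_extension_prop (boundaryCoordinates d).isClosedEmbedding_coordinates.isInducing) g
      exact ⟨h, hh, trivial⟩) g
    exact ⟨f, hf⟩

/-- Extend `g` over each cell by Tietze, then add a multiple of `1 - ‖x‖`, which vanishes on the
boundary and is positive at the interior point `p`. -/
theorem CellAttachment.exists_extension_large {d : ℕ} {L L' : SSet.{u}} {j : L ⟶ L'}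
    (c : CellAttachment d j) (g : C(|L|, ULift.{u} ℝ)) (p : |L'|)
    (hp : ¬ ∃ q, (SSet.toTop.map j).hom q = p) (a : ℝ) :
    ∃ f : C(|L'|, ULift.{u} ℝ), (∀ q, f ((SSet.toTop.map j).hom q) = g q) ∧ a ≤ (f p).down := by
  obtain ⟨k₀, x₀, rfl⟩ := (c.exists_eq_disc p).resolve_left hp
  have hx₀ : ‖x₀.1‖ < 1 := x₀.norm_le.lt_of_ne fun h ↦ hp (c.disc_mem_range k₀ x₀ h)
  have key : ∀ k, ∃ w : C(UnitBall d, ULift.{u} ℝ), ∀ z, w (simplexBall d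
      ((boundaryCoordinates d).coordinates z)) = g ((SSet.toTop.map (c.att k)).hom z) := fun k ↦
    exists_extension_real ((simplexBall d).isClosedEmbedding.comp
      (boundaryCoordinates d).isClosedEmbedding_coordinates)
      (g.comp (SSet.toTop.map (c.att k)).hom)
  choose w hw using key
  let b : ℝ := (a - (w k₀ x₀).down) / (1 - ‖x₀.1‖)
  obtain ⟨f, h1, h2⟩ := c.exists_extension_disc g
    (fun k ↦ ⟨fun x ↦ ULift.up ((w k x).down + b * (1 - ‖x.1‖)), continuous_uliftUp.comp
      ((continuous_uliftDown.comp (w k).continuous).add (by fun_prop))⟩) fun k z ↦ by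
      apply ULift.ext
      simp [norm_coordinates, hw]
  refine ⟨f, h1, ?_⟩
  rw [h2]
  have : b * (1 - ‖x₀.1‖) = a - (w k₀ x₀).down := div_mul_cancel₀ _ (by linarith)
  simp [this]

/-- A compact subset of the realization lies in a relative skeleton. -/
theorem exists_skeleton_of_compact [Mono i] {D : Type*} [TopologicalSpace D] [CompactSpace D]
    (b : C(D, |Y|)) : ∃ d, ∀ x, ∃ q, skeletonInclusion i d q = b x := by
  by_contra! hb
  -- `Q d` marks the points of the image of `b` that appear at stage `d + 1` but not at stage `d`.
  -- Were there such points for arbitrarily large `d`, a function that is at least `d` at one of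
  -- them would be unbounded on a compact set.
  let Q : ∀ d, |(SSet.skeletonOfMono i (d + 1) : SSet.{u})| → Prop := fun d p ↦
    (∃ x, skeletonInclusion i (d + 1) p = b x) ∧ ¬ ∃ q, skeletonStep i d q = p
  obtain ⟨f, -, hf⟩ := exists_extension_of_skeleta i (E := ULift.{u} ℝ)
    (fun d h ↦ (∃ p, Q d p) → ∃ p, Q d p ∧ (d : ℝ) ≤ (h p).down) (fun d g ↦ by
      by_cases hQ : ∃ p, Q d p
      · obtain ⟨p, hp⟩ := hQ
        obtain ⟨h, h1, h2⟩ := (skeletonAttachment i d).exists_extension_large g p hp.2 d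
        exact ⟨h, h1, fun _ ↦ ⟨p, hp, h2⟩⟩
      · obtain ⟨h, hh⟩ := (skeletonAttachment i d).exists_extension_of_extends
          (exists_extension_real (boundaryCoordinates d).isClosedEmbedding_coordinates) g
        exact ⟨h, hh, fun h ↦ absurd h hQ⟩) (ContinuousMap.const _ ⟨0⟩)
  obtain ⟨B, hB⟩ := ((isCompact_range (f := fun x ↦ (f (b x)).down)
    (continuous_uliftDown.comp (f.comp b).continuous))).bddAbove
  obtain ⟨N, hN⟩ := exists_nat_gt B
  have hlt : ∀ d, N ≤ d → ¬ ∃ p, Q d p := fun d hd h ↦ by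
    obtain ⟨p, ⟨⟨x, hx⟩, -⟩, h2⟩ := hf d h
    have h3 := hB ⟨x, rfl⟩
    change (d : ℝ) ≤ (f (skeletonInclusion i (d + 1) p)).down at h2
    rw [hx] at h2
    have h4 : (f (b x)).down ≤ B := h3
    have : (N : ℝ) ≤ d := by exact_mod_cast hd
    linarith
  have key : ∀ d, N ≤ d → ∀ x, (∃ q, skeletonInclusion i d q = b x) →
      ∃ q, skeletonInclusion i N q = b x := by
    intro d hd x
    induction d, hd using Nat.le_induction with
    | base => exact id
    | succ d hd ih =>
      rintro ⟨p, hp⟩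
      by_cases hq : ∃ q, skeletonStep i d q = p
      · obtain ⟨q, rfl⟩ := hq
        exact ih ⟨q, (skeletonInclusion_step i d q).symm.trans hp⟩
      · exact absurd ⟨p, ⟨x, hp⟩, hq⟩ (hlt d hd)
  obtain ⟨x, hx⟩ := hb N
  have hex : ∃ d, N ≤ d ∧ ∃ q, skeletonInclusion i d q = b x := by
    obtain ⟨n, y, t, hy⟩ := exists_cellMap_eq (b x)
    refine ⟨max N (n + 1), le_max_left _ _, ?_⟩
    have hmem : y ∈ (SSet.skeletonOfMono i (max N (n + 1))).obj _ := by
      have := SSet.skeletonOfMono_obj_eq_top i (lt_max_of_lt_right (b := N) (Nat.lt_succ_self n))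
      exact this.symm ▸ Set.mem_univ y
    refine ⟨cellMap (S := (SSet.skeletonOfMono i (max N (n + 1)) : SSet.{u})) ⟨y, hmem⟩ t, ?_⟩
    exact (toTop_map_cellMap (SSet.skeletonOfMono i (max N (n + 1))).ι ⟨y, hmem⟩ t).trans hy
  obtain ⟨d, hd, hq⟩ := hex
  obtain ⟨q, hq⟩ := key d hd x hq
  exact hx q hq

end

theorem LiftsRel.of_isEmbedding_surjective {A B : Type u} [TopologicalSpace A] [TopologicalSpace B]
    {D : Type} [TopologicalSpace D] {S : Set D} {f : C(A, B)} (hf : IsEmbedding f)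
    (hs : Function.Surjective f) : LiftsRel D S f := by
  intro a b hab
  choose g hg using hs
  have hgb : Continuous fun x ↦ g (b x) := hf.continuous_iff.2 (by
    simpa only [Function.comp_def, hg] using b.continuous)
  have h : f.comp ⟨_, hgb⟩ = b := by
    ext x
    exact hg _
  refine ⟨⟨_, hgb⟩, fun x ↦ hf.injective ?_, ?_⟩
  · rw [hab]
    exact hg _
  · rw [h]
    exact ContinuousMap.HomotopicRel.refl _

theorem skeletonOfMono_le_range {X Y : SSet.{u}} (i : X ⟶ Y) {N : ℕ}
    (hi : ∀ n ≤ N, ∀ x : Y _⦋n⦌, ∃ y, i.app _ y = x) :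
    SSet.skeletonOfMono i (N + 1) ≤ SSet.Subcomplex.range i := by
  rw [SSet.Subcomplex.le_iff_contains_nonDegenerate]
  intro n x hx
  rcases (SSet.mem_skeletonOfMono_obj_iff_of_nonDegenerate i x (N + 1)).1 hx with h | h
  · exact h
  · exact hi n (Nat.lt_succ_iff.1 h) x.1

/-- A monomorphism which is surjective on simplices of dimension at most `N` compresses. -/
theorem compressesUpTo_of_mono {X Y : SSet.{u}} (i : X ⟶ Y) [Mono i] {N : ℕ}
    (hi : ∀ n ≤ N, ∀ x : Y _⦋n⦌, ∃ y, i.app _ y = x) : CompressesUpTo N (SSet.toTop.map i).hom := by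
  intro n hn
  have hle : ∀ d, SSet.Subcomplex.range i ≤ SSet.skeletonOfMono i d := fun d ↦ by
    rw [← SSet.skeletonOfMono_zero]
    exact (SSet.skeletonOfMono i).monotone (Nat.zero_le d)
  let κ : ∀ d, X ⟶ (SSet.skeletonOfMono i d : SSet.{u}) := fun d ↦ SSet.Subcomplex.lift i (hle d)
  have hκ : ∀ d, κ d ≫ (SSet.skeletonOfMono i d).ι = i := fun d ↦ rfl
  -- Stage `N + 1` is the image of `i`, as all simplices of dimension at most `N` lie there. Each
  -- later step attaches cells of dimension `d > N ≥ n`.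
  have hlift : ∀ d, N + 1 ≤ d →
      LiftsRel (Fin n → I) (Cube.boundary (Fin n)) (SSet.toTop.map (κ d)).hom := by
    intro d hd
    induction d, hd using Nat.le_induction with
    | base =>
      have : Mono (κ (N + 1)) := mono_of_mono_fac (hκ (N + 1))
      refine LiftsRel.of_isEmbedding_surjective (isEmbedding_toTop_map_of_mono _) fun p ↦ ?_
      obtain ⟨m, x, t, rfl⟩ := exists_cellMap_eq p
      obtain ⟨y, hy⟩ := skeletonOfMono_le_range i hi _ x.2
      refine ⟨cellMap y t, (toTop_map_cellMap _ y t).trans (congrArg (fun z ↦ cellMap z t) ?_)⟩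
      exact Subtype.ext hy
    | succ d hd ih =>
      have h1 := ih.comp ((skeletonAttachment i d).liftsRel (by omega) (Cube.boundary (Fin n)))
      have h2 : (SSet.toTop.map (SSet.relativeCellComplexOfMono.r i d)).hom.comp
          (SSet.toTop.map (κ d)).hom = (SSet.toTop.map (κ (d + 1))).hom := by
        ext p
        exact (toTop_map_comp_apply (κ d) (SSet.relativeCellComplexOfMono.r i d) p).symm
      rwa [h2] at h1
  intro a b hab
  obtain ⟨d, hd⟩ := exists_skeleton_of_compact i b
  have hd' : ∀ x, ∃ q, skeletonInclusion i (max d (N + 1)) q = b x := fun x ↦ by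
    obtain ⟨q, hq⟩ := hd x
    refine ⟨(SSet.toTop.map (SSet.Subcomplex.homOfLE
      ((SSet.skeletonOfMono i).monotone (le_max_left d (N + 1))))).hom q, ?_⟩
    rw [← hq]
    exact (toTop_map_comp_apply _ (SSet.skeletonOfMono i (max d (N + 1))).ι q).symm
  choose b' hb' using hd'
  have hemb : IsEmbedding (skeletonInclusion i (max d (N + 1))) := isEmbedding_toTop_map_of_mono _
  have hb'c : Continuous b' := hemb.continuous_iff.2 (by
    simpa only [Function.comp_def, hb'] using b.continuous)
  have hκp : ∀ p, skeletonInclusion i (max d (N + 1)) ((SSet.toTop.map (κ (max d (N + 1)))).hom p) =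
      (SSet.toTop.map i).hom p := fun p ↦
    (toTop_map_comp_apply (κ (max d (N + 1))) (SSet.skeletonOfMono i (max d (N + 1))).ι p).symm
  obtain ⟨a', ha', ⟨H⟩⟩ := hlift (max d (N + 1)) (le_max_right _ _) a ⟨b', hb'c⟩ fun x ↦
    hemb.injective (by rw [hκp, hab]; exact (hb' _).symm)
  refine ⟨a', ha', ⟨⟨⟨⟨fun p ↦ skeletonInclusion i (max d (N + 1)) (H p), by fun_prop⟩, fun x ↦ ?_,
    fun x ↦ ?_⟩, fun t x hx ↦ ?_⟩⟩⟩
  · exact (congrArg _ (H.apply_zero x)).trans (hκp _)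
  · exact (congrArg _ (H.apply_one x)).trans (hb' _)
  · exact (congrArg _ (H.eq_fst t hx)).trans (hκp _)

end

section

open CategoryTheory Opposite Simplicial Topology MonoidalCategory

/-! ### Functoriality of homotopy colimits and homotopies between reindexing maps. -/

section HocolimFunctoriality

variable {J J' : Type} [SmallCategory J] [SmallCategory J']

/-- A simplex of the homotopy colimit. -/
def hocolimMk {X : J ⥤ SSet.{u}} {n : SimplexCategoryᵒᵖ} (σ : ComposableArrows Jᵒᵖ n.unop.len)
    (x : (X.obj (chainSource σ)).obj n) : (hocolim X).obj n := ⟨σ, x⟩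

theorem hocolimMk_surjective {X : J ⥤ SSet.{u}} {n : SimplexCategoryᵒᵖ} (y : (hocolim X).obj n) :
    ∃ σ x, hocolimMk (X := X) σ x = y := ⟨y.1, y.2, rfl⟩

theorem hocolim_map_mk {X : J ⥤ SSet.{u}} {n m : SimplexCategoryᵒᵖ} (θ : n ⟶ m)
    (σ : ComposableArrows Jᵒᵖ n.unop.len) (x : (X.obj (chainSource σ)).obj n) :
    (hocolim X).map θ (hocolimMk σ x) = hocolimMk (chainPullback θ.unop σ)
      ((X.map (chainTransition θ.unop σ)).app m ((X.obj (chainSource σ)).map θ x)) := by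
  refine congrArg (Sigma.mk (chainPullback θ.unop σ)) ?_
  exact (ConcreteCategory.congr_hom ((X.map (chainTransition θ.unop σ)).naturality θ) x).symm

theorem hocolimMk_eq {X : J ⥤ SSet.{u}} {n : SimplexCategoryᵒᵖ}
    {σ τ : ComposableArrows Jᵒᵖ n.unop.len} (h : σ = τ) {j : J} (f : j ⟶ chainSource σ)
    (g : j ⟶ chainSource τ) (hfg : HEq f g) (x : (X.obj j).obj n) :
    hocolimMk σ ((X.map f).app n x) = hocolimMk τ ((X.map g).app n x) := by
  subst h
  rw [eq_of_heq hfg]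

/-- The map of homotopy colimits induced by a natural transformation. -/
def hocolimMap {X Y : J ⥤ SSet.{u}} (f : X ⟶ Y) : hocolim X ⟶ hocolim Y where
  app n := ↾fun p ↦ hocolimMk p.1 ((f.app (chainSource p.1)).app n p.2)
  naturality n m θ := by
    ext p
    obtain ⟨σ, x, rfl⟩ := hocolimMk_surjective p
    refine congrArg (Sigma.mk (chainPullback θ.unop σ)) ?_
    have h1 := ConcreteCategory.congr_hom ((f.app (chainSource (chainPullback θ.unop σ))).naturality θ)
      ((X.map (chainTransition θ.unop σ)).app n x)
    have h2 := ConcreteCategory.congr_hom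
      (NatTrans.congr_app (f.naturality (chainTransition θ.unop σ)) n) x
    exact h1.trans (congrArg ((Y.obj _).map θ) h2)

theorem hocolimMap_comp {X Y Z : J ⥤ SSet.{u}} (f : X ⟶ Y) (g : Y ⟶ Z) :
    hocolimMap f ≫ hocolimMap g = hocolimMap (f ≫ g) := rfl

theorem toHocolim_naturality {X Y : J ⥤ SSet.{u}} (f : X ⟶ Y) (j : J) :
    toHocolim X j ≫ hocolimMap f = f.app j ≫ toHocolim Y j := rfl

/-- The map of homotopy colimits induced by a functor of the indexing categories. -/
def hocolimReindex (F : J ⥤ J') (X : J' ⥤ SSet.{u}) : hocolim (F ⋙ X) ⟶ hocolim X where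
  app _ := ↾fun p ↦ hocolimMk (p.1 ⋙ F.op) p.2
  naturality _ _ _ := rfl

variable {F G : J ⥤ J'} (α : F ⟶ G)

/-- The functor from `Jᵒᵖ` to arrows of `J'ᵒᵖ` given by a natural transformation. -/
def arrowFunctor : Jᵒᵖ ⥤ ComposableArrows J'ᵒᵖ 1 where
  -- Passing to `J'ᵒᵖ` reverses `α`, so vertex `0` carries `G` and vertex `1` carries `F`; this
  -- fixes which end of the homotopy belongs to which functor.
  obj j := ComposableArrows.mk₁ (α.app j.unop).op
  map f := ComposableArrows.homMk₁ (G.map f.unop).op (F.map f.unop).op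
    (congrArg Quiver.Hom.op (α.naturality f.unop))
  map_id j := ComposableArrows.hom_ext₁ (congrArg Quiver.Hom.op (G.map_id j.unop))
    (congrArg Quiver.Hom.op (F.map_id j.unop))
  map_comp f g := ComposableArrows.hom_ext₁ (congrArg Quiver.Hom.op (G.map_comp g.unop f.unop))
    (congrArg Quiver.Hom.op (F.map_comp g.unop f.unop))

/-- The chain interpolating between the images of a chain under two functors. -/
def interpolatedChain {n : ℕ} (σ : ComposableArrows Jᵒᵖ n) (β : Fin (n + 1) →o Fin 2) :
    ComposableArrows J'ᵒᵖ n :=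
  Functor.prod' σ β.monotone.functor ⋙ Functor.uncurry.obj (arrowFunctor α)

/-- The comparison of the source of an interpolated chain. -/
def interpolatedSource {n : ℕ} (σ : ComposableArrows Jᵒᵖ n) (β : Fin (n + 1) →o Fin 2) :
    F.obj (chainSource σ) ⟶ chainSource (interpolatedChain α σ β) :=
  (((arrowFunctor α).obj (σ.obj (Fin.last n))).map
    (homOfLE (Fin.le_last (β (Fin.last n))))).unop

/-- This is naturality of `α` along the chain. It makes the simplices of `reindexHomotopy`, which
are pushed to the source of the interpolated chain, compatible with operators. -/
theorem interpolatedSource_transition {r s : SimplexCategory} (θ : r ⟶ s)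
    (σ : ComposableArrows Jᵒᵖ s.len) (β : Fin (s.len + 1) →o Fin 2) :
    interpolatedSource α σ β ≫ chainTransition θ (interpolatedChain α σ β) =
      F.map (chainTransition θ σ) ≫
        interpolatedSource α (chainPullback θ σ) (β.comp θ.toOrderHom) := by
  apply Quiver.Hom.op_inj
  change (((arrowFunctor α).map (σ.map _)).app _ ≫ ((arrowFunctor α).obj _).map _) ≫
    ((arrowFunctor α).obj _).map _ =
      ((arrowFunctor α).obj (σ.obj (θ.toOrderHom (Fin.last _)))).map (homOfLE (Fin.le_last (β (θ.toOrderHom (Fin.last _))))) ≫ ((arrowFunctor α).map (σ.map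
        (homOfLE (Fin.le_last (θ.toOrderHom (Fin.last r.len)))))).app 1
  refine (Category.assoc _ _ _).trans ((congrArg _
    (((arrowFunctor α).obj (σ.obj (Fin.last s.len))).map_comp _ _).symm).trans ?_)
  exact (((arrowFunctor α).map (σ.map _)).naturality _).symm

/-- The simplices of `reindexHomotopy`. -/
def reindexHomotopyMk {X : J' ⥤ SSet.{u}} {n : SimplexCategoryᵒᵖ} (p : (hocolim (F ⋙ X)).obj n)
    (β : Fin (n.unop.len + 1) →o Fin 2) : (hocolim X).obj n :=
  hocolimMk (interpolatedChain α p.1 β) ((X.map (interpolatedSource α p.1 β)).app _ p.2)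

theorem map_reindexHomotopyMk {X : J' ⥤ SSet.{u}} {n m : SimplexCategoryᵒᵖ} (θ : n ⟶ m)
    (p : (hocolim (F ⋙ X)).obj n) (β : Fin (n.unop.len + 1) →o Fin 2) :
    reindexHomotopyMk α ((hocolim (F ⋙ X)).map θ p) (β.comp θ.unop.toOrderHom) =
      (hocolim X).map θ (reindexHomotopyMk α p β) := by
  obtain ⟨σ, x, rfl⟩ := hocolimMk_surjective p
  rw [hocolim_map_mk]
  refine Eq.trans ?_ (hocolim_map_mk θ _ _).symm
  refine congrArg (hocolimMk (chainPullback θ.unop (interpolatedChain α σ β))) ?_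
  have e1 := map_app_of_eq_comp X _ _ _ (interpolatedSource_transition α θ.unop σ β) m
    ((X.obj (F.obj (chainSource σ))).map θ x)
  have e2 := ConcreteCategory.congr_hom ((X.map (interpolatedSource α σ β)).naturality θ) x
  have e3 := map_app_of_eq_comp X (interpolatedSource α σ β)
    (chainTransition θ.unop (interpolatedChain α σ β)) _ rfl m
    ((X.obj (F.obj (chainSource σ))).map θ x)
  exact e1.symm.trans (e3.trans (congrArg _ e2))

/-- The homotopy between the reindexing maps of two functors related by a natural
transformation. -/
def reindexHomotopy (X : J' ⥤ SSet.{u}) : hocolim (F ⋙ X) ⊗ Δ[1] ⟶ hocolim X where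
  app _ := ↾fun p ↦ reindexHomotopyMk α p.1 (SSet.stdSimplex.asOrderHom p.2)
  naturality n m θ := by
    ext p
    exact map_reindexHomotopyMk α θ p.1 (SSet.stdSimplex.asOrderHom p.2)

theorem ι₁_reindexHomotopy (X : J' ⥤ SSet.{u}) :
    SSet.ι₁ ≫ reindexHomotopy α X = hocolimReindex F X := by
  ext n p
  obtain ⟨σ, x, rfl⟩ := hocolimMk_surjective p
  have h : interpolatedChain α σ (OrderHom.const _ 1) = σ ⋙ F.op :=
    CategoryTheory.Functor.hext (fun _ ↦ rfl) fun i j f ↦ heq_of_eq <| by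
      exact (congrArg (((arrowFunctor α).map (σ.map f)).app 1 ≫ ·)
        (((arrowFunctor α).obj (σ.obj j)).map_id 1)).trans (Category.comp_id _)
  refine (hocolimMk_eq h _ (𝟙 _) ?_ x).trans (congrArg (hocolimMk _) (map_app_of_eq_id X _ rfl _ x))
  exact heq_of_eq (Quiver.Hom.op_inj (((arrowFunctor α).obj (σ.obj (Fin.last _))).map_id 1))

theorem ι₀_reindexHomotopy (X : J' ⥤ SSet.{u}) :
    SSet.ι₀ ≫ reindexHomotopy α X =
      hocolimMap (Functor.whiskerRight α X) ≫ hocolimReindex G X := by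
  ext n p
  obtain ⟨σ, x, rfl⟩ := hocolimMk_surjective p
  have h : interpolatedChain α σ (OrderHom.const _ 0) = σ ⋙ G.op :=
    CategoryTheory.Functor.hext (fun _ ↦ rfl) fun i j f ↦ heq_of_eq <| by
      exact (congrArg (((arrowFunctor α).map (σ.map f)).app 0 ≫ ·)
        (((arrowFunctor α).obj (σ.obj j)).map_id 0)).trans (Category.comp_id _)
  exact hocolimMk_eq h _ (α.app (chainSource σ)) (heq_of_eq rfl) x

/-- The reindexing maps of two functors related by a natural transformation are homotopic. -/
theorem homotopic_hocolimReindex (X : J' ⥤ SSet.{u}) :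
    (SSet.toTop.map (hocolimMap (Functor.whiskerRight α X) ≫ hocolimReindex G X)).hom.Homotopic
      (SSet.toTop.map (hocolimReindex F X)).hom :=
  homotopic_realization (reindexHomotopy α X) (ι₀_reindexHomotopy α X) (ι₁_reindexHomotopy α X)

end HocolimFunctoriality

end

section

open CategoryTheory Opposite Simplicial Topology MonoidalCategory

/-! ### Reduction to singular simplicial sets. -/

section SingularHocolim

variable {J : Type} [SmallCategory J]

theorem chainTransition_comp {q r s : SimplexCategory} (φ : q ⟶ r) (θ : r ⟶ s)
    (σ : ComposableArrows Jᵒᵖ s.len) :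
    chainTransition (φ ≫ θ) σ = chainTransition θ σ ≫ chainTransition φ (chainPullback θ σ) :=
  congrArg Quiver.Hom.unop (σ.map_comp
    (homOfLE (θ.toOrderHom.monotone (Fin.le_last (φ.toOrderHom (Fin.last _)))))
    (homOfLE (Fin.le_last _)))

/-- The map to the homotopy colimit given by a chain. -/
def chainMap (Y : J ⥤ SSet.{u}) {k : ℕ} (σ : ComposableArrows Jᵒᵖ k) :
    Y.obj (chainSource σ) ⊗ Δ[k] ⟶ hocolim Y where
  app n := ↾fun p ↦ hocolimMk (chainPullback (s := ⦋k⦌) (SSet.stdSimplex.objEquiv p.2) σ)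
    ((Y.map (chainTransition (s := ⦋k⦌) (SSet.stdSimplex.objEquiv p.2) σ)).app n p.1)
  naturality n m φ := by
    ext p
    obtain ⟨x, β⟩ := p
    refine Eq.trans ?_ (hocolim_map_mk φ _ _).symm
    refine congrArg (hocolimMk (chainPullback (φ.unop ≫ SSet.stdSimplex.objEquiv β) σ)) ?_
    have e1 := map_app_of_eq_comp Y _ _ _
      (chainTransition_comp φ.unop (SSet.stdSimplex.objEquiv β) σ) m
      ((Y.obj (chainSource σ)).map φ x)
    have e2 := ConcreteCategory.congr_hom
      ((Y.map (chainTransition (s := ⦋k⦌) (SSet.stdSimplex.objEquiv β) σ)).naturality φ) x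
    exact e1.trans (congrArg _ e2)

theorem chainMap_id (Y : J ⥤ SSet.{u}) {k : ℕ} (σ : ComposableArrows Jᵒᵖ k)
    (x : (Y.obj (chainSource σ)) _⦋k⦌) :
    (chainMap Y σ).app _ (prodSimplex x (stdSimplexMk (𝟙 ⦋k⦌))) =
      hocolimMk (n := op ⦋k⦌) σ x :=
  congrArg (Sigma.mk σ) (map_app_of_eq_id Y _
      (congrArg Quiver.Hom.unop (σ.map_id (Fin.last k))) _ x)

/-- This is the relation that glues the pieces `Y(nₛ) × Δ[s]` together; it makes
`singularComparison` simplicial. -/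
theorem chainMap_pullback (Y : J ⥤ SSet.{u}) {k l : ℕ} (σ : ComposableArrows Jᵒᵖ k)
    (a : ⦋l⦌ ⟶ ⦋k⦌) :
    Y.map (chainTransition (s := ⦋k⦌) a σ) ▷ Δ[l] ≫ chainMap Y (chainPullback (s := ⦋k⦌) a σ) =
      Y.obj (chainSource σ) ◁ SSet.stdSimplex.map a ≫ chainMap Y σ := by
  ext n p
  obtain ⟨x, β⟩ := p
  exact congrArg (hocolimMk (chainPullback (SSet.stdSimplex.objEquiv β ≫ a) σ))
    (map_app_of_eq_comp Y _ _ _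
      (chainTransition_comp (SSet.stdSimplex.objEquiv β) a σ) n x).symm

theorem chainMap_naturality {X Y : J ⥤ SSet.{u}} (f : X ⟶ Y) {k : ℕ}
    (σ : ComposableArrows Jᵒᵖ k) :
    f.app (chainSource σ) ▷ Δ[k] ≫ chainMap Y σ = chainMap X σ ≫ hocolimMap f := by
  ext n p
  obtain ⟨x, β⟩ := p
  exact congrArg (hocolimMk (chainPullback (s := ⦋k⦌) (SSet.stdSimplex.objEquiv β) σ))
    (ConcreteCategory.congr_hom (NatTrans.congr_app
      (f.naturality (chainTransition (s := ⦋k⦌) (SSet.stdSimplex.objEquiv β) σ)) n) x).symm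

/-- The objectwise singular simplicial set of the realization. -/
noncomputable abbrev singularRealization (Y : J ⥤ SSet.{u}) : J ⥤ SSet.{u} :=
  Y ⋙ SSet.toTop ⋙ TopCat.toSSet

/-- The unit of the adjunction, objectwise. -/
noncomputable def singularUnit (Y : J ⥤ SSet.{u}) : Y ⟶ singularRealization Y where
  app j := sSetTopAdj.unit.app (Y.obj j)
  naturality _ _ f := sSetTopAdj.unit.naturality (Y.map f)

/-- The maps induced on objectwise singular simplicial sets. -/
noncomputable abbrev singularRealizationMap {X Y : J ⥤ SSet.{u}} (f : X ⟶ Y) :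
    singularRealization X ⟶ singularRealization Y :=
  Functor.whiskerRight f (SSet.toTop ⋙ TopCat.toSSet)

/-- The comparison of the homotopy colimit of the singular simplicial sets with the
realization of the homotopy colimit. -/
noncomputable def singularComparison (Y : J ⥤ SSet.{u}) :
    hocolim (singularRealization Y) ⟶ TopCat.toSSet.obj |hocolim Y| :=
  -- A simplex `y : Δⁿ → |Y(nₛ)|` over a chain gives `t ↦ (y t, t)` in `|Y(nₛ)| × Δⁿ`, which is sent
  -- to `|Y(nₛ) × Δ[n]|` and on to the realized homotopy colimit.
  toSingular (fun n p ↦ (SSet.toTop.map (chainMap Y p.1)).hom.comp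
      ((cylinderMap (Y.obj (chainSource p.1)) n.unop.len).comp
        ((TopCat.toSSetObjEquiv _ _ p.2).prodMk (ContinuousMap.id _)))) (by
    intro n m f p t
    obtain ⟨σ, y, rfl⟩ := hocolimMk_surjective p
    rw [hocolim_map_mk]
    have h1 := cylinderMap_naturality (Y.map (chainTransition f.unop σ)) m.unop.len
      (TopCat.toSSetObjEquiv _ _ y (stdSimplex.map f.unop.toOrderHom t)) t
    have h2 := cylinderMap_map (S := Y.obj (chainSource σ)) (k := m.unop.len) (l := n.unop.len) f.unop
      (TopCat.toSSetObjEquiv _ _ y (stdSimplex.map f.unop.toOrderHom t)) t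
    have h3 := congrArg (fun g ↦ (SSet.toTop.map g).hom
      (cylinderMap (Y.obj (chainSource σ)) m.unop.len
        (TopCat.toSSetObjEquiv _ _ y (stdSimplex.map f.unop.toOrderHom t), t)))
      (chainMap_pullback Y (l := m.unop.len) (k := n.unop.len) σ f.unop)
    simp only [toTop_map_comp_apply] at h3
    refine Eq.trans ?_ (h3.trans ?_)
    · exact congrArg (SSet.toTop.map (chainMap Y (chainPullback f.unop σ))).hom h1.symm
    · exact congrArg (SSet.toTop.map (chainMap Y σ)).hom h2)

theorem singularComparison_cellMap (Y : J ⥤ SSet.{u}) {n : ℕ} (σ : ComposableArrows Jᵒᵖ n)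
    (y : ((singularRealization Y).obj (chainSource σ)) _⦋n⦌) (t) :
    realizationDesc (singularComparison Y) (cellMap (hocolimMk (n := op ⦋n⦌) σ y) t) =
      (SSet.toTop.map (chainMap Y σ)).hom (cylinderMap (Y.obj (chainSource σ)) n
        (TopCat.toSSetObjEquiv |Y.obj (chainSource σ)| (op ⦋n⦌) y t, t)) :=
  realizationDesc_cellMap (singularComparison Y) _ t

/-- With `singularComparison_naturality`, this exhibits the realized homotopy colimit of `Y` as a
natural retract of that of `Sing|Y|`. -/
theorem singularComparison_unit (Y : J ⥤ SSet.{u}) (p : |hocolim Y|) :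
    realizationDesc (singularComparison Y)
      ((SSet.toTop.map (hocolimMap (singularUnit Y))).hom p) = p := by
  obtain ⟨n, y, t, rfl⟩ := exists_cellMap_eq p
  obtain ⟨σ, x, rfl⟩ := hocolimMk_surjective y
  rw [toTop_map_cellMap]
  refine (singularComparison_cellMap Y σ ((singularUnit Y).app _ |>.app _ x) t).trans ?_
  have h1 := cylinderMap_cellMap x (𝟙 ⦋n⦌) (𝟙 ⦋n⦌) t
  have h2 : stdSimplex.map (𝟙 ⦋n⦌ : ⦋n⦌ ⟶ ⦋n⦌).toOrderHom t = t := stdSimplex.map_id_apply t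
  rw [h2] at h1
  refine (congrArg (SSet.toTop.map (chainMap Y σ)).hom h1).trans ?_
  rw [toTop_map_cellMap]
  refine congrArg (fun z ↦ cellMap z t) ?_
  have h3 : (Y.obj (chainSource σ)).map (𝟙 ⦋n⦌ : ⦋n⦌ ⟶ ⦋n⦌).op x = x :=
    ConcreteCategory.congr_hom ((Y.obj (chainSource σ)).map_id (op ⦋n⦌)) x
  rw [h3]
  exact chainMap_id Y σ x

theorem singularComparison_naturality {X Y : J ⥤ SSet.{u}} (f : X ⟶ Y)
    (p : |hocolim (singularRealization X)|) :
    realizationDesc (singularComparison Y)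
      ((SSet.toTop.map (hocolimMap (singularRealizationMap f))).hom p) =
      (SSet.toTop.map (hocolimMap f)).hom (realizationDesc (singularComparison X) p) := by
  obtain ⟨n, y, t, rfl⟩ := exists_cellMap_eq p
  obtain ⟨σ, x, rfl⟩ := hocolimMk_surjective y
  rw [toTop_map_cellMap]
  refine (singularComparison_cellMap Y σ ((singularRealizationMap f).app _ |>.app _ x) t).trans ?_
  refine Eq.trans ?_ (congrArg (SSet.toTop.map (hocolimMap f)).hom
    (singularComparison_cellMap X σ x t).symm)
  rw [← toTop_map_comp_apply, ← chainMap_naturality, toTop_map_comp_apply, cylinderMap_naturality]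
  rfl

/-- A map of homotopy colimits compresses if it does so for the singular simplicial sets. -/
theorem CompressesUpTo.of_singularRealization {X Y : J ⥤ SSet.{u}} (f : X ⟶ Y) {N : ℕ}
    (h : CompressesUpTo N (SSet.toTop.map (hocolimMap (singularRealizationMap f))).hom) :
    CompressesUpTo N (SSet.toTop.map (hocolimMap f)).hom := fun i hi ↦
  (h i hi).retract _ (SSet.toTop.map (hocolimMap (singularUnit X))).hom
    (SSet.toTop.map (hocolimMap (singularUnit Y))).hom
    (realizationDesc (singularComparison X)) (realizationDesc (singularComparison Y))
    (singularComparison_unit X) (singularComparison_unit Y)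
    (fun p ↦ by
      rw [← toTop_map_comp_apply, ← toTop_map_comp_apply, hocolimMap_comp, hocolimMap_comp]
      refine congrArg (fun g ↦ (SSet.toTop.map (hocolimMap g)).hom p) ?_
      ext j : 2
      exact (sSetTopAdj.unit.naturality (f.app j)).symm)
    (fun p ↦ (singularComparison_naturality f p).symm)

end SingularHocolim

end

/-! ### Anodyne subdiagrams: filtering a homotopy colimit by skeleta of the nerve. -/

section

open CategoryTheory Opposite Simplicial Topology MonoidalCategory Limits

/-- A surjective operator has a section, which would bring the nondegenerate `y` itself into the
skeleton of dimension below `d`. A nonsurjective one factors through a face of smaller dimension. -/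
theorem map_mem_skeleton_iff {Y : SSet.{u}} {d n : ℕ} {y : Y _⦋d⦌} (hy : y ∈ Y.nonDegenerate d)
    (θ : ⦋n⦌ ⟶ ⦋d⦌) :
    Y.map θ.op y ∈ (Y.skeleton d).obj _ ↔ ¬ Function.Surjective θ.toOrderHom := by
  constructor
  · intro h hs
    have : Epi θ := SimplexCategory.epi_iff_surjective.2 hs
    have hsec := isSplitEpi_of_epi θ
    have h1 : Y.map (section_ θ).op (Y.map θ.op y) = y := by
      rw [← ConcreteCategory.comp_apply, ← Y.map_comp, ← op_comp, IsSplitEpi.id, op_id, Y.map_id]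
      rfl
    have h2 : Y.map (section_ θ).op (Y.map θ.op y) ∈ (Y.skeleton d).obj _ :=
      (Y.skeleton d).map (section_ θ).op h
    have h3 : y ∈ (Y.skeleton d).obj _ := by rwa [h1] at h2
    exact lt_irrefl d ((Y.mem_skeleton_obj_iff_of_nonDegenerate ⟨y, hy⟩ d).1 h3)
  · intro hs
    rcases d with _ | d
    · exact absurd (fun b ↦ ⟨0, Subsingleton.elim (α := Fin 1) _ _⟩) hs
    obtain ⟨i, θ', rfl⟩ := SimplexCategory.eq_comp_δ_of_not_surjective θ hs
    have h1 : Y.map (θ' ≫ SimplexCategory.δ i).op y =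
        Y.map θ'.op (Y.map (SimplexCategory.δ i).op y) := by
      rw [op_comp, Y.map_comp]; rfl
    rw [h1]
    exact (Y.skeleton (d + 1)).map θ'.op (Y.mem_skeleton _ (Nat.lt_succ_self d))

section HocolimAnodyne

variable {J : Type} [SmallCategory J]

/-- A surjective monotone map preserves the last vertex. -/
theorem isIso_chainTransition {r s : SimplexCategory} (θ : r ⟶ s)
    (hθ : Function.Surjective θ.toOrderHom) (σ : ComposableArrows Jᵒᵖ s.len) :
    IsIso (chainTransition θ σ) := by
  have h : θ.toOrderHom (Fin.last r.len) = Fin.last s.len := by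
    obtain ⟨x, hx⟩ := hθ (Fin.last s.len)
    exact le_antisymm (Fin.le_last _) (hx ▸ θ.toOrderHom.monotone (Fin.le_last x))
  have : IsIso (homOfLE (Fin.le_last (θ.toOrderHom (Fin.last r.len)))) :=
    ⟨homOfLE h.ge, Subsingleton.elim _ _, Subsingleton.elim _ _⟩
  have h2 : IsIso (σ.map (homOfLE (Fin.le_last (θ.toOrderHom (Fin.last r.len))))) :=
    Functor.map_isIso σ _
  exact isIso_unop _

theorem map_app_injective_of_isIso (X : J ⥤ SSet.{u}) {i j : J} (f : i ⟶ j) [IsIso f]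
    (n : SimplexCategoryᵒᵖ) : Function.Injective ((X.map f).app n) := by
  intro x y h
  have key : ∀ x, (X.map (inv f)).app n ((X.map f).app n x) = x := fun x ↦ by
    rw [← map_app_of_eq_comp X f (inv f) _ rfl, map_app_of_eq_id X _ (IsIso.hom_inv_id f)]
  rw [← key x, h, key]

variable (M : J ⥤ SSet.{u}) (A : ∀ j, (M.obj j).Subcomplex)
  (hA : ∀ {i j : J} (f : i ⟶ j), A i ≤ (A j).preimage (M.map f))

/-- The filtration of a homotopy colimit, relative to the homotopy colimit of a subdiagram, by the
skeleta of the nerve. -/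
def hocolimFiltration (d : ℕ) : (hocolim M).Subcomplex where
  -- `skeleton d` consists of the dimensions below `d`, so it is empty for `d = 0`, and stage `0` is
  -- the homotopy colimit of the subdiagram `A`.
  obj n := Set.ofPred fun p ↦ p.2 ∈ (A (chainSource p.1)).obj n ∨
    (show (nerve Jᵒᵖ).obj n from p.1) ∈ ((nerve Jᵒᵖ).skeleton d).obj n
  map {n m} θ p hp := by
    obtain ⟨σ, x, rfl⟩ := hocolimMk_surjective p
    rcases hp with h | h
    · left
      exact (A _).map θ (hA (chainTransition θ.unop σ) n h)
    · right
      exact ((nerve Jᵒᵖ).skeleton d).map θ h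

theorem hocolimFiltration_mono : Monotone (hocolimFiltration M A hA) := by
  intro d e h n p hp
  exact hp.imp id fun h' ↦ (nerve Jᵒᵖ).skeleton.monotone h _ h'

theorem iSup_hocolimFiltration : ⨆ d, hocolimFiltration M A hA d = ⊤ := by
  rw [eq_top_iff]
  intro n p _
  have h : p ∈ (hocolimFiltration M A hA (n.unop.len + 1)).obj n :=
    Or.inr ((nerve Jᵒᵖ).mem_skeleton (i := n.unop.len) (show (nerve Jᵒᵖ) _⦋n.unop.len⦌ from p.1)
      (Nat.lt_succ_self _))
  exact le_iSup (hocolimFiltration M A hA) (n.unop.len + 1) _ h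

variable (J) in
/-- A nondegenerate chain. -/
@[ext]
structure NondegenerateChain (d : ℕ) where
  /-- The underlying chain. -/
  chain : ComposableArrows Jᵒᵖ d
  nonDegenerate : (show (nerve Jᵒᵖ) _⦋d⦌ from chain) ∈ (nerve Jᵒᵖ).nonDegenerate d

/-- Over a surjective operator the transition map is invertible, so membership in `A` can be moved
back to the source of the chain. A nonsurjective operator lies in `∂Δ[d]`, and the chain it produces
is in the skeleton. -/
theorem chainMap_mem_iff {d : ℕ} (c : NondegenerateChain J d) {n : SimplexCategoryᵒᵖ}
    (p : (M.obj (chainSource c.chain) ⊗ Δ[d] : SSet.{u}).obj n) :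
    (chainMap M c.chain).app n p ∈ (hocolimFiltration M A hA d).obj n ↔
      p ∈ ((A (chainSource c.chain)).unionProd (SSet.boundary d)).obj n := by
  have key := map_mem_skeleton_iff c.nonDegenerate (n := n.unop.len)
    (SSet.stdSimplex.objEquiv p.2)
  have hb : p.2 ∈ (SSet.boundary d).obj n ↔
    ¬ Function.Surjective (SSet.stdSimplex.objEquiv p.2).toOrderHom := Iff.rfl
  refine Iff.trans ?_ (SSet.Subcomplex.mem_unionProd_iff _ _ p).symm
  refine Iff.trans ?_ (or_congr_left hb).symm
  constructor
  · rintro (h | h)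
    · by_cases hs : Function.Surjective (SSet.stdSimplex.objEquiv p.2).toOrderHom
      · right
        have := isIso_chainTransition (s := ⦋d⦌) (SSet.stdSimplex.objEquiv p.2) hs c.chain
        have h1 := hA (inv (chainTransition (s := ⦋d⦌) (SSet.stdSimplex.objEquiv p.2) c.chain)) n h
        have h2 : (M.map (inv (chainTransition (s := ⦋d⦌) (SSet.stdSimplex.objEquiv p.2) c.chain))).app n
            ((M.map (chainTransition (s := ⦋d⦌) (SSet.stdSimplex.objEquiv p.2) c.chain)).app n p.1) =
              p.1 := by
          rw [← map_app_of_eq_comp M _ _ _ rfl, map_app_of_eq_id M _ (IsIso.hom_inv_id _)]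
        have h3 : _ ∈ (A (chainSource c.chain)).obj n := h1
        exact h2 ▸ h3
      · exact Or.inl hs
    · exact Or.inl (key.1 h)
  · rintro (h | h)
    · exact Or.inr (key.2 h)
    · exact Or.inl (hA _ n h)

theorem hocolimFiltration_succ {d : ℕ} {n : SimplexCategoryᵒᵖ} {p : (hocolim M).obj n}
    (hp : p ∈ (hocolimFiltration M A hA (d + 1)).obj n) :
    p ∈ (hocolimFiltration M A hA d).obj n ∨ ∃ (c : NondegenerateChain J d) (q : _),
      (chainMap M c.chain).app n q = p := by
  obtain ⟨σ, x, rfl⟩ := hocolimMk_surjective p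
  rcases hp with h | h
  · exact Or.inl (Or.inl h)
  · rw [SSet.skeleton_succ] at h
    rcases h with h | h
    · exact Or.inl (Or.inr h)
    · rw [Subfunctor.iSup_obj] at h
      obtain ⟨y, θ, hθ⟩ := Set.mem_iUnion.1 h
      by_cases hs : Function.Surjective θ.unop.toOrderHom
      · right
        let c : NondegenerateChain J d := ⟨y.1, y.2⟩
        have := isIso_chainTransition (s := ⦋d⦌) θ.unop hs c.chain
        have hc : chainPullback (s := ⦋d⦌) θ.unop c.chain = σ := hθ
        subst hc
        refine ⟨c, ((M.map (inv (chainTransition (s := ⦋d⦌) θ.unop c.chain))).app n x,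
          SSet.stdSimplex.objEquiv.symm θ.unop), ?_⟩
        refine congrArg (hocolimMk (chainPullback (s := ⦋d⦌) θ.unop c.chain)) ?_
        refine (map_app_of_eq_comp M _ _ (𝟙 _)
          (IsIso.inv_hom_id (chainTransition (s := ⦋d⦌) θ.unop c.chain)).symm n x).symm.trans ?_
        exact map_app_of_eq_id M _ rfl n x
      · left
        right
        have := (map_mem_skeleton_iff y.2 (n := n.unop.len) θ.unop).2 hs
        rw [← hθ]
        exact this

/-- The relative cells attached in the filtration of the homotopy colimit. -/
noncomputable abbrev hocolimCell {d : ℕ} (c : NondegenerateChain J d) :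
    (M.obj (chainSource c.chain) ⊗ Δ[d] : SSet.{u}).Subcomplex :=
  (A (chainSource c.chain)).unionProd (SSet.boundary d)

/-- The coproduct of the inclusions of the boundaries of the relative cells. -/
noncomputable abbrev hocolimCellInclusion (d : ℕ) :
    (∐ fun c : NondegenerateChain J d ↦ (hocolimCell M A c : SSet.{u})) ⟶
      ∐ fun c : NondegenerateChain J d ↦ M.obj (chainSource c.chain) ⊗ Δ[d] :=
  Limits.Sigma.map fun c ↦ (hocolimCell M A c).ι

/-- The attaching maps of the relative cells. -/
noncomputable abbrev hocolimAttach (d : ℕ) :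
    (∐ fun c : NondegenerateChain J d ↦ (hocolimCell M A c : SSet.{u})) ⟶
      (hocolimFiltration M A hA d : SSet.{u}) :=
  Limits.Sigma.desc fun c ↦ SSet.Subcomplex.lift ((hocolimCell M A c).ι ≫ chainMap M c.chain) (by
    rintro n _ ⟨x, rfl⟩
    exact (chainMap_mem_iff M A hA c x.1).2 x.2)

/-- The characteristic maps of the relative cells. -/
noncomputable abbrev hocolimChar (d : ℕ) :
    (∐ fun c : NondegenerateChain J d ↦ M.obj (chainSource c.chain) ⊗ Δ[d]) ⟶
      (hocolimFiltration M A hA (d + 1) : SSet.{u}) :=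
  Limits.Sigma.desc fun c ↦ SSet.Subcomplex.lift (chainMap M c.chain) (by
    rintro n _ ⟨p, rfl⟩
    refine Or.inr ?_
    have h := ((nerve Jᵒᵖ).skeleton (d + 1)).map (SSet.stdSimplex.objEquiv p.2).op
      ((nerve Jᵒᵖ).mem_skeleton (show (nerve Jᵒᵖ) _⦋d⦌ from c.chain) (Nat.lt_succ_self d))
    exact h)

/-- The inclusion of a stage of the filtration into the next one. -/
abbrev hocolimStep (d : ℕ) : (hocolimFiltration M A hA d : SSet.{u}) ⟶
    (hocolimFiltration M A hA (d + 1) : SSet.{u}) :=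
  SSet.Subcomplex.homOfLE (hocolimFiltration_mono M A hA d.le_succ)

theorem sigma_jointly_surjective {ι : Type} (F : ι → SSet.{u}) {n : SimplexCategoryᵒᵖ}
    (a : (∐ F).obj n) : ∃ c x, (Limits.Sigma.ι F c).app n x = a :=
  Cofan.inj_jointly_surjective_of_isColimit
    (isColimitCofanMkObjOfIsColimit ((CategoryTheory.evaluation _ _).obj n) _ _
      (coproductIsCoproduct F)) a

theorem hocolimAttach_step (d : ℕ) :
    hocolimAttach M A hA d ≫ hocolimStep M A hA d =
      hocolimCellInclusion M A d ≫ hocolimChar M A hA d := by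
  apply Limits.Sigma.hom_ext
  intro c
  rw [← cancel_mono (SSet.Subcomplex.ι _)]
  simp
  rfl

theorem hocolimChar_app {d : ℕ} (c : NondegenerateChain J d) {n : SimplexCategoryᵒᵖ}
    (p : (M.obj (chainSource c.chain) ⊗ Δ[d] : SSet.{u}).obj n) :
    ((hocolimChar M A hA d).app n ((Limits.Sigma.ι (fun c : NondegenerateChain J d ↦
      M.obj (chainSource c.chain) ⊗ Δ[d]) c).app n p)).1 = (chainMap M c.chain).app n p := by
  have h : Limits.Sigma.ι (fun c : NondegenerateChain J d ↦ M.obj (chainSource c.chain) ⊗ Δ[d]) c ≫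
      hocolimChar M A hA d ≫ SSet.Subcomplex.ι _ = chainMap M c.chain := by
    simp
    rfl
  exact ConcreteCategory.congr_hom (NatTrans.congr_app h n) p

theorem hocolimCellInclusion_app {d : ℕ} (c : NondegenerateChain J d) {n : SimplexCategoryᵒᵖ}
    (p : (hocolimCell M A c : SSet.{u}).obj n) :
    (hocolimCellInclusion M A d).app n ((Limits.Sigma.ι (fun c : NondegenerateChain J d ↦
      (hocolimCell M A c : SSet.{u})) c).app n p) =
      (Limits.Sigma.ι (fun c : NondegenerateChain J d ↦ M.obj (chainSource c.chain) ⊗ Δ[d]) c).app n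
        p.1 := by
  have h : Limits.Sigma.ι (fun c : NondegenerateChain J d ↦ (hocolimCell M A c : SSet.{u})) c ≫
      hocolimCellInclusion M A d = (hocolimCell M A c).ι ≫
        Limits.Sigma.ι (fun c : NondegenerateChain J d ↦ M.obj (chainSource c.chain) ⊗ Δ[d]) c := by
    simp
  exact ConcreteCategory.congr_hom (NatTrans.congr_app h n) p

theorem hocolimAttach_app {d : ℕ} (c : NondegenerateChain J d) {n : SimplexCategoryᵒᵖ}
    (p : (hocolimCell M A c : SSet.{u}).obj n) :
    ((hocolimAttach M A hA d).app n ((Limits.Sigma.ι (fun c : NondegenerateChain J d ↦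
      (hocolimCell M A c : SSet.{u})) c).app n p)).1 = (chainMap M c.chain).app n p.1 := by
  have h : Limits.Sigma.ι (fun c : NondegenerateChain J d ↦ (hocolimCell M A c : SSet.{u})) c ≫
      hocolimAttach M A hA d ≫ SSet.Subcomplex.ι _ =
        (hocolimCell M A c).ι ≫ chainMap M c.chain := by
    simp
    rfl
  exact ConcreteCategory.congr_hom (NatTrans.congr_app h n) p

theorem isPullback_hocolimFiltration_app (d : ℕ) (n : SimplexCategoryᵒᵖ) :
    IsPullback ((hocolimAttach M A hA d).app n) ((hocolimCellInclusion M A d).app n)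
      ((hocolimStep M A hA d).app n) ((hocolimChar M A hA d).app n) := by
  rw [Types.isPullback_iff]
  refine ⟨NatTrans.congr_app (hocolimAttach_step M A hA d) n, fun x y ⟨_, h⟩ ↦ ?_, fun x y h ↦ ?_⟩
  · exact injective_of_mono ((hocolimCellInclusion M A d).app n) h
  · obtain ⟨c, p, rfl⟩ := sigma_jointly_surjective _ y
    have h1 : x.1 = (chainMap M c.chain).app n p :=
      (congrArg Subtype.val h).trans (hocolimChar_app M A hA c p)
    have hp := (chainMap_mem_iff M A hA c p).1 (h1 ▸ x.2)
    refine ⟨(Limits.Sigma.ι (fun c : NondegenerateChain J d ↦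
      (hocolimCell M A c : SSet.{u})) c).app n ⟨p, hp⟩, ?_, ?_⟩
    · exact Subtype.ext ((hocolimAttach_app M A hA c ⟨p, hp⟩).trans h1.symm)
    · exact hocolimCellInclusion_app M A c ⟨p, hp⟩

/-- Off the boundary, the underlying chain is a degeneracy of a nondegenerate one in a unique way,
and the transition map is injective because it is invertible. -/
theorem chainMap_injective {d : ℕ} {c c' : NondegenerateChain J d} {n : SimplexCategoryᵒᵖ}
    {p : (M.obj (chainSource c.chain) ⊗ Δ[d] : SSet.{u}).obj n}
    {p' : (M.obj (chainSource c'.chain) ⊗ Δ[d] : SSet.{u}).obj n}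
    (hp : p.2 ∉ (SSet.boundary d).obj n) (hp' : p'.2 ∉ (SSet.boundary d).obj n)
    (h : (chainMap M c.chain).app n p = (chainMap M c'.chain).app n p') :
    (⟨c, p⟩ : Σ c : NondegenerateChain J d, (M.obj (chainSource c.chain) ⊗ Δ[d] : SSet.{u}).obj n) =
      ⟨c', p'⟩ := by
  obtain ⟨x, β⟩ := p
  obtain ⟨x', β'⟩ := p'
  obtain ⟨θ, rfl⟩ := SSet.stdSimplex.objEquiv.symm.surjective β
  obtain ⟨θ', rfl⟩ := SSet.stdSimplex.objEquiv.symm.surjective β'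
  have hs : Function.Surjective θ.toOrderHom := not_not.1 hp
  have hs' : Function.Surjective θ'.toOrderHom := not_not.1 hp'
  have : Epi θ := SimplexCategory.epi_iff_surjective.2 hs
  have : Epi θ' := SimplexCategory.epi_iff_surjective.2 hs'
  have h1 : (nerve Jᵒᵖ).map θ.op (show (nerve Jᵒᵖ) _⦋d⦌ from c.chain) =
      (nerve Jᵒᵖ).map θ'.op (show (nerve Jᵒᵖ) _⦋d⦌ from c'.chain) := congrArg Sigma.fst h
  obtain rfl : c = c' := by
    ext1
    exact Subtype.ext_iff.mp ((nerve Jᵒᵖ).unique_nonDegenerate_simplex _ θ ⟨_, c.nonDegenerate⟩ rfl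
      θ' ⟨_, c'.nonDegenerate⟩ h1)
  obtain rfl : θ = θ' := (nerve Jᵒᵖ).unique_nonDegenerate_map _ θ ⟨_, c.nonDegenerate⟩ rfl
    θ' ⟨_, c.nonDegenerate⟩ h1
  have := isIso_chainTransition (s := ⦋d⦌) θ hs c.chain
  have h2 := map_app_injective_of_isIso M (chainTransition (s := ⦋d⦌) θ c.chain) n
    (eq_of_heq (Sigma.mk.inj_iff.1 h).2)
  exact congrArg (fun z ↦ (⟨c, (z, SSet.stdSimplex.objEquiv.symm θ)⟩ :
    Σ c : NondegenerateChain J d, (M.obj (chainSource c.chain) ⊗ Δ[d] : SSet.{u}).obj n)) h2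

/-- A pullback square of sets along an injection is a pushout once the two maps to the corner are
jointly surjective and the characteristic map is injective off the image of the boundary. -/
theorem isPushout_hocolimFiltration_app (d : ℕ) (n : SimplexCategoryᵒᵖ) :
    IsPushout ((hocolimAttach M A hA d).app n) ((hocolimCellInclusion M A d).app n)
      ((hocolimStep M A hA d).app n) ((hocolimChar M A hA d).app n) := by
  refine Types.isPushout_of_isPullback_of_mono' (isPullback_hocolimFiltration_app M A hA d n) ?_ ?_
  · refine Set.eq_univ_of_forall fun p ↦ ?_
    rcases hocolimFiltration_succ M A hA p.2 with h | ⟨c, q, hq⟩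
    · exact Or.inl ⟨⟨p.1, h⟩, rfl⟩
    · exact Or.inr ⟨_, Subtype.ext ((hocolimChar_app M A hA c q).trans hq)⟩
  · intro x y hx hy h
    obtain ⟨c, p, rfl⟩ := sigma_jointly_surjective _ x
    obtain ⟨c', p', rfl⟩ := sigma_jointly_surjective _ y
    have key : ∀ (c : NondegenerateChain J d)
        (p : (M.obj (chainSource c.chain) ⊗ Δ[d] : SSet.{u}).obj n),
        (Limits.Sigma.ι (fun c : NondegenerateChain J d ↦
          M.obj (chainSource c.chain) ⊗ Δ[d]) c).app n p ∉
            Set.range ((hocolimCellInclusion M A d).app n) → p.2 ∉ (SSet.boundary d).obj n :=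
      fun c p hp hb ↦ hp ⟨_, hocolimCellInclusion_app M A c
        ⟨p, (SSet.Subcomplex.mem_unionProd_iff _ _ p).2 (Or.inl hb)⟩⟩
    have h1 := (hocolimChar_app M A hA c p).symm.trans
      ((congrArg Subtype.val h).trans (hocolimChar_app M A hA c' p'))
    have h2 := chainMap_injective M (key c p hx) (key c' p' hy) h1
    exact congrArg (fun z : Σ c : NondegenerateChain J d,
      (M.obj (chainSource c.chain) ⊗ Δ[d] : SSet.{u}).obj n ↦
        (Limits.Sigma.ι (fun c : NondegenerateChain J d ↦
          M.obj (chainSource c.chain) ⊗ Δ[d]) z.1).app n z.2) h2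

theorem isPushout_hocolimFiltration (d : ℕ) :
    IsPushout (hocolimAttach M A hA d) (hocolimCellInclusion M A d) (hocolimStep M A hA d)
      (hocolimChar M A hA d) where
  w := hocolimAttach_step M A hA d
  isColimit' := ⟨evaluationJointlyReflectsColimits _ (fun n ↦ by
    refine (isColimitMapCoconePushoutCoconeEquiv _ _).2 (IsPushout.isColimit ?_)
    exact isPushout_hocolimFiltration_app M A hA d n)⟩

/-- The step is a pushout of a coproduct of pushout-products of `A j → M j` with `∂Δ[d] → Δ[d]`,
which are anodyne. -/
theorem anodyne_hocolimStep (h : ∀ j, SSet.anodyneExtensions (A j).ι) (d : ℕ) :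
    SSet.anodyneExtensions (hocolimStep M A hA d) := by
  refine MorphismProperty.of_isPushout (isPushout_hocolimFiltration M A hA d) ?_
  have : SSet.anodyneExtensions.{u}.IsStableUnderCoproductsOfShape (NondegenerateChain J d) :=
    MorphismProperty.llp_isStableUnderCoproductsOfShape _ _
  exact MorphismProperty.colimMap (W := SSet.anodyneExtensions) _ fun ⟨c⟩ ↦
    SSet.anodyneExtensions_unionProd_ι' _ _ (h (chainSource c.chain))

theorem anodyne_hocolimFiltration (h : ∀ j, SSet.anodyneExtensions (A j).ι) :
    SSet.anodyneExtensions (hocolimFiltration M A hA 0).ι := by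
  have hle : SSet.anodyneExtensions.{u}.transfiniteCompositionsOfShape ℕ ≤
      SSet.anodyneExtensions := by
    rw [SSet.anodyneExtensions_eq_llp_rlp]
    exact MorphismProperty.transfiniteCompositionsOfShape_le _ _
  exact hle _ ⟨{
    F := (hocolimFiltration_mono M A hA).functor ⋙ SSet.Subcomplex.toSSetFunctor
    isoBot := Iso.refl _
    incl := { app _ := SSet.Subcomplex.ι _ }
    isColimit := IsColimit.ofIsoColimit (isColimitOfPreserves (SSet.Subcomplex.toSSetFunctor)
        ((CompleteLattice.colimitCocone ((hocolimFiltration_mono M A hA).functor)).isColimit))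
        (Cocone.ext (SSet.Subcomplex.eqToIso (iSup_hocolimFiltration M A hA) ≪≫
          SSet.Subcomplex.topIso _))
    map_mem j _ := anodyne_hocolimStep M A hA h j }⟩

end HocolimAnodyne

end

section

open CategoryTheory Opposite Simplicial Topology MonoidalCategory Limits

/-! ### Lifting of homotopies defined on the boundary of a simplex. -/

section PathLifting

open scoped unitInterval

variable {A B : Type u} [TopologicalSpace A] [TopologicalSpace B]
variable {D : Type} [TopologicalSpace D] {S : Set D}

/-- A homotopy of the boundary into the image of `f` extends to a homotopy into the image of `f`. -/
theorem LiftsRel.exists_path_lift (hS : HasHEP D S) (h : HasHEP (I × D) (cylinderBoundary S))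
    {f : C(A, B)} (hf : LiftsRel D S f) (a : C(S, A)) (b : C(D, B)) (k : C(I × S, B))
    (h0 : ∀ x : S, k (0, x) = b x) (h1 : ∀ x, k (1, x) = f (a x)) :
    ∃ (a' : C(D, A)) (W : C(I × D, B)), (∀ x, W (0, x) = b x) ∧ (∀ x, W (1, x) = f (a' x)) ∧
      ∀ t (x : S), W (t, x) = k (t, x) := by
  obtain ⟨H, H0, H1⟩ := hS.extend b k h0
  obtain ⟨a', ha', ⟨K⟩⟩ := hf a (homotopyAt H 1) (fun x ↦ by simp [H1, h1])
  -- Concatenating `H` and `K` would reparametrize the prescribed homotopy over `S`. Instead the end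
  -- of `H` is deformed by `K` with `H` held fixed on the rest of the boundary of `I × D`, and
  -- homotopy extension for the cylinder yields a homotopy that is still `k` over `S`.
  let P : C(I × D, B) := ⟨fun p ↦ K (σ p.1, p.2), by fun_prop⟩
  let R : C(I × (I × D), B) := ⟨fun p ↦ H (σ p.2.1, p.2.2), by fun_prop⟩
  obtain ⟨l, l0, l1⟩ := exists_glue_face hS.isClosed P R (fun s x hx ↦ by
    simp only [P, R, ContinuousMap.coe_mk, unitInterval.symm_zero]
    exact K.eq_snd _ hx)
  obtain ⟨G, G0, G1⟩ := h.extend ⟨fun p ↦ H (σ p.1, p.2), by fun_prop⟩ l (fun p ↦ by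
    obtain ⟨⟨t, x⟩, hp⟩ := p
    by_cases ht : t = 0
    · subst ht
      rw [l0 0 ⟨(0, x), hp⟩ rfl]
      simp [P]
    · rw [l1 0 ⟨(t, x), hp⟩ (hp.elim (fun h' ↦ Or.inl (h'.resolve_left ht)) Or.inr)]
      rfl)
  refine ⟨a', ⟨fun p ↦ G (1, (σ p.1, p.2)), by fun_prop⟩, fun x ↦ ?_, fun x ↦ ?_, fun t x ↦ ?_⟩
  · have h2 : ((1 : I), x) ∈ cylinderBoundary S := Or.inl (Or.inr rfl)
    simp only [ContinuousMap.coe_mk, unitInterval.symm_zero]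
    rw [G1 1 ⟨_, h2⟩, l1 _ _ (Or.inl rfl)]
    simp [R, H0]
  · have h2 : ((0 : I), x) ∈ cylinderBoundary S := Or.inl (Or.inl rfl)
    simp only [ContinuousMap.coe_mk, unitInterval.symm_one]
    rw [G1 1 ⟨_, h2⟩, l0 _ _ rfl]
    simp [P]
  · have h2 : (σ t, (x : D)) ∈ cylinderBoundary S := Or.inr x.2
    simp only [ContinuousMap.coe_mk]
    rw [G1 1 ⟨_, h2⟩, l1 _ _ (Or.inr x.2)]
    simp [R, H1]

/-- The boundary of a simplex. -/
def simplexBoundary (n : ℕ) : Set (stdSimplex ℝ (Fin (n + 1))) := Set.ofPred fun t ↦ ∃ j, t j = 0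

theorem hasHEP_simplexBoundary (n : ℕ) : HasHEP _ (simplexBoundary n) := by
  obtain ⟨e, he⟩ := exists_stdSimplex_homeomorph_cube n
  exact (HasHEP.cube n).congr e he

theorem hasHEP_cylinder_simplexBoundary (n : ℕ) :
    HasHEP (I × _) (cylinderBoundary (simplexBoundary n)) := by
  obtain ⟨e, he⟩ := exists_stdSimplex_homeomorph_cube n
  refine (HasHEP.cylinder_cube n).congr ((Homeomorph.refl I).prodCongr e) fun x ↦ ?_
  exact or_congr_right (he x.2)

theorem CompressesUpTo.liftsRel_simplexBoundary {N : ℕ} {f : C(A, B)} (hf : CompressesUpTo N f)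
    {n : ℕ} (hn : n ≤ N) : LiftsRel _ (simplexBoundary n) f := by
  obtain ⟨e, he⟩ := exists_stdSimplex_homeomorph_cube n
  exact (hf n hn).congr e he

theorem map_mem_simplexBoundary {m n : ℕ} (θ : ⦋m⦌ ⟶ ⦋n⦌)
    (hθ : ¬ Function.Surjective θ.toOrderHom) (t : stdSimplex ℝ (Fin (m + 1))) :
    stdSimplex.map θ.toOrderHom t ∈ simplexBoundary n := by
  obtain ⟨j, hj⟩ := not_forall.1 hθ
  refine ⟨j, ?_⟩
  by_contra hc
  obtain ⟨x, hx, -⟩ := (stdSimplex_map_ne_zero_iff _ _ _).1 hc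
  exact hj ⟨x, hx⟩

/-- The map from a simplex to the boundary of another one induced by a nonsurjective operator. -/
noncomputable def boundaryFace {m n : ℕ} (θ : ⦋m⦌ ⟶ ⦋n⦌) (hθ : ¬ Function.Surjective θ.toOrderHom) :
    C(stdSimplex ℝ (Fin (m + 1)), simplexBoundary n) :=
  ⟨fun t ↦ ⟨stdSimplex.map θ.toOrderHom t, map_mem_simplexBoundary θ hθ t⟩,
    (stdSimplex.continuous_map _).subtype_mk _⟩

theorem boundaryFace_comp {l m n : ℕ} (φ : ⦋l⦌ ⟶ ⦋m⦌) (θ : ⦋m⦌ ⟶ ⦋n⦌) (θ' : ⦋l⦌ ⟶ ⦋n⦌)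
    (h : θ' = φ ≫ θ) (hθ : ¬ Function.Surjective θ.toOrderHom)
    (hθ' : ¬ Function.Surjective θ'.toOrderHom) (t : stdSimplex ℝ (Fin (l + 1))) :
    boundaryFace θ' hθ' t = boundaryFace θ hθ (stdSimplex.map φ.toOrderHom t) := by
  subst h
  apply Subtype.ext
  change stdSimplex.map (θ.toOrderHom ∘ φ.toOrderHom) t = _
  exact (stdSimplex.map_comp_apply φ.toOrderHom θ.toOrderHom t).symm

end PathLifting

/-! ### Simplices whose low-dimensional faces lift form an anodyne subcomplex. -/

section Deformation

/-- A subcomplex onto which the simplicial set deforms is an anodyne extension. -/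
theorem anodyne_of_deformation {X : SSet.{u}} (A : X.Subcomplex) (h : X ⊗ Δ[1] ⟶ X)
    (h0 : SSet.ι₀ ≫ h = 𝟙 X)
    (h1 : ∀ n p, p ∈ (A.unionProd (SSet.horn 1 1)).obj n → h.app n p ∈ A.obj n) :
    SSet.anodyneExtensions A.ι := by
  -- `U` is `A × Δ[1] ∪ X × {1}`. The end `0` embeds `A → X` into `U → X × Δ[1]`, and `h` retracts
  -- it back.
  let U := A.unionProd (SSet.horn.{u} 1 1)
  let i : (A : SSet.{u}) ⟶ (U : SSet.{u}) := SSet.Subcomplex.lift (A.ι ≫ SSet.ι₀) (by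
    rintro n _ ⟨x, rfl⟩
    exact (SSet.Subcomplex.mem_unionProd_iff _ _ _).2 (Or.inr x.2))
  let r : (U : SSet.{u}) ⟶ (A : SSet.{u}) := SSet.Subcomplex.lift (U.ι ≫ h) (by
    rintro n _ ⟨x, rfl⟩
    exact h1 n x.1 x.2)
  have hi : i ≫ U.ι = A.ι ≫ SSet.ι₀ := rfl
  have hr : r ≫ A.ι = U.ι ≫ h := rfl
  let R : RetractArrow A.ι U.ι :=
    { i := Arrow.homMk i SSet.ι₀ hi
      r := Arrow.homMk r h hr
      retract := by
        ext1
        · change i ≫ r = 𝟙 _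
          rw [← cancel_mono A.ι, Category.assoc, hr, ← Category.assoc, hi, Category.assoc, h0]
          rfl
        · exact h0 }
  have : SSet.anodyneExtensions.{u}.IsStableUnderRetracts :=
    MorphismProperty.llp_isStableUnderRetracts _
  exact MorphismProperty.of_retract R
    (SSet.anodyneExtensions_unionProd_ι _ _ (SSet.anodyneExtensions.horn_ι 1))

open scoped unitInterval

variable {E : TopCat.{u}}

/-- The simplex of the singular simplicial set given by a continuous map. -/
noncomputable def singularSimplex {n : ℕ} (f : C(stdSimplex ℝ (Fin (n + 1)), E)) :
    (TopCat.toSSet.obj E) _⦋n⦌ := (TopCat.toSSetObjEquiv E (op ⦋n⦌)).symm f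

/-- The evaluation of paths. -/
def pathEval (E : TopCat.{u}) (t : I) : TopCat.of C(I, E) ⟶ E :=
  TopCat.ofHom ⟨fun γ ↦ γ t, by fun_prop⟩

/-- The constant paths. -/
def pathConst (E : TopCat.{u}) : E ⟶ TopCat.of C(I, E) :=
  TopCat.ofHom ⟨fun e ↦ ContinuousMap.const I e, ContinuousMap.continuous_const'⟩

/-- The singular simplices of the path space whose end is in a subcomplex. -/
noncomputable abbrev pathsEndingIn (A : (TopCat.toSSet.obj E).Subcomplex) :
    (TopCat.toSSet.obj (TopCat.of C(I, E))).Subcomplex :=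
  A.preimage (TopCat.toSSet.map (pathEval E 1))

/-- The property that homotopies of boundaries of simplices into `A` extend to homotopies of
simplices into `A`. -/
def HasPathLifting (A : (TopCat.toSSet.obj E).Subcomplex) : Prop :=
  ∀ (i : ℕ) (b : C(stdSimplex ℝ (Fin (i + 1)), E)) (k : C(I × simplexBoundary i, E)),
    (∀ x : simplexBoundary i, k (0, x) = b x) →
    (∀ (n : ℕ) (θ : ⦋n⦌ ⟶ ⦋i⦌) (hθ : ¬ Function.Surjective θ.toOrderHom),
      singularSimplex ⟨fun t ↦ k (1, boundaryFace θ hθ t), by fun_prop⟩ ∈ A.obj (op ⦋n⦌)) →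
    ∃ W : C(I × stdSimplex ℝ (Fin (i + 1)), E), (∀ x, W (0, x) = b x) ∧
      (∀ t (x : simplexBoundary i), W (t, x) = k (t, x)) ∧
      singularSimplex ⟨fun x ↦ W (1, x), by fun_prop⟩ ∈ A.obj (op ⦋i⦌)

/-- A lifting problem against `∂Δ[i] → Δ[i]` is a simplex of `E` with a family of paths over its
boundary that end in `A`; `HasPathLifting` extends the family. -/
theorem HasPathLifting.rlp {A : (TopCat.toSSet.obj E).Subcomplex} (hA : HasPathLifting A) :
    (MorphismProperty.monomorphisms SSet.{u}).rlp
      ((pathsEndingIn A).ι ≫ TopCat.toSSet.map (pathEval E 0)) := by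
  rw [SSet.rlp_monomorphisms]
  rintro _ _ _ ⟨i⟩
  refine ⟨fun {u v} sq ↦ ?_⟩
  let κ := realizationDesc (u ≫ (pathsEndingIn A).ι)
  let φ : C(simplexBoundary i, |(∂Δ[i] : SSet.{u})|) :=
    (boundaryCoordinates i).lift ⟨Subtype.val, by fun_prop⟩ (fun x ↦ by
      rw [range_boundaryCoordinates]; exact x.2)
  have hφ : ∀ {n : ℕ} (x : (∂Δ[i] : SSet.{u}) _⦋n⦌) (t) (ht),
      φ ⟨stdSimplex.map (SSet.stdSimplex.asOrderHom x.1) t, ht⟩ = cellMap x t := fun x t ht ↦ by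
    apply (boundaryCoordinates i).coordinates_injective
    rw [VertexEmbedding.coordinates_lift, VertexEmbedding.coordinates_cellMap]
    rfl
  have hm : ∀ {n : ℕ} (x : (∂Δ[i] : SSet.{u}) _⦋n⦌) (t),
      stdSimplex.map (SSet.stdSimplex.asOrderHom x.1) t ∈ simplexBoundary i := fun x t ↦
    map_mem_simplexBoundary (SSet.stdSimplex.objEquiv x.1) x.2 t
  have hκ : ∀ {n : ℕ} (x : (∂Δ[i] : SSet.{u}) _⦋n⦌) (t),
      κ (cellMap x t) = TopCat.toSSetObjEquiv _ _ (u.app _ x).1 t := fun x t ↦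
    realizationDesc_cellMap _ x t
  let b := TopCat.toSSetObjEquiv _ _ (SSet.yonedaEquiv v)
  let k : C(I × simplexBoundary i, E) := ⟨fun p ↦ κ (φ p.2) p.1, by fun_prop⟩
  have hv : ∀ {n : ℕ} (x : (∂Δ[i] : SSet.{u}) _⦋n⦌) (t),
      b (stdSimplex.map (SSet.stdSimplex.asOrderHom x.1) t) =
        TopCat.toSSetObjEquiv _ _ (u.app _ x).1 t 0 := fun x t ↦ by
    have h1 := ConcreteCategory.congr_hom (NatTrans.congr_app sq.w _) x
    have h2 := congrArg (fun z ↦ TopCat.toSSetObjEquiv E _ z t) h1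
    refine Eq.trans ?_ h2.symm
    have h3 := stdSimplex_hom_app v x.1
    exact congrArg (fun z ↦ TopCat.toSSetObjEquiv E _ z t) h3.symm
  have hex : ∀ x : simplexBoundary i, ∃ (n : ℕ) (y : (∂Δ[i] : SSet.{u}) _⦋n⦌) (t : _),
      x = ⟨stdSimplex.map (SSet.stdSimplex.asOrderHom y.1) t, hm y t⟩ := fun x ↦ by
    obtain ⟨n, y, t, hy⟩ := exists_cellMap_eq (φ x)
    refine ⟨n, y, t, Subtype.ext ?_⟩
    have h1 := congrArg (boundaryCoordinates i).coordinates hy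
    rw [VertexEmbedding.coordinates_lift, VertexEmbedding.coordinates_cellMap] at h1
    exact h1.symm
  obtain ⟨W, W0, W1, W2⟩ := hA i b k (fun x ↦ by
    obtain ⟨n, y, t, rfl⟩ := hex x
    change κ (φ _) 0 = b _
    rw [hφ, hκ, hv]) (fun n θ hθ ↦ by
    let y : (∂Δ[i] : SSet.{u}) _⦋n⦌ := ⟨stdSimplexMk θ, hθ⟩
    have h2 : (TopCat.toSSet.map (pathEval E 1)).app _ (u.app _ y).1 =
        singularSimplex ⟨fun t ↦ k (1, boundaryFace θ hθ t), by fun_prop⟩ := by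
      apply (TopCat.toSSetObjEquiv E _).injective
      ext t
      change TopCat.toSSetObjEquiv _ _ (u.app _ y).1 t 1 = κ (φ (boundaryFace θ hθ t)) 1
      refine (congrArg (fun γ ↦ γ 1) (hκ y t)).symm.trans ?_
      exact congrArg (fun z ↦ κ z 1) (hφ y t (hm y t)).symm
    exact h2 ▸ (u.app _ y).2)
  let w : (pathsEndingIn A : SSet.{u}) _⦋i⦌ :=
    ⟨singularSimplex (E := TopCat.of C(I, E)) ⟨fun x ↦ ⟨fun t ↦ W (t, x), by fun_prop⟩,
      (W.comp ⟨fun p : _ × I ↦ (p.2, p.1), by fun_prop⟩).curry.continuous⟩, W2⟩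
  refine ⟨⟨⟨SSet.yonedaEquiv.symm w, ?_, ?_⟩⟩⟩
  · ext n x
    induction n using Opposite.rec with | _ n => ?_
    induction n using SimplexCategory.rec with | _ n => ?_
    apply Subtype.ext
    apply (TopCat.toSSetObjEquiv _ _).injective
    ext t s
    change W (s, stdSimplex.map (SSet.stdSimplex.asOrderHom x.1) t) = _
    refine (W1 s ⟨_, hm x t⟩).trans ?_
    change κ (φ _) s = _
    rw [hφ, hκ]
    rfl
  · apply SSet.yonedaEquiv.injective
    apply (TopCat.toSSetObjEquiv E _).injective
    ext x
    refine Eq.trans ?_ (W0 x)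
    exact congrArg (fun z : (pathsEndingIn A : SSet.{u}) _⦋i⦌ ↦
      TopCat.toSSetObjEquiv (TopCat.of C(I, E)) (op ⦋i⦌) z.1 x 0)
        (SSet.yonedaEquiv.apply_symm_apply w)

theorem stdSimplex_map_of_const {X Y : Type*} [Fintype X] [Fintype Y] [DecidableEq Y] (β : X → Y)
    {i : Y} (h : ∀ x, β x = i) (t : stdSimplex ℝ X) :
    stdSimplex.map β t = stdSimplex.vertex i := by
  ext j
  rw [stdSimplex_map_apply, stdSimplex.vertex_coe]
  by_cases hj : i = j
  · subst hj
    simp [h]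
  · simp [h, hj, Ne.symm hj]

/-- The evaluation of a family of paths over a simplex at times given by a map to `Δ¹`. -/
noncomputable def evalPaths {n : ℕ} (γ : C(stdSimplex ℝ (Fin (n + 1)), C(I, E)))
    (β : Fin (n + 1) →o Fin 2) : C(stdSimplex ℝ (Fin (n + 1)), E) :=
  ⟨fun t ↦ γ t (stdSimplexHomeomorphUnitInterval (stdSimplex.map β t)),
    ContinuousEval.continuous_eval.comp (γ.continuous.prodMk
      (stdSimplexHomeomorphUnitInterval.continuous.comp (stdSimplex.continuous_map _)))⟩

theorem evalPaths_map {m n : ℕ} (θ : ⦋m⦌ ⟶ ⦋n⦌) (γ : C(stdSimplex ℝ (Fin (n + 1)), C(I, E)))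
    (γ' : C(stdSimplex ℝ (Fin (m + 1)), C(I, E))) (β : Fin (n + 1) →o Fin 2)
    (h : ∀ t, γ' t = γ (stdSimplex.map θ.toOrderHom t)) (t) :
    evalPaths γ' (β.comp θ.toOrderHom) t = evalPaths γ β (stdSimplex.map θ.toOrderHom t) := by
  simp only [evalPaths, ContinuousMap.coe_mk]
  rw [stdSimplex.map_comp_apply, h]
  rfl

/-- The simplicial homotopy given by a map to the singular simplicial set of the path space. -/
noncomputable def pathHomotopy {X : SSet.{u}} (s : X ⟶ TopCat.toSSet.obj (TopCat.of C(I, E))) :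
    X ⊗ Δ[1] ⟶ TopCat.toSSet.obj E :=
  toSingular (fun n p ↦ evalPaths (TopCat.toSSetObjEquiv (TopCat.of C(I, E)) n (s.app n p.1))
    (SSet.stdSimplex.asOrderHom p.2)) (fun {_ m} f p t ↦
      evalPaths_map f.unop _ _ (SSet.stdSimplex.asOrderHom p.2) (fun t ↦ congrArg (fun z ↦
        (TopCat.toSSetObjEquiv (TopCat.of C(I, E)) m z t : C(I, E)))
          (ConcreteCategory.congr_hom (s.naturality f) p.1)) t)

theorem pathHomotopy_app_const {X : SSet.{u}} (s : X ⟶ TopCat.toSSet.obj (TopCat.of C(I, E)))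
    {n : SimplexCategoryᵒᵖ} (p : (X ⊗ Δ[1] : SSet.{u}).obj n) (i : Fin 2)
    (hp : ∀ j, SSet.stdSimplex.asOrderHom p.2 j = i) :
    (pathHomotopy s).app n p = (TopCat.toSSet.map (pathEval E
      (stdSimplexHomeomorphUnitInterval (stdSimplex.vertex i)))).app n (s.app n p.1) := by
  apply (TopCat.toSSetObjEquiv _ _).injective
  ext t
  exact congrArg (fun z ↦ (TopCat.toSSetObjEquiv (TopCat.of C(I, E)) n (s.app n p.1) t :
    C(I, E)) (stdSimplexHomeomorphUnitInterval z)) (stdSimplex_map_of_const _ hp t)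

/-- Lifting the identity gives `s`, which assigns to each simplex a family of paths ending in `A`,
constant if the simplex is in `A`. Running along these paths deforms the singular set into `A`,
relative to `A`. -/
theorem HasPathLifting.anodyne {A : (TopCat.toSSet.obj E).Subcomplex} (hA : HasPathLifting A) :
    SSet.anodyneExtensions A.ι := by
  let c : (A : SSet.{u}) ⟶ (pathsEndingIn A : SSet.{u}) :=
    SSet.Subcomplex.lift (A.ι ≫ TopCat.toSSet.map (pathConst E)) (by
      rintro n _ ⟨x, rfl⟩
      exact x.2)
  have := hA.rlp A.ι inferInstance
  have sq : CommSq c A.ι ((pathsEndingIn A).ι ≫ TopCat.toSSet.map (pathEval E 0)) (𝟙 _) := ⟨rfl⟩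
  let s := sq.lift ≫ (pathsEndingIn A).ι
  have hs0 : s ≫ TopCat.toSSet.map (pathEval E 0) = 𝟙 _ := sq.fac_right
  have hs : A.ι ≫ s = A.ι ≫ TopCat.toSSet.map (pathConst E) := by
    rw [← Category.assoc, sq.fac_left]
    rfl
  have e0 : stdSimplexHomeomorphUnitInterval (stdSimplex.vertex (0 : Fin 2)) = 0 :=
    stdSimplexHomeomorphUnitInterval_zero
  have e1 : stdSimplexHomeomorphUnitInterval (stdSimplex.vertex (1 : Fin 2)) = 1 :=
    stdSimplexHomeomorphUnitInterval_one
  refine anodyne_of_deformation A (pathHomotopy s) ?_ fun n p hp ↦ ?_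
  · ext n x
    refine (pathHomotopy_app_const s _ 0 fun j ↦ rfl).trans ?_
    rw [e0]
    exact ConcreteCategory.congr_hom (NatTrans.congr_app hs0 n) x
  · rcases (SSet.Subcomplex.mem_unionProd_iff _ _ _).1 hp with h | h
    · rw [pathHomotopy_app_const s p 1 fun j ↦ ?_, e1]
      · exact (sq.lift.app n p.1).2
      · by_contra hj
        have hj0 : SSet.stdSimplex.asOrderHom p.2 j = 0 := by
          revert hj
          generalize SSet.stdSimplex.asOrderHom p.2 j = k
          revert k
          decide
        refine h (Set.eq_univ_of_forall fun k ↦ ?_)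
        by_cases hk : k = 1
        · exact Or.inr hk
        · refine Or.inl ⟨j, hj0.trans ?_⟩
          revert hk k
          decide
    · have h1 : s.app n p.1 = (TopCat.toSSet.map (pathConst E)).app n p.1 :=
        ConcreteCategory.congr_hom (NatTrans.congr_app hs n) ⟨p.1, h⟩
      have h2 : (pathHomotopy s).app n p = p.1 := by
        apply (TopCat.toSSetObjEquiv _ _).injective
        ext t
        exact congrArg (fun z ↦ (TopCat.toSSetObjEquiv (TopCat.of C(I, E)) n z t :
          C(I, E)) (stdSimplexHomeomorphUnitInterval
            (stdSimplex.map (SSet.stdSimplex.asOrderHom p.2) t))) h1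
      rw [h2]
      exact h

variable {F : TopCat.{u}}

/-- The singular simplices whose faces of dimension at most `N` lift along `f`. -/
noncomputable def liftedFaces (N : ℕ) (f : F ⟶ E) : (TopCat.toSSet.obj E).Subcomplex where
  obj n := Set.ofPred fun x ↦ ∀ (k : ℕ) (_ : k ≤ N) (θ : n ⟶ op ⦋k⦌),
    (TopCat.toSSet.obj E).map θ x ∈ Set.range ((TopCat.toSSet.map f).app (op ⦋k⦌))
  map {n m} φ x hx k hk θ := by
    have := hx k hk (φ ≫ θ)
    rwa [Functor.map_comp] at this

theorem range_le_liftedFaces (N : ℕ) (f : F ⟶ E) :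
    SSet.Subcomplex.range (TopCat.toSSet.map f) ≤ liftedFaces N f := by
  rintro n _ ⟨x, rfl⟩ k hk θ
  exact ⟨_, ConcreteCategory.congr_hom ((TopCat.toSSet.map f).naturality θ) x⟩

theorem mem_range_of_mem_liftedFaces {N : ℕ} {f : F ⟶ E} {n : ℕ} (hn : n ≤ N)
    {x : (TopCat.toSSet.obj E) _⦋n⦌} (hx : x ∈ (liftedFaces N f).obj _) :
    x ∈ Set.range ((TopCat.toSSet.map f).app (op ⦋n⦌)) := by
  have := hx n hn (𝟙 _)
  rwa [CategoryTheory.Functor.map_id] at this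

theorem liftedFaces_le_preimage (N : ℕ) {F' E' : TopCat.{u}} {f : F ⟶ E} {f' : F' ⟶ E'}
    (a : F ⟶ F') (b : E ⟶ E') (h : f ≫ b = a ≫ f') :
    liftedFaces N f ≤ (liftedFaces N f').preimage (TopCat.toSSet.map b) := by
  intro n x hx k hk θ
  obtain ⟨y, hy⟩ := hx k hk θ
  refine ⟨(TopCat.toSSet.map a).app _ y, ?_⟩
  have h1 := congrArg TopCat.toSSet.map h
  rw [Functor.map_comp, Functor.map_comp] at h1
  have h2 := ConcreteCategory.congr_hom (NatTrans.congr_app h1 (op ⦋k⦌)) y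
  refine h2.symm.trans ?_
  refine (congrArg ((TopCat.toSSet.map b).app _) hy).trans ?_
  exact ConcreteCategory.congr_hom ((TopCat.toSSet.map b).naturality θ) x

theorem toSSet_map_injective {f : F ⟶ E} (hf : Function.Injective f) (n : SimplexCategoryᵒᵖ) :
    Function.Injective ((TopCat.toSSet.map f).app n) := by
  intro x y h
  apply (TopCat.toSSetObjEquiv _ _).injective
  ext t
  exact hf (congrArg (fun z ↦ TopCat.toSSetObjEquiv _ _ z t) h)

/-- Lifts along an injective map are unique, so lifts chosen separately on the faces are compatible.
-/
theorem exists_boundary_lift {f : F ⟶ E} (hf : Function.Injective f) {i : ℕ}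
    (k : C(I × simplexBoundary i, E))
    (g : ∀ (n : ℕ) (θ : ⦋n⦌ ⟶ ⦋i⦌) (_ : ¬ Function.Surjective θ.toOrderHom),
      C(stdSimplex ℝ (Fin (n + 1)), F))
    (hg : ∀ (n : ℕ) (θ : ⦋n⦌ ⟶ ⦋i⦌) (hθ : ¬ Function.Surjective θ.toOrderHom) (t),
      f (g n θ hθ t) = k (1, boundaryFace θ hθ t)) :
    ∃ G : (∂Δ[i] : SSet.{u}) ⟶ TopCat.toSSet.obj F, ∀ (n : ℕ) (y : (∂Δ[i] : SSet.{u}) _⦋n⦌) (t),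
      f (TopCat.toSSetObjEquiv _ _ (G.app _ y) t) =
        k (1, boundaryFace (SSet.stdSimplex.objEquiv y.1) y.2 t) := by
  let c (n : SimplexCategoryᵒᵖ) (x : (∂Δ[i] : SSet.{u}).obj n) :
      C(stdSimplex ℝ (Fin (n.unop.len + 1)), F) :=
    g n.unop.len (SSet.stdSimplex.objEquiv x.1) x.2
  have hc : ∀ (n : SimplexCategoryᵒᵖ) (x : (∂Δ[i] : SSet.{u}).obj n) (t),
      f (c n x t) = k (1, boundaryFace (m := n.unop.len) (SSet.stdSimplex.objEquiv x.1) x.2 t) :=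
    fun n x t ↦ hg n.unop.len (SSet.stdSimplex.objEquiv x.1) x.2 t
  have hn : ∀ {n m : SimplexCategoryᵒᵖ} (φ : n ⟶ m) (x : (∂Δ[i] : SSet.{u}).obj n) (t),
      c m ((∂Δ[i] : SSet.{u}).map φ x) t = c n x (stdSimplex.map φ.unop.toOrderHom t) := by
    intro n m φ x t
    apply hf
    rw [hc, hc]
    have e : SSet.stdSimplex.objEquiv ((∂Δ[i] : SSet.{u}).map φ x).1 =
        φ.unop ≫ SSet.stdSimplex.objEquiv x.1 := rfl
    exact congrArg (fun z ↦ k (1, z)) (boundaryFace_comp _ _ _ e _ _ t)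
  refine ⟨toSingular c hn, fun n y t ↦ ?_⟩
  rw [toSingular_app]
  exact hc (op ⦋n⦌) y t

/-- For `i ≤ N` the end of the homotopy lifts over the whole boundary and compression applies. For
`i > N` any extension of the homotopy will do: operators from dimension at most `N` to `⦋i⦌` are not
surjective, so the faces to be lifted lie in the boundary. -/
theorem hasPathLifting_liftedFaces {N : ℕ} {f : F ⟶ E} (hf : Function.Injective f)
    (hN : CompressesUpTo N f.hom) : HasPathLifting (liftedFaces N f) := by
  intro i b k h0 h1
  by_cases hi : i ≤ N
  · have h2 : ∀ (n : ℕ) (θ : ⦋n⦌ ⟶ ⦋i⦌) (hθ : ¬ Function.Surjective θ.toOrderHom),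
        ∃ g : C(stdSimplex ℝ (Fin (n + 1)), F), ∀ t, f (g t) = k (1, boundaryFace θ hθ t) := by
      intro n θ hθ
      rcases i with _ | i
      · exact absurd (fun b ↦ ⟨0, Subsingleton.elim (α := Fin 1) _ _⟩) hθ
      obtain ⟨j, θ', rfl⟩ := SimplexCategory.eq_comp_δ_of_not_surjective θ hθ
      have hj : ¬ Function.Surjective (SimplexCategory.δ j).toOrderHom := fun h ↦ by
        obtain ⟨l, hl⟩ := h j
        exact Fin.succAbove_ne j l hl
      obtain ⟨y, hy⟩ := mem_range_of_mem_liftedFaces (by omega) (h1 i (SimplexCategory.δ j) hj)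
      refine ⟨(TopCat.toSSetObjEquiv _ _ y).comp
        ⟨stdSimplex.map θ'.toOrderHom, stdSimplex.continuous_map _⟩, fun t ↦ ?_⟩
      refine (congrArg (fun z ↦ TopCat.toSSetObjEquiv _ _ z (stdSimplex.map θ'.toOrderHom t))
        hy).trans ?_
      refine congrArg (fun z ↦ k (1, z)) (Subtype.ext ?_)
      exact (stdSimplex.map_comp_apply _ _ _)
    choose g hg using h2
    obtain ⟨G, hG⟩ := exists_boundary_lift hf k g hg
    let φ : C(simplexBoundary i, |(∂Δ[i] : SSet.{u})|) :=
      (boundaryCoordinates i).lift ⟨Subtype.val, by fun_prop⟩ (fun x ↦ by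
        rw [range_boundaryCoordinates]; exact x.2)
    obtain ⟨a', W, W0, W1, W2⟩ := (hN.liftsRel_simplexBoundary hi).exists_path_lift
      (hasHEP_simplexBoundary i) (hasHEP_cylinder_simplexBoundary i)
      ((realizationDesc G).comp φ) b k h0 (fun x ↦ by
        obtain ⟨n, y, t, hy⟩ := exists_cellMap_eq (φ x)
        have h3 := congrArg (boundaryCoordinates i).coordinates hy
        rw [VertexEmbedding.coordinates_lift, VertexEmbedding.coordinates_cellMap] at h3
        rw [ContinuousMap.comp_apply, ← hy, realizationDesc_cellMap]
        refine Eq.trans ?_ (hG n y t).symm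
        exact congrArg (fun z ↦ k (1, z)) (Subtype.ext h3.symm))
    refine ⟨W, W0, W2, range_le_liftedFaces N f _ ⟨singularSimplex a', ?_⟩⟩
    apply (TopCat.toSSetObjEquiv _ _).injective
    ext x
    exact (W1 x).symm
  · obtain ⟨W, W0, W1⟩ := (hasHEP_simplexBoundary i).extend b k h0
    refine ⟨W, W0, W1, fun n hn θ ↦ ?_⟩
    have hθ : ¬ Function.Surjective θ.unop.toOrderHom := fun h ↦ by
      have := Fintype.card_le_of_surjective _ h
      simp at this
      omega
    have h3 := mem_range_of_mem_liftedFaces hn (h1 n θ.unop hθ)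
    convert h3 using 1
    apply (TopCat.toSSetObjEquiv _ _).injective
    ext x
    exact W1 1 (boundaryFace θ.unop hθ x)

/-- The singular simplices whose faces of dimension at most `N` lift along an injective map which
is `N`-connected form an anodyne subcomplex. -/
theorem anodyne_liftedFaces {N : ℕ} {f : F ⟶ E} (hf : Function.Injective f)
    (hN : CompressesUpTo N f.hom) : SSet.anodyneExtensions (liftedFaces N f).ι :=
  (hasPathLifting_liftedFaces hf hN).anodyne

end Deformation

end

section

open CategoryTheory Opposite Simplicial Topology MonoidalCategory Limits

/-! ### Homotopy colimits preserve connectivity. -/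

section HocolimConnectivity

open scoped unitInterval

variable {J : Type} [SmallCategory J]

/-- Homotopy colimits preserve the connectivity of injective maps. -/
theorem CompressesUpTo.hocolimMap_of_injective {D D' : J ⥤ TopCat.{u}} (g : D ⟶ D') {N : ℕ}
    (hi : ∀ j, Function.Injective (g.app j)) (hg : ∀ j, CompressesUpTo N (g.app j).hom) :
    CompressesUpTo N (SSet.toTop.map (hocolimMap (Functor.whiskerRight g TopCat.toSSet))).hom := by
  let M := D' ⋙ TopCat.toSSet
  let A (j : J) : (M.obj j).Subcomplex := liftedFaces N (g.app j)
  have hA : ∀ {i j : J} (f : i ⟶ j), A i ≤ (A j).preimage (M.map f) := fun {i j} f ↦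
    liftedFaces_le_preimage N (D.map f) (D'.map f) (g.naturality f).symm
  let e : hocolim (D ⋙ TopCat.toSSet) ⟶ (hocolimFiltration M A hA 0 : SSet.{u}) :=
    SSet.Subcomplex.lift (hocolimMap (Functor.whiskerRight g TopCat.toSSet)) (by
      rintro n _ ⟨p, rfl⟩
      obtain ⟨c, x, rfl⟩ := hocolimMk_surjective p
      exact Or.inl (range_le_liftedFaces N _ _ ⟨x, rfl⟩))
  have he : e ≫ SSet.Subcomplex.ι _ = hocolimMap (Functor.whiskerRight g TopCat.toSSet) := rfl
  have hinj : ∀ n, Function.Injective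
      ((hocolimMap (Functor.whiskerRight g TopCat.toSSet)).app n) := by
    rintro n ⟨c, x⟩ ⟨c', y⟩ h
    obtain rfl : c = c' := congrArg Sigma.fst h
    exact congrArg (hocolimMk c) (toSSet_map_injective (hi _) n (eq_of_heq (Sigma.mk.inj_iff.1 h).2))
  have : Mono e := by
    have : ∀ n, Mono (e.app n) := fun n ↦ (mono_iff_injective _).2 fun p q h ↦
      hinj n (congrArg Subtype.val h)
    exact NatTrans.mono_of_mono_app e
  have h1 : CompressesUpTo N (SSet.toTop.map e).hom := by
    refine compressesUpTo_of_mono e fun n hn x ↦ ?_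
    obtain ⟨p, hp⟩ := x
    obtain ⟨c, y, rfl⟩ := hocolimMk_surjective p
    -- At stage `0` the skeleton is empty. A simplex of dimension at most `N` is among its own
    -- tested faces, so it lifts.
    have hy : y ∈ (A (chainSource c)).obj _ := hp.resolve_right (by
      rw [SSet.skeleton_zero]
      exact id)
    obtain ⟨z, hz⟩ := mem_range_of_mem_liftedFaces hn hy
    exact ⟨hocolimMk c z, Subtype.ext (congrArg (hocolimMk c) hz)⟩
  have h2 := compressesUpTo_of_anodyne
    (anodyne_hocolimFiltration M A hA fun j ↦ anodyne_liftedFaces (hi j) (hg j)) N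
  have := h1.comp h2
  rw [← he, SSet.toTop.map_comp]
  exact this

variable {A B : Type u} [TopologicalSpace A] [TopologicalSpace B]

/-- The product of a space with an indiscrete space. -/
abbrev Thickening (A B : Type u) : Type u := B × Indiscrete (Option A)

/-- The functoriality of thickenings. -/
def thickeningMap {A' B' : Type u} [TopologicalSpace A'] [TopologicalSpace B'] (a : A → A')
    (b : C(B, B')) : C(Thickening A B, Thickening A' B') :=
  ⟨fun p ↦ (b p.1, Option.map a p.2), (b.continuous.comp continuous_fst).prodMk continuous_top⟩

/-- The zero section of a thickening. -/
def thickeningSection (A B : Type u) [TopologicalSpace B] : C(B, Thickening A B) :=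
  ⟨fun b ↦ (b, none), continuous_id.prodMk continuous_top⟩

/-- The injective map to a thickening given by a map. -/
def thickeningGraph (f : C(A, B)) : C(A, Thickening A B) :=
  ⟨fun a ↦ (f a, some a), f.continuous.prodMk continuous_top⟩

/-- The first coordinate follows the homotopy for `f`; the second may jump after time `0`, since
every function to an indiscrete space is continuous. -/
theorem LiftsRel.thickeningGraph {D : Type} [TopologicalSpace D] {S : Set D} {f : C(A, B)}
    (hf : LiftsRel D S f) : LiftsRel D S (thickeningGraph f) := by
  classical
  intro a b hab
  obtain ⟨a', ha', ⟨K⟩⟩ := hf a (ContinuousMap.fst.comp b) (fun x ↦ congrArg Prod.fst (hab x))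
  let k (p : I × D) : Indiscrete (Option A) := if p.1 = 0 then some (a' p.2) else (b p.2).2
  have hk0 : ∀ x, k (0, x) = some (a' x) := fun x ↦ if_pos rfl
  have hk1 : ∀ x, k (1, x) = (b x).2 := fun x ↦ if_neg one_ne_zero
  have hkS : ∀ t, ∀ x ∈ S, k (t, x) = some (a' x) := fun t x hx ↦ by
    by_cases ht : t = 0
    · exact if_pos ht
    · refine (if_neg ht).trans ?_
      exact (congrArg Prod.snd (hab ⟨x, hx⟩)).symm.trans (congrArg some (ha' ⟨x, hx⟩).symm)
  refine ⟨a', ha', ⟨⟨⟨⟨fun p ↦ (K p, k p), K.continuous.prodMk continuous_top⟩, fun x ↦ ?_,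
    fun x ↦ ?_⟩, fun t x hx ↦ ?_⟩⟩⟩
  · exact Prod.ext (K.apply_zero x) (hk0 x)
  · exact Prod.ext (K.apply_one x) (hk1 x)
  · exact Prod.ext (K.eq_fst t hx) (hkS t x hx)

theorem homotopic_thickeningSection (A : Type u) {B : Type u} [TopologicalSpace B] :
    ((thickeningSection A B).comp ContinuousMap.fst).Homotopic
      (ContinuousMap.id (Thickening A B)) := by
  classical
  let k (p : I × Thickening A B) : Indiscrete (Option A) := if p.1 = 0 then none else p.2.2
  refine ⟨⟨⟨fun p ↦ (p.2.1, k p), (continuous_fst.comp continuous_snd).prodMk continuous_top⟩,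
    fun x ↦ ?_, fun x ↦ ?_⟩⟩
  · exact Prod.ext rfl (if_pos rfl)
  · exact Prod.ext rfl (if_neg one_ne_zero)

theorem compressesUpTo_thickeningSection (A : Type u) {B : Type u} [TopologicalSpace B] (N : ℕ) : CompressesUpTo N (thickeningSection A B) :=
  CompressesUpTo.of_homotopyInverse (g := ContinuousMap.fst)
    (ContinuousMap.Homotopic.refl _) (homotopic_thickeningSection A)

/-- The objectwise thickening. -/
def thickeningFunctor (D D' : J ⥤ TopCat.{u}) : J ⥤ TopCat.{u} where
  obj j := TopCat.of (Thickening (D.obj j) (D'.obj j))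
  map f := TopCat.ofHom (thickeningMap (D.map f) (D'.map f).hom)
  map_id j := TopCat.hom_ext (ContinuousMap.ext fun p ↦ by
    have h : D.map (𝟙 j) = 𝟙 _ := D.map_id j
    have h' : D'.map (𝟙 j) = 𝟙 _ := D'.map_id j
    refine Prod.ext (x := thickeningMap (D.map (𝟙 j)) (D'.map (𝟙 j)).hom p) (y := p) ?_ ?_
    · exact ConcreteCategory.congr_hom h' p.1
    · change Option.map (D.map (𝟙 j)) p.2 = p.2
      rw [h]
      exact congrFun Option.map_id p.2)
  map_comp {i j k} f g := TopCat.hom_ext (ContinuousMap.ext fun p ↦ by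
    have h : D.map (f ≫ g) = D.map f ≫ D.map g := D.map_comp f g
    have h' : D'.map (f ≫ g) = D'.map f ≫ D'.map g := D'.map_comp f g
    refine Prod.ext (x := thickeningMap (D.map (f ≫ g)) (D'.map (f ≫ g)).hom p)
      (y := thickeningMap (D.map g) (D'.map g).hom (thickeningMap (D.map f) (D'.map f).hom p)) ?_ ?_
    · exact ConcreteCategory.congr_hom h' p.1
    · change Option.map (D.map (f ≫ g)) p.2 = Option.map (D.map g) (Option.map (D.map f) p.2)
      rw [h]
      exact (Option.map_map (D.map g) (D.map f) (show Option (D.obj i) from p.2)).symm)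

/-- Homotopy colimits of singular simplicial sets preserve connectivity. -/
theorem CompressesUpTo.hocolimMap_toSSet {D D' : J ⥤ TopCat.{u}} (g : D ⟶ D') {N : ℕ}
    (hg : ∀ j, CompressesUpTo N (g.app j).hom) :
    CompressesUpTo N (SSet.toTop.map (hocolimMap (Functor.whiskerRight g TopCat.toSSet))).hom := by
  let T := thickeningFunctor D D'
  let γ : D ⟶ T :=
    { app j := TopCat.ofHom (thickeningGraph (g.app j).hom)
      naturality i j f := by
        ext x
        exact Prod.ext (ConcreteCategory.congr_hom (g.naturality f) x) rfl }
  let s : D' ⟶ T := { app j := TopCat.ofHom (thickeningSection (D.obj j) (D'.obj j)) }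
  let π : T ⟶ D' := { app j := TopCat.ofHom ContinuousMap.fst }
  -- The map `g` factors as `γ` followed by `π`, and `π` is a left inverse of `s`. Both `γ` and `s`
  -- are injective, and two-out-of-three transfers the conclusion from `s` to `π`.
  have h1 := hocolimMap_of_injective γ (N := N)
    (fun j x y h ↦ Option.some_injective _ (congrArg Prod.snd h))
    (fun j i hi ↦ (hg j i hi).thickeningGraph)
  have h2 := hocolimMap_of_injective s (N := N) (fun j x y h ↦ congrArg Prod.fst h)
    (fun j ↦ compressesUpTo_thickeningSection _ N)
  have h3 : CompressesUpTo N
      (SSet.toTop.map (hocolimMap (Functor.whiskerRight π TopCat.toSSet))).hom := by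
    refine h2.of_comp ?_
    convert CompressesUpTo.refl using 1
    ext p
    exact toTop_map_comp_apply (hocolimMap (Functor.whiskerRight s TopCat.toSSet))
      (hocolimMap (Functor.whiskerRight π TopCat.toSSet)) p |>.symm.trans (toTop_map_id_apply p)
  convert h1.comp h3 using 1
  ext p
  exact toTop_map_comp_apply (hocolimMap (Functor.whiskerRight γ TopCat.toSSet))
      (hocolimMap (Functor.whiskerRight π TopCat.toSSet)) p

/-- Homotopy colimits preserve connectivity. -/
theorem CompressesUpTo.hocolimMap {X Y : J ⥤ SSet.{u}} (f : X ⟶ Y) {N : ℕ}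
    (hf : ∀ j, CompressesUpTo N (SSet.toTop.map (f.app j)).hom) :
    CompressesUpTo N (SSet.toTop.map (hocolimMap f)).hom :=
  of_singularRealization f (hocolimMap_toSSet (Functor.whiskerRight f SSet.toTop) hf)

end HocolimConnectivity

end

section

open CategoryTheory Opposite Simplicial Topology MonoidalCategory Limits

/-! ### Constant diagrams over a category with an initial object. -/

section ConstantDiagrams

variable {J : Type} [SmallCategory J]

/-- The projection from the homotopy colimit of a constant diagram. -/
def hocolimConstProj (J : Type) [SmallCategory J] (S : SSet.{u}) :
    hocolim ((Functor.const J).obj S) ⟶ S where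
  app _ := ↾fun p ↦ p.2
  naturality _ _ _ := rfl

/-- For a constant diagram the whiskered transformation is the identity, and reindexing along a
constant functor is the projection followed by the canonical map. -/
theorem homotopic_const_toHocolim (S : SSet.{u}) {F : J ⥤ J} {j : J}
    (α : F ⟶ (Functor.const J).obj j) :
    (SSet.toTop.map (hocolimConstProj J S ≫ toHocolim ((Functor.const J).obj S) j)).hom.Homotopic
      (SSet.toTop.map (hocolimReindex F ((Functor.const J).obj S))).hom :=
  homotopic_hocolimReindex α ((Functor.const J).obj S)

/-- The canonical map to the homotopy colimit of a constant diagram indexed by a category with an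
initial object is arbitrarily highly connected, being a homotopy equivalence. -/
theorem compressesUpTo_toHocolim_const (S : SSet.{u}) {z : J} (hz : IsInitial z) (j : J) (N : ℕ) :
    CompressesUpTo N (SSet.toTop.map (toHocolim ((Functor.const J).obj S) j)).hom := by
  let K := (Functor.const J).obj S
  -- The constant functor at `z` maps to the identity functor and to the constant functor at `j`.
  -- Hence the identity and the projection followed by the canonical map are homotopic to the same
  -- reindexing map.
  let α : (Functor.const J).obj z ⟶ 𝟭 J := { app i := hz.to i, naturality _ _ _ := hz.hom_ext _ _ }
  let β : (Functor.const J).obj z ⟶ (Functor.const J).obj j := (Functor.const J).map (hz.to j)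
  have h1 : (SSet.toTop.map (𝟙 (hocolim K))).hom.Homotopic
      (SSet.toTop.map (hocolimReindex ((Functor.const J).obj z) K)).hom :=
    homotopic_hocolimReindex α K
  have h2 := homotopic_const_toHocolim S β
  have h3 := h2.trans h1.symm
  refine CompressesUpTo.of_homotopyInverse (g := (SSet.toTop.map (hocolimConstProj J S)).hom) ?_ ?_
  · convert ContinuousMap.Homotopic.refl _ using 1
    ext p
    exact (toTop_map_id_apply p).symm.trans (toTop_map_comp_apply (toHocolim K j)
      (hocolimConstProj J S) p)
  · rw [SSet.toTop.map_comp, SSet.toTop.map_id] at h3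
    exact h3

end ConstantDiagrams

/-! ### The shift functor on `𝓘` and the approximation lemma. -/

namespace InjCat

/-- The empty set is an initial object. -/
def isInitialZero : IsInitial (InjCat.mk 0) :=
  IsInitial.ofUniqueHom (fun m ↦ (⟨fun i ↦ i.elim0, fun i ↦ i.elim0⟩ : Fin 0 ↪ Fin m.card))
    fun _ f ↦ DFunLike.ext (F := Fin 0 ↪ Fin _) f _ fun i ↦ i.elim0

/-- The injection `f ⊔ n`. -/
def shiftEmbedding {m m' : ℕ} (f : Fin m ↪ Fin m') (n : ℕ) : Fin (m + n) ↪ Fin (m' + n) :=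
  (finSumFinEquiv.symm.toEmbedding.trans (f.sumMap (.refl (Fin n)))).trans
    finSumFinEquiv.toEmbedding

theorem shiftEmbedding_inl {m m' : ℕ} (f : Fin m ↪ Fin m') (n : ℕ) (i : Fin m) :
    shiftEmbedding f n (finSumFinEquiv (Sum.inl i)) = finSumFinEquiv (Sum.inl (f i)) := by
  simp [shiftEmbedding]

theorem shiftEmbedding_inr {m m' : ℕ} (f : Fin m ↪ Fin m') (n : ℕ) (i : Fin n) :
    shiftEmbedding f n (finSumFinEquiv (Sum.inr i)) = finSumFinEquiv (Sum.inr i) := by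
  simp [shiftEmbedding]

/-- The functor `m ↦ m ⊔ n`. -/
def shift (n : ℕ) : InjCat ⥤ InjCat where
  obj m := ⟨m.card + n⟩
  map f := shiftEmbedding f n
  map_id m := by
    refine DFunLike.ext (F := Fin _ ↪ Fin _) _ _ fun i ↦ ?_
    obtain ⟨i, rfl⟩ := finSumFinEquiv.surjective i
    rcases i with i | i
    · exact shiftEmbedding_inl _ n i
    · exact shiftEmbedding_inr _ n i
  map_comp f g := by
    refine DFunLike.ext (F := Fin _ ↪ Fin _) _ _ fun i ↦ ?_
    obtain ⟨i, rfl⟩ := finSumFinEquiv.surjective i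
    rcases i with i | i
    · exact (shiftEmbedding_inl _ n i).trans (((congrArg (shiftEmbedding g n)
        (shiftEmbedding_inl f n i)).trans (shiftEmbedding_inl g n _)).symm)
    · exact (shiftEmbedding_inr _ n i).trans (((congrArg (shiftEmbedding g n)
        (shiftEmbedding_inr f n i)).trans (shiftEmbedding_inr g n _)).symm)

/-- The inclusion `m → m ⊔ n`. -/
def shiftInl (n : ℕ) : 𝟭 InjCat ⟶ shift n where
  app m := Function.Embedding.inl.trans (finSumFinEquiv (m := m.card) (n := n)).toEmbedding
  naturality _ _ f := DFunLike.ext (F := Fin _ ↪ Fin _) _ _ fun i ↦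
    (shiftEmbedding_inl f n i).symm

/-- The inclusion `n → m ⊔ n`. -/
def shiftInr (n : ℕ) : (Functor.const InjCat).obj (InjCat.mk n) ⟶ shift n where
  app m := Function.Embedding.inr.trans (finSumFinEquiv (m := m.card) (n := n)).toEmbedding
  naturality _ _ f := DFunLike.ext (F := Fin _ ↪ Fin _) _ _ fun i ↦
    (shiftEmbedding_inr f n i).symm

end InjCat

theorem CompressesUpTo.toTop_map_comp {A B C : SSet.{u}} {f : A ⟶ B} {g : B ⟶ C} {N : ℕ}
    (hf : CompressesUpTo N (SSet.toTop.map f).hom) (hg : CompressesUpTo N (SSet.toTop.map g).hom) :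
    CompressesUpTo N (SSet.toTop.map (f ≫ g)).hom := by
  rw [SSet.toTop.map_comp]
  exact hf.comp hg

theorem CompressesUpTo.of_toTop_map_comp {A B C : SSet.{u}} {f : A ⟶ B} {g : B ⟶ C} {N : ℕ}
    (hf : CompressesUpTo N (SSet.toTop.map f).hom)
    (hfg : CompressesUpTo N (SSet.toTop.map (f ≫ g)).hom) :
    CompressesUpTo N (SSet.toTop.map g).hom := by
  rw [SSet.toTop.map_comp] at hfg
  exact hf.of_comp hfg

/-- If all maps out of `X(n)` are `N`-connected, so is the canonical map `X(n) → X_{h𝓘}`. -/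
theorem compressesUpTo_toHocolim (X : ISpace.{u}) (n N : ℕ)
    (hX : ∀ (m : InjCat) (f : InjCat.mk n ⟶ m), CompressesUpTo N (SSet.toTop.map (X.map f)).hom) :
    CompressesUpTo N (SSet.toTop.map (toHocolim X (InjCat.mk n))).hom := by
  let T := InjCat.shift n
  let η := Functor.whiskerRight (InjCat.shiftInl n) X
  let c : (Functor.const InjCat).obj (X.obj (InjCat.mk n)) ⟶ T ⋙ X :=
    { app j := X.map ((InjCat.shiftInr n).app j)
      naturality i j f := by
        have h := (InjCat.shiftInr n).naturality f
        change 𝟙 _ ≫ X.map ((InjCat.shiftInr n).app j) =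
          X.map ((InjCat.shiftInr n).app i) ≫ X.map (T.map f)
        rw [← X.map_comp, ← h, X.map_comp]
        exact congrArg (· ≫ _) (X.map_id _).symm }
  have h1 : CompressesUpTo N (SSet.toTop.map (c.app (InjCat.mk n) ≫
      toHocolim (T ⋙ X) (InjCat.mk n))).hom := by
    rw [← toHocolim_naturality]
    exact (compressesUpTo_toHocolim_const _ InjCat.isInitialZero _ N).toTop_map_comp
      (CompressesUpTo.hocolimMap c fun j ↦ hX _ _)
  -- Two-out-of-three, since `n → n ⊔ n` itself induces an `N`-connected map.
  have h2 : CompressesUpTo N (SSet.toTop.map (toHocolim (T ⋙ X) (InjCat.mk n))).hom :=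
    CompressesUpTo.of_toTop_map_comp (hX _ _) h1
  -- The same map to the homotopy colimit is now preceded by the first inclusion of `n` into `n ⊔
  -- n`, which is a component of the transformation from the identity to `T`.
  have h3 : CompressesUpTo N (SSet.toTop.map (toHocolim X (InjCat.mk n) ≫ hocolimMap η)).hom := by
    have h := toHocolim_naturality η (InjCat.mk n)
    have h4 : CompressesUpTo N (SSet.toTop.map (η.app (InjCat.mk n) ≫
      toHocolim (T ⋙ X) (InjCat.mk n))).hom := CompressesUpTo.toTop_map_comp (hX _ _) h2
    rw [← h] at h4
    exact h4
  rw [SSet.toTop.map_comp] at h3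
  -- That transformation makes reindexing along `T` a left homotopy inverse of `hocolimMap η`.
  refine CompressesUpTo.cancel (r := (SSet.toTop.map (hocolimReindex T X)).hom) h3 ?_
  have h5 := homotopic_hocolimReindex (InjCat.shiftInl n) X
  have h6 : SSet.toTop.map (hocolimReindex (𝟭 InjCat) X) = 𝟙 _ := SSet.toTop.map_id (hocolim X)
  rw [h6, SSet.toTop.map_comp] at h5
  exact h5

end

/-- **Bökstedt's approximation lemma.** -/
theorem corollary2 (X : ISpace.{u}) (lam : ℕ → ℤ)
    (hmono : Monotone lam) (hunbdd : ¬ BddAbove (Set.range lam))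
    (hX : ∀ (k : ℕ) (m n : InjCat) (f : m ⟶ n), k ≤ m.card →
      SSetIsConnectedMap (lam k) (X.map f)) :
    ∀ n : ℕ, SSetIsConnectedMap (lam n) (toHocolim X (InjCat.mk n)) := by
  intro n
  -- A negative bound imposes no condition; a nonnegative one is a natural number, as
  -- `CompressesUpTo` requires.
  rcases lt_or_ge (lam n) 0 with h | h
  · exact ⟨fun h' ↦ absurd h' (by omega), fun h' ↦ absurd h' (by omega),
      fun i _ h' ↦ absurd h' (by omega), fun i _ h' ↦ absurd h' (by omega)⟩
  · refine (compressesUpTo_toHocolim X n (lam n).toNat fun m f ↦ ?_).isConnectedMap (by omega)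
    exact (hX n _ _ f le_rfl).compressesUpTo (by omega)
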